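/- Let $(z,w)=(x+iy,\,u+iv)$ be the coordinates of $\mathbb{C}^2$, and let $M=\{v=F(z,\bar z,u)\}$ be a Levi nondegenerate hypersurface graphed by a real-analytic function $F$ on an open set $\Omega\subset\mathbb{C}_z\times\mathbb{R}_u$. Write $(x_1,y_1)$ and $(x_1,y_1,x_2,y_2)$ for the 1-jets $(\dot x,\dot y)$ and the 2-jets $(\dot x,\dot y,\ddot x,\ddot y)$ of curves $u\mapsto(x(u),y(u))$ in $M$. A 1-jet at $p\in M$ is CR-transversal if the tangent vector with $(\dot u,\dot x,\dot y)=(1,x_1,y_1)$ does not lie in $T^c_pM=T_pM\cap iT_pM$; a 2-jet is CR-transversal if its 1-jet is. For a local biholomorphism $h$ let $h^{(2)}$ be its second prolongation, i.e. the induced map on 2-jets of curves. A normalizing map at $p$ is a local biholomorphism $\varphi$ of $\mathbb{C}^2$ sending $p$ to $0$ and $M$ near $p$ to a real-analytic hypersurface $v=z\bar z+O(6)$ near $0$, where $O(6)$ is a remainder for the weights $[z]=[\bar z]=1$, $[u]=2$. Put $$\Sigma_0=\{x_2=-2x_1^2y_1-2y_1^3,\ \ y_2=2x_1y_1^2+2x_1^3\}\subset\mathbb{R}^4,\qquad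 \Sigma_p=\varphi^{(2)-1}(\Sigma_0),$$ the latter being a set of CR-transversal 2-jets at $p$. Then: 1. At every $p\in M$ there exist normalizing maps, and $\Sigma_p$ does not depend on the normalizing map $\varphi$ at $p$. 2. To each such $M$ are associated two functions $A$, $B$, real-analytic on the open set of all CR-transversal 1-jets $(u,x,y,x_1,y_1)$ of $M$, such that for every $p=(u,x,y)\in M$ the surface $\Sigma_p$ is the graph $$x_2=A(u,x,y,x_1,y_1),\qquad y_2=B(u,x,y,x_1,y_1)$$ over the CR-transversal 1-jets at $p$. 3. The assignment of 2-jets to CR-transversal 1-jets is biholomorphically invariant: if a local biholomorphism $h$ sends $(M,p)$ to another such hypersurface $(M',p')$, with associated functions $A',B'$, and $(x_1,y_1)$ is a CR-transversal 1-jet of $M$ at $p$ whose image direction under $h$ has nonzero $u$-component, then $h^{(2)}$ sends the 2-jet $(x_1,y_1,A,B)$ to $(x_1',y_1',A',B')$, where $(x_1',y_1')$ is the image 1-jet, which is CR-transversal, and $A',B'$ are evaluated at $p'$ and $(x_1',y_1')$. 4. (Moser chains.) For every $p=(u_p,x_p,y_p)\in M$ and every CR-transversal 1-jet $(x_1^p,y_1^p)$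 at $p$, the system $$\ddot x=A(u,x,y,\dot x,\dot y),\qquad \ddot y=B(u,x,y,\dot x,\dot y)$$ has a solution $u\mapsto(x(u),y(u))$ near $u_p$ with $(x,y)(u_p)=(x_p,y_p)$ and $(\dot x,\dot y)(u_p)=(x_1^p,y_1^p)$, and two such solutions on an open interval containing $u_p$ coincide there. -/

import Mathlib

open Set Filter Topology Asymptotics

/-- A real-analytic hypersurface `M³ ⊂ ℂ²` graphed as `v = F(z, z̄, u)` over an open set `Ω` of
`(z, u) ∈ ℂ × ℝ`, in the coordinates `(z, w) = (x + i y, u + i v)` of `ℂ²`. -/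
structure AnalyticGraph where
  Ω : Set (ℂ × ℝ)
  isOpen : IsOpen Ω
  F : ℂ × ℝ → ℝ
  analytic : AnalyticOnNhd ℝ F Ω

namespace AnalyticGraph

noncomputable section

/-- The hypersurface as a subset of `ℂ²`. -/
def carrier (M : AnalyticGraph) : Set (ℂ × ℂ) :=
  {P | (P.1, P.2.re) ∈ M.Ω ∧ P.2.im = M.F (P.1, P.2.re)}

/-- The point of `M` above `(z, u)`. -/
def point (M : AnalyticGraph) (p : ℂ × ℝ) : ℂ × ℂ :=
  (p.1, (p.2 : ℂ) + (M.F p : ℂ) * Complex.I)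

/-- The defining function `ρ = F(z, z̄, u) - v`. -/
def rho (M : AnalyticGraph) (P : ℂ × ℂ) : ℝ :=
  M.F (P.1, P.2.re) - P.2.im

/-- `ξ ∈ T_p^c M = T_p M ∩ i T_p M`. -/
def CRTangent (M : AnalyticGraph) (p : ℂ × ℝ) (ξ : ℂ × ℂ) : Prop :=
  fderiv ℝ M.rho (M.point p) ξ = 0 ∧ fderiv ℝ M.rho (M.point p) (Complex.I • ξ) = 0

/-- Four times the Levi form `∑ ρ_{j k̄} ξ_j ξ̄_k` of `ρ`, written with the real Hessian of `ρ`. -/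
def leviForm (M : AnalyticGraph) (p : ℂ × ℝ) (ξ : ℂ × ℂ) : ℝ :=
  fderiv ℝ (fderiv ℝ M.rho) (M.point p) ξ ξ +
    fderiv ℝ (fderiv ℝ M.rho) (M.point p) (Complex.I • ξ) (Complex.I • ξ)

/-- Levi nondegeneracy at every point: as `T_p^c M` is a complex line, the Levi form is
nondegenerate on it if and only if it does not vanish on nonzero vectors. -/
def LeviNondegenerate (M : AnalyticGraph) : Prop :=
  ∀ p ∈ M.Ω, ∀ ξ : ℂ × ℂ, M.CRTangent p ξ → ξ ≠ 0 → M.leviForm p ξ ≠ 0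

/-- The tangent vector to `M` at the point above `p` with coordinates `(ẋ, ẏ, u̇) = (x₁, y₁, 1)`,
where `z₁ = x₁ + i y₁`. -/
def velocity (M : AnalyticGraph) (p : ℂ × ℝ) (z₁ : ℂ) : ℂ × ℂ :=
  (z₁, 1 + (fderiv ℝ M.F p (z₁, 1) : ℂ) * Complex.I)

/-- The 1-jet `z₁ = x₁ + i y₁` at `p` (of curves `u ↦ (x(u), y(u))`) is CR-transversal. -/
def CRTransversal (M : AnalyticGraph) (p : ℂ × ℝ) (z₁ : ℂ) : Prop :=
  ¬ M.CRTangent p (M.velocity p z₁)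

/-- The set of all CR-transversal 1-jets `(z, u, z₁)` of `M`. -/
def transversalJets (M : AnalyticGraph) : Set ((ℂ × ℝ) × ℂ) :=
  {q | q.1 ∈ M.Ω ∧ M.CRTransversal q.1 q.2}

/-- A curve in `M`, parametrized by `u`, with 2-jet `j = (z₁, z₂)` at `p`. -/
def jetCurve (M : AnalyticGraph) (p : ℂ × ℝ) (j : ℂ × ℂ) (t : ℝ) : ℂ × ℂ :=
  M.point (p.1 + j.1 * ((t - p.2 : ℝ) : ℂ) + j.2 * ((t - p.2 : ℝ) : ℂ) ^ 2 / 2, t)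

/-- Differentiation with respect to `U` along a parametrized curve: `d/dU = (1/U') d/dt`. -/
def derivWrt (U : ℝ → ℝ) (Z : ℝ → ℂ) (t : ℝ) : ℂ :=
  (deriv U t)⁻¹ • deriv Z t

/-- The 2-jet `(dz/du, d²z/du²)` of a parametrized curve `t ↦ (z(t), w(t))` in `ℂ²`,
where `u = Re w`; it is meaningful when `u' ≠ 0`. -/
def curveJet (c : ℝ → ℂ × ℂ) (t : ℝ) : ℂ × ℂ :=
  (derivWrt (fun s => (c s).2.re) (fun s => (c s).1) t,
    derivWrt (fun s => (c s).2.re)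
      (derivWrt (fun s => (c s).2.re) (fun s => (c s).1)) t)

/-- The second prolongation `h⁽²⁾` of a map `h`, on the 2-jets `(z₁, z₂)` of curves in `M` at `p`:
the 2-jet of the image curve. -/
def prolong (M : AnalyticGraph) (h : ℂ × ℂ → ℂ × ℂ) (p : ℂ × ℝ) (j : ℂ × ℂ) : ℂ × ℂ :=
  curveJet (h ∘ M.jetCurve p j) p.2

/-- The image under `h` of the direction of the 1-jet `z₁` at `p` has nonzero `u`-component, so
that the image is again a jet of a curve parametrized by `u`. -/
def ImageParamByU (M : AnalyticGraph) (h : ℂ × ℂ → ℂ × ℂ) (p : ℂ × ℝ) (z₁ : ℂ) : Prop :=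
  (fderiv ℝ h (M.point p) (M.velocity p z₁)).2.re ≠ 0

/-- `e` is a local biholomorphism of `ℂ²` sending `(M, p)` to `(M', p')`. -/
structure IsLocalBiholomorphism (e : OpenPartialHomeomorph (ℂ × ℂ) (ℂ × ℂ))
    (M : AnalyticGraph) (p : ℂ × ℝ) (M' : AnalyticGraph) (p' : ℂ × ℝ) : Prop where
  holo : DifferentiableOn ℂ e e.source
  holo_symm : DifferentiableOn ℂ e.symm e.target
  mem : p ∈ M.Ω
  mem' : p' ∈ M'.Ω
  mem_source : M.point p ∈ e.source
  map_point : e (M.point p) = M'.point p'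
  /-- `e` maps `M ∩ e.source` onto `M' ∩ e.target`. -/
  image : e.IsImage M.carrier M'.carrier

/-- `N` is of the form `v = z z̄ + O(6)` near the origin, with the weights `[z] = [z̄] = 1`,
`[u] = 2` in the remainder. -/
def IsNormalized (N : AnalyticGraph) : Prop :=
  (fun q : ℂ × ℝ => N.F q - ‖q.1‖ ^ 2) =O[𝓝 0] (fun q : ℂ × ℝ => ‖q.1‖ ^ 6 + |q.2| ^ 3)

/-- `φ` is a map (a translation of `p` to the origin followed by a biholomorphism fixing the
origin) normalizing `M` near `p` to some `v = z z̄ + O(6)` near `0`. -/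
def IsNormalizing (M : AnalyticGraph) (p : ℂ × ℝ)
    (φ : OpenPartialHomeomorph (ℂ × ℂ) (ℂ × ℂ)) : Prop :=
  ∃ N : AnalyticGraph, N.IsNormalized ∧ IsLocalBiholomorphism φ M p N 0

/-- The surface `Σ₀` in the 2-jet fiber `ℝ⁴ = {(x₁ + i y₁, x₂ + i y₂)}` above the origin. -/
def sigmaZero : Set (ℂ × ℂ) :=
  {j | j.2.re = -2 * j.1.re ^ 2 * j.1.im - 2 * j.1.im ^ 3 ∧
       j.2.im = 2 * j.1.re * j.1.im ^ 2 + 2 * j.1.re ^ 3}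

/-- The surface `Σ_p = φ⁽²⁾⁻¹(Σ₀)` in the fiber above `p` of 2-jets of CR-transversal curves. -/
def sigma (M : AnalyticGraph) (p : ℂ × ℝ) (φ : ℂ × ℂ → ℂ × ℂ) : Set (ℂ × ℂ) :=
  {j | M.CRTransversal p j.1 ∧ M.prolong φ p j ∈ sigmaZero}

/-- The curve `u ↦ ζ(u) = x(u) + i y(u)` in `M` is a CR-transversal solution on the open set `I`
of the system `ẍ = A(u, x, y, ẋ, ẏ)`, `ÿ = B(u, x, y, ẋ, ẏ)`. -/
def SolvesODE (M : AnalyticGraph) (A B : (ℂ × ℝ) × ℂ → ℝ) (I : Set ℝ) (ζ : ℝ → ℂ) : Prop :=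
  ∀ t ∈ I, ((ζ t, t), deriv ζ t) ∈ M.transversalJets ∧
    DifferentiableAt ℝ ζ t ∧
    HasDerivAt (fun s => (deriv ζ s).re) (A ((ζ t, t), deriv ζ t)) t ∧
    HasDerivAt (fun s => (deriv ζ s).im) (B ((ζ t, t), deriv ζ t)) t

end

end AnalyticGraph

/-! The model is the hyperquadric `v = z z̄`. A transversal complex line `z = α w` meets it in a
curve with 2-jet `(α, 2i|α|²α)` at the origin, and `Σ₀` is exactly the set of these 2-jets. The
isotropy group of the quadric at `0` permutes such lines, so it preserves `Σ₀`. The theorem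
transports this picture to every point of `M` by normalization up to weighted order 6.

Order 6 is what a 2-jet needs. A curve parametrized by `u` has `z = O(u)`, so its weighted size is
of order `√|u|`, and a remainder of weight 6 is `O(u³)` along it (`isBigO_baseCurve`).

Existence of normalizing maps. A quadratic map brings `M` at `p` to `v = z z̄ + O(3)`; it divides by
the Levi coefficient, which is where nondegeneracy enters. The terms of weight 3, 4 and 5 are then
removed by shears `(z + f, w + g)`, where `f`, `g` solve `Im g - 2 Re(z̄ f) = -(term)` on the
quadric. This equation is always solvable in these weights, and its solution is given by explicit
formulas, so everything depends analytically on `p` (`exists_analytic_normalizing`).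

Independence. Two normalizing maps differ by a biholomorphism between hypersurfaces `v = z z̄ +
O(6)`. Comparing weights 2 to 5 in `Im g = |f|² + O(6)` shows that the coefficients seen by 2-jets
are those of the quadric automorphism with `z`-component `λ(z + a w)/(1 - 2iāz - (r + i|a|²)w)`. A
direct identity (`JetRelations.jet_identity`) then shows that `Σ₀` goes to `Σ₀`. Together with
functoriality of prolongation (`prolong_comp`) this gives `sigma_eq`.

Graph and analyticity. For a fixed 1-jet, membership in `Σ_p` is a real affine equation in `z₂ = x₂
+ i y₂` with invertible linear part, because the normalizing map is an immersion on `M`. Cramer's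
rule gives `A + iB` in terms of the first two derivatives of the normalizing map, and the analytic
family of such maps makes it analytic.

Invariance is immediate from independence: a normalizing map for `(M', p')` composed with `h`
normalizes `(M, p)`. Chains are integral curves of an analytic vector field on the space of
transversal 1-jets, so Picard–Lindelöf applies. -/

/-! ### Two-jets of parametrized curves. -/

/-- The 2-jet `(dz/du, d²z/du²)` of a curve in `ℂ²` with first and second derivatives `X`, `Y`. -/
noncomputable def jetOf (X Y : ℂ × ℂ) : ℂ × ℂ :=
  (X.1 / (X.2.re : ℂ), ((X.2.re : ℂ) * Y.1 - (Y.2.re : ℂ) * X.1) / (X.2.re : ℂ) ^ 3)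

/-- A change of parameter `s ↦ t(s)` with `t' = a`, `t'' = b` turns the derivatives `X`, `Y` into `a
X`, `a² Y + b X`; the geometric 2-jet cannot see it. -/
theorem jetOf_reparam (X Y : ℂ × ℂ) (a b : ℝ) (ha : a ≠ 0) :
    jetOf (a • X) ((a ^ 2) • Y + b • X) = jetOf X Y := by
  have ha' : (a : ℂ) ≠ 0 := by exact_mod_cast ha
  by_cases hX : X.2.re = 0
  · ext1 <;> simp [jetOf, hX]
  have hX' : (X.2.re : ℂ) ≠ 0 := by exact_mod_cast hX
  ext1
  · simp only [jetOf, Prod.smul_fst, Prod.smul_snd, Complex.real_smul, Complex.re_ofReal_mul,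
      Complex.ofReal_mul]
    field_simp
  · simp only [jetOf, Prod.smul_fst, Prod.smul_snd, Complex.real_smul, Complex.re_ofReal_mul,
      Complex.ofReal_mul, Prod.fst_add, Prod.snd_add, Complex.add_re, Complex.ofReal_add]
    push_cast
    field_simp
    ring

theorem curveJet_eq_jetOf {c : ℝ → ℂ × ℂ} {c' : ℝ → ℂ × ℂ} {t : ℝ} {Y : ℂ × ℂ}
    (hc : ∀ᶠ s in 𝓝 t, HasDerivAt c (c' s) s) (hc' : HasDerivAt c' Y t)
    (h0 : (c' t).2.re ≠ 0) : AnalyticGraph.curveJet c t = jetOf (c' t) Y := by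
  have key : ∀ s, HasDerivAt c (c' s) s →
      HasDerivAt (fun s => (c s).2.re) (c' s).2.re s ∧ HasDerivAt (fun s => (c s).1) (c' s).1 s := by
    intro s hs
    exact ⟨(Complex.reCLM.comp (ContinuousLinearMap.snd ℝ ℂ ℂ)).hasFDerivAt.comp_hasDerivAt s hs,
      (ContinuousLinearMap.fst ℝ ℂ ℂ).hasFDerivAt.comp_hasDerivAt s hs⟩
  have e1 : AnalyticGraph.derivWrt (fun s => (c s).2.re) (fun s => (c s).1) =ᶠ[𝓝 t]
      fun s => ((c' s).2.re)⁻¹ • (c' s).1 := by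
    filter_upwards [hc] with s hs
    simp only [AnalyticGraph.derivWrt, (key s hs).1.deriv, (key s hs).2.deriv]
  have hU := (key t hc.self_of_nhds).1
  have d1 : HasDerivAt (fun s => (c' s).2.re) Y.2.re t :=
    (Complex.reCLM.comp (ContinuousLinearMap.snd ℝ ℂ ℂ)).hasFDerivAt.comp_hasDerivAt t hc'
  have d2 : HasDerivAt (fun s => (c' s).1) Y.1 t := (ContinuousLinearMap.fst ℝ ℂ ℂ).hasFDerivAt.comp_hasDerivAt t hc'
  have d3 := (d1.inv h0).smul d2
  have h0' : ((c' t).2.re : ℂ) ≠ 0 := by exact_mod_cast h0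
  unfold AnalyticGraph.curveJet jetOf
  ext1
  · change AnalyticGraph.derivWrt _ _ t = _
    rw [e1.self_of_nhds]
    simp [div_eq_inv_mul]
  · change AnalyticGraph.derivWrt _ _ t = _
    unfold AnalyticGraph.derivWrt at e1 ⊢
    rw [e1.deriv_eq, hU.deriv]
    erw [d3.deriv]
    simp only [Complex.real_smul]
    push_cast
    simp only [Pi.inv_apply]
    push_cast
    field_simp
    ring

/-! ### Second-order chain rule. -/

section SecondDerivative

variable {E F : Type*} [NormedAddCommGroup E] [NormedSpace ℝ E] [NormedAddCommGroup F]
  [NormedSpace ℝ F]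

theorem hasDerivAt_comp_twice {Ψ : E → F} {b b' : ℝ → E} {t : ℝ} {Y : E}
    (hΨ : ContDiffAt ℝ 2 Ψ (b t)) (hb : ∀ᶠ s in 𝓝 t, HasDerivAt b (b' s) s)
    (hb' : HasDerivAt b' Y t) :
    (∀ᶠ s in 𝓝 t, HasDerivAt (Ψ ∘ b) (fderiv ℝ Ψ (b s) (b' s)) s) ∧
      HasDerivAt (fun s => fderiv ℝ Ψ (b s) (b' s))
        (fderiv ℝ (fderiv ℝ Ψ) (b t) (b' t) (b' t) + fderiv ℝ Ψ (b t) Y) t := by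
  have hbc : ContinuousAt b t := hb.self_of_nhds.continuousAt
  have hd : ∀ᶠ x in 𝓝 (b t), DifferentiableAt ℝ Ψ x := by
    filter_upwards [hΨ.eventually (by simp)] with x hx
    exact hx.differentiableAt (by simp)
  refine ⟨?_, ?_⟩
  · filter_upwards [hb, hbc.eventually hd] with s h1 h2
    exact h2.hasFDerivAt.comp_hasDerivAt s h1
  · have h1 : DifferentiableAt ℝ (fderiv ℝ Ψ) (b t) :=
      (hΨ.fderiv_right (m := 1) (by norm_num)).differentiableAt (by simp)
    have h2 := h1.hasFDerivAt.comp_hasDerivAt t hb.self_of_nhds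
    exact h2.clm_apply hb'

end SecondDerivative

/-! ### The second prolongation and its functoriality. -/

namespace AnalyticGraph

/-- The base curve `u ↦ (z(u), u)` with 2-jet `j` at `p`. -/
noncomputable def baseCurve (p : ℂ × ℝ) (j : ℂ × ℂ) (t : ℝ) : ℂ × ℝ :=
  (p.1 + j.1 * ((t - p.2 : ℝ) : ℂ) + j.2 * ((t - p.2 : ℝ) : ℂ) ^ 2 / 2, t)

theorem baseCurve_self (p : ℂ × ℝ) (j : ℂ × ℂ) : baseCurve p j p.2 = p := by
  ext1 <;> simp [baseCurve]

theorem hasDerivAt_baseCurve (p : ℂ × ℝ) (j : ℂ × ℂ) (t : ℝ) :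
    HasDerivAt (baseCurve p j) (j.1 + j.2 * ((t - p.2 : ℝ) : ℂ), 1) t := by
  have h1 : HasDerivAt (fun t : ℝ => ((t - p.2 : ℝ) : ℂ)) 1 t := by
    simpa using ((hasDerivAt_id t).sub_const p.2).ofReal_comp
  refine HasDerivAt.prodMk ?_ (hasDerivAt_id t)
  have := ((h1.const_mul j.1).const_add p.1).add (((h1.pow 2).const_mul j.2).div_const 2)
  refine this.congr_deriv ?_
  simp only [Nat.add_one_sub_one, pow_one, mul_one]
  push_cast
  ring

theorem hasDerivAt_baseCurve_deriv (p : ℂ × ℝ) (j : ℂ × ℂ) (t : ℝ) :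
    HasDerivAt (fun t : ℝ => ((j.1 + j.2 * ((t - p.2 : ℝ) : ℂ), 1) : ℂ × ℝ)) (j.2, 0) t := by
  have h1 : HasDerivAt (fun t : ℝ => ((t - p.2 : ℝ) : ℂ)) 1 t := by
    simpa using ((hasDerivAt_id t).sub_const p.2).ofReal_comp
  refine HasDerivAt.prodMk ?_ (hasDerivAt_const _ _)
  simpa using (h1.const_mul j.2).const_add j.1

/-- The first derivative, in the base parameter, of the image under `Ψ` of a curve with jet `j`. -/
noncomputable def firstOrder (Ψ : ℂ × ℝ → ℂ × ℂ) (p : ℂ × ℝ) (z₁ : ℂ) : ℂ × ℂ :=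
  fderiv ℝ Ψ p (z₁, 1)

/-- The second derivative, in the base parameter, of the image under `Ψ` of a curve with jet `j`. -/
noncomputable def secondOrder (Ψ : ℂ × ℝ → ℂ × ℂ) (p : ℂ × ℝ) (j : ℂ × ℂ) : ℂ × ℂ :=
  fderiv ℝ (fderiv ℝ Ψ) p (j.1, 1) (j.1, 1) + fderiv ℝ Ψ p (j.2, 0)

/-- Only the first two derivatives of `h ∘ M.point` on the base enter the prolongation, so
prolongations become algebra in these derivatives. -/
theorem prolong_eq (M : AnalyticGraph) {h : ℂ × ℂ → ℂ × ℂ} {p : ℂ × ℝ} (j : ℂ × ℂ)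
    (hΨ : ContDiffAt ℝ 2 (h ∘ M.point) p) (h0 : (firstOrder (h ∘ M.point) p j.1).2.re ≠ 0) :
    M.prolong h p j =
      jetOf (firstOrder (h ∘ M.point) p j.1) (secondOrder (h ∘ M.point) p j) := by
  have hself := baseCurve_self p j
  obtain ⟨h1, h2⟩ := hasDerivAt_comp_twice (b := baseCurve p j)
    (b' := fun t => (j.1 + j.2 * ((t - p.2 : ℝ) : ℂ), 1)) (t := p.2) (by rwa [hself])
    (Eventually.of_forall (hasDerivAt_baseCurve p j)) (hasDerivAt_baseCurve_deriv p j p.2)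
  have := curveJet_eq_jetOf h1 h2 (by simpa [hself, firstOrder] using h0)
  unfold prolong
  refine Eq.trans this ?_
  simp [hself, firstOrder, secondOrder]

/-- The projection of `ℂ²` to the base coordinates `(z, u)`. -/
noncomputable def base : ℂ × ℂ →L[ℝ] ℂ × ℝ :=
  (ContinuousLinearMap.fst ℝ ℂ ℂ).prod (Complex.reCLM.comp (ContinuousLinearMap.snd ℝ ℂ ℂ))

@[simp] theorem base_apply (P : ℂ × ℂ) : base P = (P.1, P.2.re) := rfl

@[simp] theorem base_point (M : AnalyticGraph) (p : ℂ × ℝ) : base (M.point p) = p := by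
  ext1 <;> simp [point]

theorem point_base {M : AnalyticGraph} {P : ℂ × ℂ} (hP : P ∈ M.carrier) :
    M.point (base P) = P := by
  ext1
  · rfl
  · apply Complex.ext
    · simp [point]
    · simpa [point] using hP.2.symm

theorem point_mem_carrier (M : AnalyticGraph) {p : ℂ × ℝ} (hp : p ∈ M.Ω) :
    M.point p ∈ M.carrier := by
  simpa [carrier, point] using hp

/-- The left side keeps the old parameter along the intermediate curve, the right side first
reparametrizes that curve by its own `u`. The two differ by a change of parameter, so
`jetOf_reparam` applies with `a = Re X₂` and `b = Re Y₂`. -/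
theorem jetOf_comp_linear {L : ℂ × ℝ →L[ℝ] ℂ × ℂ} {B : ℂ × ℝ →L[ℝ] ℂ × ℝ →L[ℝ] ℂ × ℂ}
    (X Y : ℂ × ℂ) (hX : X.2.re ≠ 0) :
    jetOf (L (base X)) (B (base X) (base X) + L (base Y)) =
      jetOf (L ((jetOf X Y).1, 1))
        (B ((jetOf X Y).1, 1) ((jetOf X Y).1, 1) + L ((jetOf X Y).2, 0)) := by
  have hX' : (X.2.re : ℂ) ≠ 0 := by exact_mod_cast hX
  have e1 : base X = X.2.re • ((jetOf X Y).1, (1 : ℝ)) := by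
    ext1
    · simp [jetOf]; field_simp
    · simp
  have e2 : base Y = (X.2.re ^ 2) • ((jetOf X Y).2, (0 : ℝ)) + Y.2.re • ((jetOf X Y).1, (1 : ℝ)) := by
    ext1
    · simp [jetOf]; field_simp; ring
    · simp
  rw [← jetOf_reparam (L ((jetOf X Y).1, 1)) _ X.2.re Y.2.re hX, e1, e2]
  congr 1
  · rw [map_smul]
  · simp only [map_smul, map_add, smul_apply, smul_add, smul_smul, add_assoc, pow_two]

/-- Since `h` maps `M` into `M'`, the image curve is recovered from its base projection, and `g ∘ h`
on `M` factors through the base of `M'`. The chain rule and `jetOf_comp_linear` then finish the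
argument. -/
theorem prolong_comp {M M' : AnalyticGraph} {h g : ℂ × ℂ → ℂ × ℂ} {p p' : ℂ × ℝ} (j : ℂ × ℂ)
    (hh : ContDiffAt ℝ 2 (h ∘ M.point) p) (hg : ContDiffAt ℝ 2 (g ∘ M'.point) p')
    (hp : h (M.point p) = M'.point p')
    (hmem : ∀ᶠ q in 𝓝 p, h (M.point q) ∈ M'.carrier)
    (h0 : (firstOrder (h ∘ M.point) p j.1).2.re ≠ 0)
    (h1 : (firstOrder ((g ∘ h) ∘ M.point) p j.1).2.re ≠ 0) :
    M.prolong (g ∘ h) p j = M'.prolong g p' (M.prolong h p j) := by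
  have hself := baseCurve_self p j
  have hpp : base ((h ∘ M.point) p) = p' := by rw [Function.comp, hp, base_point]
  have heq : (g ∘ h) ∘ M.point =ᶠ[𝓝 p] (g ∘ M'.point) ∘ (base ∘ (h ∘ M.point)) := by
    filter_upwards [hmem] with q hq
    simp only [Function.comp]
    rw [point_base hq]
  obtain ⟨a1, a2⟩ := hasDerivAt_comp_twice (Ψ := h ∘ M.point) (b := baseCurve p j)
    (b' := fun t => (j.1 + j.2 * ((t - p.2 : ℝ) : ℂ), 1)) (t := p.2) (by rwa [hself])
    (Eventually.of_forall (hasDerivAt_baseCurve p j)) (hasDerivAt_baseCurve_deriv p j p.2)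
  have b1 := a1.mono fun s hs => base.hasFDerivAt.comp_hasDerivAt s hs
  have b2 := base.hasFDerivAt.comp_hasDerivAt p.2 a2
  obtain ⟨c1, c2⟩ := hasDerivAt_comp_twice (Ψ := g ∘ M'.point) (t := p.2)
    (by simpa only [Function.comp_apply, hself, hp, base_point] using hg) b1 b2
  have heq' : (g ∘ h) ∘ M.jetCurve p j =ᶠ[𝓝 p.2]
      (g ∘ M'.point) ∘ (base ∘ ((h ∘ M.point) ∘ baseCurve p j)) := by
    have hc : Tendsto (baseCurve p j) (𝓝 p.2) (𝓝 p) := by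
      have := (hasDerivAt_baseCurve p j p.2).continuousAt
      rwa [ContinuousAt, hself] at this
    filter_upwards [hc.eventually heq] with s hs
    exact hs
  have c1' := (c1.and heq'.eventuallyEq_nhds).mono fun s hs => hs.1.congr_of_eventuallyEq hs.2
  have hL : fderiv ℝ ((g ∘ h) ∘ M.point) p =
      (fderiv ℝ (g ∘ M'.point) p').comp (base.comp (fderiv ℝ (h ∘ M.point) p)) := by
    rw [heq.fderiv_eq]
    have d1 : HasFDerivAt (h ∘ M.point) (fderiv ℝ (h ∘ M.point) p) p :=
      (hh.differentiableAt (by simp)).hasFDerivAt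
    have d2 : HasFDerivAt (g ∘ M'.point) (fderiv ℝ (g ∘ M'.point) p')
        ((base ∘ (h ∘ M.point)) p) := by
      rw [Function.comp_apply, hpp]
      exact (hg.differentiableAt (by simp)).hasFDerivAt
    exact (d2.comp p (base.hasFDerivAt.comp p d1)).fderiv
  have e1 := curveJet_eq_jetOf c1' c2 (by
    have := h1
    rw [firstOrder, hL] at this
    simp only [Function.comp_apply, hself, hp, base_point, sub_self, Complex.ofReal_zero, mul_zero,
      add_zero]
    exact this)
  have e2 := prolong_eq M j hh h0
  set X := firstOrder (h ∘ M.point) p j.1 with hX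
  set Y := secondOrder (h ∘ M.point) p j with hY
  have key : M.prolong (g ∘ h) p j = jetOf (fderiv ℝ (g ∘ M'.point) p' (base X))
      (fderiv ℝ (fderiv ℝ (g ∘ M'.point)) p' (base X) (base X) +
        fderiv ℝ (g ∘ M'.point) p' (base Y)) := by
    refine Eq.trans e1 ?_
    simp only [Function.comp_apply, hself, hp, base_point, sub_self, Complex.ofReal_zero, mul_zero,
      add_zero]
    rfl
  rw [key, jetOf_comp_linear X Y h0, e2]
  refine (prolong_eq M' _ hg ?_).symm
  have h1' : (fderiv ℝ (g ∘ M'.point) p' (base X)).2.re ≠ 0 := by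
    have := h1
    rwa [firstOrder, hL] at this
  have e3 : base X = X.2.re • ((jetOf X Y).1, (1 : ℝ)) := by
    have hX' : (X.2.re : ℂ) ≠ 0 := by exact_mod_cast h0
    ext1
    · simp [jetOf]; field_simp
    · simp
  rw [e3, map_smul] at h1'
  intro h2
  apply h1'
  rw [firstOrder] at h2
  simp only [Prod.smul_snd, Complex.real_smul, Complex.re_ofReal_mul, h2, mul_zero]

end AnalyticGraph

/-! ### Holomorphic functions of two variables are analytic. -/

section Osgood

open Metric Complex

/-- The normalized contour integral over a circle, on continuous functions on that circle. -/
noncomputable def contourIntegral (b : ℂ) {R : ℝ} (hR : 0 ≤ R) : C(sphere b R, ℂ) →L[ℂ] ℂ :=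
  LinearMap.mkContinuous
    { toFun := fun g => (2 * Real.pi * I : ℂ)⁻¹ •
        ∫ θ in (0 : ℝ)..2 * Real.pi, deriv (circleMap b R) θ • g ⟨circleMap b R θ, circleMap_mem_sphere b hR θ⟩
      map_add' := by
        intro g g'
        rw [← smul_add, ← intervalIntegral.integral_add]
        · simp [mul_add]
        all_goals
          apply Continuous.intervalIntegrable
          simp only [deriv_circleMap]
          fun_prop
      map_smul' := by
        intro c g
        have h : ∀ θ, deriv (circleMap b R) θ •
            (c • g) ⟨circleMap b R θ, circleMap_mem_sphere b hR θ⟩ =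
            c • (deriv (circleMap b R) θ • g ⟨circleMap b R θ, circleMap_mem_sphere b hR θ⟩) :=
          fun θ => by rw [ContinuousMap.smul_apply, smul_comm]
        simp only [h, intervalIntegral.integral_smul, RingHom.id_apply]
        rw [smul_comm] }
    (‖(2 * Real.pi * I : ℂ)⁻¹‖ * (R * |2 * Real.pi - 0|)) (by
      intro g
      simp only [LinearMap.coe_mk, AddHom.coe_mk]
      rw [norm_smul, mul_assoc ‖_‖]
      refine mul_le_mul_of_nonneg_left ?_ (norm_nonneg _)
      rw [mul_right_comm]
      apply intervalIntegral.norm_integral_le_of_norm_le_const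
      intro θ _
      rw [norm_smul]
      gcongr
      · simp [abs_of_nonneg hR]
      · exact g.norm_coe_le_norm _)

theorem contourIntegral_apply (b : ℂ) {R : ℝ} (hR : 0 ≤ R) (g : C(sphere b R, ℂ)) (g' : ℂ → ℂ)
    (h : ∀ η : sphere b R, g η = g' η) :
    contourIntegral b hR g = (2 * Real.pi * I : ℂ)⁻¹ • ∮ η in C(b, R), g' η := by
  simp only [contourIntegral, LinearMap.mkContinuous_apply, LinearMap.coe_mk, AddHom.coe_mk, h,
    circleIntegral]

/-- The Cauchy kernel is seen as one map `w ↦ (η - w)⁻¹` into the Banach algebra of continuous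
functions of `η` on the circle. For `w` in the disc `η - w` is a unit there, and inversion is
analytic at units. -/
theorem exists_analyticAt_kernel (b : ℂ) {R : ℝ} (hR : 0 < R) :
    ∃ κ : ℂ → C(sphere b R, ℂ), AnalyticAt ℂ κ b ∧
      ∀ w ∈ ball b R, ∀ η : sphere b R, κ w η = ((η : ℂ) - w)⁻¹ := by
  let ι : C(sphere b R, ℂ) := ⟨fun η => (η : ℂ), continuous_subtype_val⟩
  have hne : ∀ w ∈ ball b R, ∀ η : sphere b R, (η : ℂ) - w ≠ 0 := by
    intro w hw η h0
    have h1 : (η : ℂ) = w := sub_eq_zero.1 h0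
    have h2 := η.2
    rw [h1, mem_sphere] at h2
    rw [mem_ball, h2] at hw
    exact lt_irrefl _ hw
  have hunit : ∀ w (hw : w ∈ ball b R), ∃ u : C(sphere b R, ℂ)ˣ,
      (u : C(sphere b R, ℂ)) = ι - algebraMap ℂ _ w ∧
      ∀ η, (↑u⁻¹ : C(sphere b R, ℂ)) η = ((η : ℂ) - w)⁻¹ := by
    intro w hw
    refine ⟨⟨ι - algebraMap ℂ _ w, ⟨fun η => ((η : ℂ) - w)⁻¹,
      (continuous_subtype_val.sub continuous_const).inv₀ (hne w hw)⟩, ?_, ?_⟩, rfl, fun η => rfl⟩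
    · ext η
      simpa [ι] using mul_inv_cancel₀ (hne w hw η)
    · ext η
      simpa [ι] using inv_mul_cancel₀ (hne w hw η)
  refine ⟨fun w => Ring.inverse (ι - algebraMap ℂ _ w), ?_, ?_⟩
  · obtain ⟨u, hu, -⟩ := hunit b (mem_ball_self hR)
    have h1 : AnalyticAt ℂ Ring.inverse (ι - algebraMap ℂ C(sphere b R, ℂ) b) := by
      rw [← hu]
      exact analyticAt_inverse u
    have h2 : AnalyticAt ℂ (fun w => ι - algebraMap ℂ C(sphere b R, ℂ) w) b :=
      analyticAt_const.fun_sub ((algebraMapCLM ℂ C(sphere b R, ℂ)).analyticAt b)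
    exact AnalyticAt.fun_comp (f := fun w => ι - algebraMap ℂ C(sphere b R, ℂ) w) h1 h2
  · intro w hw η
    obtain ⟨u, hu, hu'⟩ := hunit w hw
    simp only [← hu, Ring.inverse_unit, hu']

/-- **Osgood's lemma**: a holomorphic function of two variables is analytic. -/
theorem DifferentiableOn.analyticAt_prod {f : ℂ × ℂ → ℂ} {U : Set (ℂ × ℂ)} (hU : IsOpen U)
    (hf : DifferentiableOn ℂ f U) {x : ℂ × ℂ} (hx : x ∈ U) : AnalyticAt ℂ f x := by
  obtain ⟨a, b⟩ := x
  obtain ⟨R, hR, hRU⟩ : ∃ R > 0, closedBall a R ×ˢ closedBall b R ⊆ U := by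
    obtain ⟨R, hR, h⟩ := Metric.nhds_basis_closedBall.mem_iff.1 (hU.mem_nhds hx)
    exact ⟨R, hR, by rwa [closedBall_prod_same]⟩
  have hd1 : ∀ w ∈ closedBall b R, DifferentiableOn ℂ (fun z => f (z, w)) (closedBall a R) := by
    intro w hw
    exact hf.comp (by fun_prop) (fun z hz => hRU ⟨hz, hw⟩)
  have hd2 : ∀ z ∈ closedBall a R, DifferentiableOn ℂ (fun w => f (z, w)) (closedBall b R) := by
    intro z hz
    exact hf.comp (by fun_prop) (fun w hw => hRU ⟨hz, hw⟩)
  let Fc : C(closedBall a R × sphere b R, ℂ) := ⟨fun q => f (q.1, q.2), by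
    refine hf.continuousOn.comp_continuous (by fun_prop) ?_
    exact fun q => hRU ⟨q.1.2, sphere_subset_closedBall q.2.2⟩⟩
  classical
  let G : ℂ → C(sphere b R, ℂ) := fun z => if h : z ∈ closedBall a R then Fc.curry ⟨z, h⟩ else 0
  have hGv : ∀ z ∈ closedBall a R, ∀ η : sphere b R, G z η = f (z, η) := by
    intro z hz η
    simp only [G, dif_pos hz]
    rfl
  have hGc : ContinuousOn G (closedBall a R) := by
    rw [continuousOn_iff_continuous_domRestrict]
    convert Fc.curry.continuous using 1
    ext z η
    simp only [domRestrict_apply, hGv z z.2]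
    rfl
  have hGs : ContinuousOn G (sphere a R) := hGc.mono sphere_subset_closedBall
  -- The Banach-valued Cauchy integral of `G` is analytic and agrees with `G` pointwise in `η`, by
  -- the scalar Cauchy formula in `z`.
  have hG : AnalyticAt ℂ G a := by
    have hcirc : CircleIntegrable G a (⟨R, hR.le⟩ : NNReal) := hGs.circleIntegrable hR.le
    have h1 := (hasFPowerSeriesOn_cauchy_integral hcirc hR).analyticAt
    refine h1.congr ?_
    filter_upwards [ball_mem_nhds a hR] with z hz
    ext η
    rw [hGv z (ball_subset_closedBall hz)]
    have h2 := ((hd1 η (sphere_subset_closedBall η.2)).diffContOnCl_ball (c := a) (R := R)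
      Subset.rfl).two_pi_i_inv_smul_circleIntegral_sub_inv_smul hz
    refine Eq.trans ?_ h2
    have h3 : CircleIntegrable (fun ξ => (ξ - z)⁻¹ • G ξ) a R := by
      refine ContinuousOn.circleIntegrable hR.le (ContinuousOn.fun_smul ?_ hGs)
      refine (continuousOn_id.sub continuousOn_const).inv₀ ?_
      intro ξ hξ h0
      have : ξ = z := sub_eq_zero.1 h0
      rw [mem_sphere, this] at hξ
      rw [mem_ball, hξ] at hz
      exact lt_irrefl _ hz
    have h4 := (ContinuousMap.evalCLM ℂ η).intervalIntegral_comp_comm h3.out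
    simp only [ContinuousMap.smul_apply]
    congr 1
    refine Eq.trans h4.symm ?_
    simp only [circleIntegral]
    refine intervalIntegral.integral_congr fun θ _ => ?_
    simp only [ContinuousMap.evalCLM_apply, ContinuousMap.smul_apply]
    congr 2
    exact hGv _ (sphere_subset_closedBall (circleMap_mem_sphere a hR.le θ)) η
  obtain ⟨κ, hκ, hκv⟩ := exists_analyticAt_kernel b hR
  -- Cauchy's formula in `w` writes `f(z, w)` as a continuous linear functional of the product of
  -- two analytic one-variable maps.
  have hA : AnalyticAt ℂ (fun q : ℂ × ℂ => contourIntegral b hR.le (κ q.2 * G q.1)) (a, b) := by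
    refine (ContinuousLinearMap.analyticAt _ _).fun_comp ?_
    exact (hκ.fun_comp (f := Prod.snd) (x := (a, b)) analyticAt_snd).mul
      (hG.fun_comp (f := Prod.fst) (x := (a, b)) analyticAt_fst)
  refine hA.congr ?_
  filter_upwards [prod_mem_nhds (ball_mem_nhds a hR) (ball_mem_nhds b hR)] with q hq
  have hz := ball_subset_closedBall hq.1
  rw [contourIntegral_apply b hR.le _ (fun η => (η - q.2)⁻¹ • f (q.1, η))]
  · exact ((hd2 q.1 hz).diffContOnCl_ball (c := b) (R := R)
      Subset.rfl).two_pi_i_inv_smul_circleIntegral_sub_inv_smul hq.2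
  · intro η
    simp only [ContinuousMap.mul_apply, hκv q.2 hq.2, hGv q.1 hz, smul_eq_mul]

theorem DifferentiableOn.analyticAt_prod_prod {f : ℂ × ℂ → ℂ × ℂ} {U : Set (ℂ × ℂ)} (hU : IsOpen U)
    (hf : DifferentiableOn ℂ f U) {x : ℂ × ℂ} (hx : x ∈ U) : AnalyticAt ℂ f x :=
  (DifferentiableOn.analyticAt_prod hU hf.fst hx).prod
    (DifferentiableOn.analyticAt_prod hU hf.snd hx)

end Osgood

/-! ### Tangent vectors and the CR structure of a graph. -/

namespace AnalyticGraph

theorem analyticAt_point (M : AnalyticGraph) {p : ℂ × ℝ} (hp : p ∈ M.Ω) :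
    AnalyticAt ℝ M.point p := by
  have h1 : AnalyticAt ℝ (fun q : ℂ × ℝ => (q.2 : ℂ)) p :=
    (Complex.ofRealCLM.analyticAt _).fun_comp analyticAt_snd
  have h2 : AnalyticAt ℝ (fun q : ℂ × ℝ => (M.F q : ℂ)) p :=
    (Complex.ofRealCLM.analyticAt _).fun_comp (M.analytic p hp)
  exact analyticAt_fst.prod (h1.add (h2.mul analyticAt_const))

/-- The tangent vector to `M` above the base vector `v`. -/
noncomputable def tangentLift (M : AnalyticGraph) (p : ℂ × ℝ) (v : ℂ × ℝ) : ℂ × ℂ :=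
  (v.1, (v.2 : ℂ) + (fderiv ℝ M.F p v : ℂ) * Complex.I)

@[simp] theorem base_tangentLift (M : AnalyticGraph) (p v : ℂ × ℝ) :
    base (M.tangentLift p v) = v := by
  ext1 <;> simp [tangentLift]

theorem velocity_eq_tangentLift (M : AnalyticGraph) (p : ℂ × ℝ) (z₁ : ℂ) :
    M.velocity p z₁ = M.tangentLift p (z₁, 1) := by
  simp [velocity, tangentLift]

theorem tangentLift_smul (M : AnalyticGraph) (p v : ℂ × ℝ) (a : ℝ) :
    M.tangentLift p (a • v) = a • M.tangentLift p v := by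
  ext1
  · rfl
  · simp [tangentLift, mul_assoc]

theorem fderiv_point (M : AnalyticGraph) {p : ℂ × ℝ} (hp : p ∈ M.Ω) (v : ℂ × ℝ) :
    fderiv ℝ M.point p v = M.tangentLift p v := by
  have hF : HasFDerivAt M.F (fderiv ℝ M.F p) p := (M.analytic p hp).differentiableAt.hasFDerivAt
  have h1 : HasFDerivAt (fun q : ℂ × ℝ => (q.2 : ℂ))
      (Complex.ofRealCLM.comp (ContinuousLinearMap.snd ℝ ℂ ℝ)) p :=
    (Complex.ofRealCLM.comp (ContinuousLinearMap.snd ℝ ℂ ℝ)).hasFDerivAt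
  have h2 : HasFDerivAt (fun q : ℂ × ℝ => (M.F q : ℂ))
      (Complex.ofRealCLM.comp (fderiv ℝ M.F p)) p := Complex.ofRealCLM.hasFDerivAt.comp p hF
  have h3 := (hasFDerivAt_fst (𝕜 := ℝ) (p := p)).prodMk (h1.add (h2.mul_const Complex.I))
  rw [show M.point = fun q : ℂ × ℝ => (q.1, (q.2 : ℂ) + (M.F q : ℂ) * Complex.I) from rfl]
  erw [h3.fderiv]
  ext1
  · rfl
  · simp [tangentLift, mul_comm]

theorem hasFDerivAt_rho (M : AnalyticGraph) {P : ℂ × ℂ} (hP : base P ∈ M.Ω) :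
    HasFDerivAt M.rho ((fderiv ℝ M.F (base P)).comp base -
      Complex.imCLM.comp (ContinuousLinearMap.snd ℝ ℂ ℂ)) P := by
  have hF : HasFDerivAt M.F (fderiv ℝ M.F (base P)) (base P) :=
    (M.analytic _ hP).differentiableAt.hasFDerivAt
  exact (hF.comp P base.hasFDerivAt).sub
    (Complex.imCLM.comp (ContinuousLinearMap.snd ℝ ℂ ℂ)).hasFDerivAt

theorem fderiv_rho_point (M : AnalyticGraph) {p : ℂ × ℝ} (hp : p ∈ M.Ω) (ξ : ℂ × ℂ) :
    fderiv ℝ M.rho (M.point p) ξ = fderiv ℝ M.F p (base ξ) - ξ.2.im := by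
  rw [(M.hasFDerivAt_rho (by rwa [base_point])).fderiv, base_point]
  rfl

theorem fderiv_rho_eq_zero_iff (M : AnalyticGraph) {p : ℂ × ℝ} (hp : p ∈ M.Ω) (ξ : ℂ × ℂ) :
    fderiv ℝ M.rho (M.point p) ξ = 0 ↔ M.tangentLift p (base ξ) = ξ := by
  rw [M.fderiv_rho_point hp]
  constructor
  · intro h
    ext1
    · rfl
    · apply Complex.ext
      · simp [tangentLift]
      · simpa [tangentLift, sub_eq_zero] using h
  · intro h
    have := congrArg (fun x : ℂ × ℂ => x.2.im) h
    simpa [tangentLift, sub_eq_zero] using this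

theorem CRTangent_smul (M : AnalyticGraph) {p : ℂ × ℝ} {ξ : ℂ × ℂ} (a : ℝ)
    (h : M.CRTangent p ξ) : M.CRTangent p (a • ξ) := by
  refine ⟨by rw [map_smul, h.1, smul_zero], ?_⟩
  rw [smul_comm, map_smul, h.2, smul_zero]

/-- The velocity is always tangent to `M`, so only `i` times it matters. That vector has base part
`(i z₁, -dF(z₁, 1))` and imaginary part `1`. -/
theorem CRTransversal_iff (M : AnalyticGraph) {p : ℂ × ℝ} (hp : p ∈ M.Ω) (z₁ : ℂ) :
    M.CRTransversal p z₁ ↔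
      fderiv ℝ M.F p (Complex.I * z₁, -fderiv ℝ M.F p (z₁, 1)) ≠ 1 := by
  unfold CRTransversal CRTangent
  have h1 : fderiv ℝ M.rho (M.point p) (M.velocity p z₁) = 0 := by
    rw [M.fderiv_rho_eq_zero_iff hp, velocity_eq_tangentLift, base_tangentLift]
  rw [M.fderiv_rho_point hp (Complex.I • _)]
  simp only [h1, true_and]
  simp [velocity, sub_eq_zero]

theorem isOpen_transversalJets (M : AnalyticGraph) : IsOpen M.transversalJets := by
  have h1 : M.transversalJets = {q : (ℂ × ℝ) × ℂ | q.1 ∈ M.Ω} ∩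
      (fun q : (ℂ × ℝ) × ℂ => fderiv ℝ M.F q.1 (Complex.I * q.2, -fderiv ℝ M.F q.1 (q.2, 1))) ⁻¹'
        {x | x ≠ 1} := by
    ext q
    simp only [transversalJets, mem_ofPred_eq, mem_inter_iff, mem_preimage]
    exact and_congr_right fun hq => M.CRTransversal_iff hq _
  have h0 : IsOpen {q : (ℂ × ℝ) × ℂ | q.1 ∈ M.Ω} := M.isOpen.preimage continuous_fst
  rw [h1]
  refine ContinuousOn.isOpen_inter_preimage ?_ h0 isOpen_ne
  have hD : ContinuousOn (fun q : (ℂ × ℝ) × ℂ => fderiv ℝ M.F q.1)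
      {q : (ℂ × ℝ) × ℂ | q.1 ∈ M.Ω} :=
    (M.analytic.fderiv.continuousOn).comp continuousOn_fst fun q hq => hq
  exact hD.clm_apply (ContinuousOn.prodMk (by fun_prop)
    (hD.clm_apply (by fun_prop)).neg)

/-! ### Local biholomorphisms: groupoid laws and action on tangent vectors. -/

namespace IsLocalBiholomorphism

variable {e : OpenPartialHomeomorph (ℂ × ℂ) (ℂ × ℂ)} {M M' M'' : AnalyticGraph}
  {p p' p'' : ℂ × ℝ}

theorem symm (h : IsLocalBiholomorphism e M p M' p') :
    IsLocalBiholomorphism e.symm M' p' M p where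
  holo := h.holo_symm
  holo_symm := by simpa using h.holo
  mem := h.mem'
  mem' := h.mem
  mem_source := by
    rw [← h.map_point]
    exact e.map_source h.mem_source
  map_point := by rw [← h.map_point, e.left_inv h.mem_source]
  image := h.image.symm

theorem trans {e' : OpenPartialHomeomorph (ℂ × ℂ) (ℂ × ℂ)}
    (h : IsLocalBiholomorphism e M p M' p') (h' : IsLocalBiholomorphism e' M' p' M'' p'') :
    IsLocalBiholomorphism (e.trans e') M p M'' p'' where
  holo := by
    rw [e.coe_trans, e.trans_source]
    exact h'.holo.comp (h.holo.mono inter_subset_left) fun x hx => hx.2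
  holo_symm := by
    rw [e.coe_trans_symm, e.trans_target]
    exact h.holo_symm.comp (h'.holo_symm.mono inter_subset_left) fun x hx => hx.2
  mem := h.mem
  mem' := h'.mem'
  mem_source := by
    rw [e.trans_source]
    exact ⟨h.mem_source, by rw [mem_preimage, h.map_point]; exact h'.mem_source⟩
  map_point := by rw [e.coe_trans, Function.comp, h.map_point, h'.map_point]
  image := by
    intro x hx
    rw [e.trans_source] at hx
    exact (h'.image hx.2).trans (h.image hx.1)

theorem analyticAt (h : IsLocalBiholomorphism e M p M' p') : AnalyticAt ℂ e (M.point p) :=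
  DifferentiableOn.analyticAt_prod_prod e.open_source h.holo h.mem_source

theorem analyticAt_comp_point (h : IsLocalBiholomorphism e M p M' p') :
    AnalyticAt ℝ (e ∘ M.point) p :=
  h.analyticAt.restrictScalars.comp (M.analyticAt_point h.mem)

theorem eventually_mem (h : IsLocalBiholomorphism e M p M' p') :
    ∀ᶠ q in 𝓝 p, e (M.point q) ∈ M'.carrier := by
  filter_upwards [(M.analyticAt_point h.mem).continuousAt.eventually
    (e.open_source.mem_nhds h.mem_source), M.isOpen.mem_nhds h.mem] with q h1 h2
  exact (h.image h1).2 (M.point_mem_carrier h2)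

theorem hasFDerivAt (h : IsLocalBiholomorphism e M p M' p') :
    HasFDerivAt e (fderiv ℝ e (M.point p)) (M.point p) :=
  h.analyticAt.differentiableAt.restrictScalars ℝ |>.hasFDerivAt

theorem fderiv_smul (h : IsLocalBiholomorphism e M p M' p') (c : ℂ) (ξ : ℂ × ℂ) :
    fderiv ℝ e (M.point p) (c • ξ) = c • fderiv ℝ e (M.point p) ξ := by
  rw [h.analyticAt.differentiableAt.fderiv_restrictScalars ℝ]
  simp

theorem firstOrder_eq (h : IsLocalBiholomorphism e M p M' p') (z₁ : ℂ) :
    firstOrder (e ∘ M.point) p z₁ = fderiv ℝ e (M.point p) (M.velocity p z₁) := by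
  rw [firstOrder, (h.hasFDerivAt.comp p
    (M.analyticAt_point h.mem).differentiableAt.hasFDerivAt).fderiv, velocity_eq_tangentLift,
    ← M.fderiv_point h.mem]
  rfl

theorem fderiv_symm_fderiv (h : IsLocalBiholomorphism e M p M' p') (ξ : ℂ × ℂ) :
    fderiv ℝ e.symm (M'.point p') (fderiv ℝ e (M.point p) ξ) = ξ := by
  have h1 := h.symm.hasFDerivAt
  rw [← h.map_point] at h1
  have h2 := h1.comp (M.point p) h.hasFDerivAt
  have h3 : e.symm ∘ e =ᶠ[𝓝 (M.point p)] id := by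
    filter_upwards [e.open_source.mem_nhds h.mem_source] with x hx
    exact e.left_inv hx
  have h4 := (h2.congr_of_eventuallyEq h3.symm).unique (hasFDerivAt_id _)
  rw [← h.map_point]
  exact DFunLike.congr_fun h4 ξ

/-- Differentiating `M'.point ∘ base ∘ e ∘ M.point = e ∘ M.point`, valid near `p`, shows that the
image of a tangent vector is the lift of its base part, hence tangent. -/
theorem fderiv_rho_map (h : IsLocalBiholomorphism e M p M' p') {ξ : ℂ × ℂ}
    (hξ : fderiv ℝ M.rho (M.point p) ξ = 0) :
    fderiv ℝ M'.rho (M'.point p') (fderiv ℝ e (M.point p) ξ) = 0 := by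
  rw [M.fderiv_rho_eq_zero_iff h.mem, ← M.fderiv_point h.mem] at hξ
  rw [M'.fderiv_rho_eq_zero_iff h.mem']
  have h1 := h.hasFDerivAt.comp p (M.analyticAt_point h.mem).differentiableAt.hasFDerivAt
  have h2 : HasFDerivAt (base ∘ (e ∘ M.point)) _ p := base.hasFDerivAt.comp p h1
  have h3 : HasFDerivAt M'.point (fderiv ℝ M'.point p') ((base ∘ (e ∘ M.point)) p) := by
    simp only [Function.comp_apply, h.map_point, base_point]
    exact (M'.analyticAt_point h.mem').differentiableAt.hasFDerivAt
  have h4 : M'.point ∘ (base ∘ (e ∘ M.point)) =ᶠ[𝓝 p] e ∘ M.point := by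
    filter_upwards [h.eventually_mem] with q hq
    exact point_base hq
  have h5 := DFunLike.congr_fun (((h3.comp p h2).congr_of_eventuallyEq h4.symm).unique h1) (base ξ)
  simp only [ContinuousLinearMap.comp_apply, hξ] at h5
  rw [← M'.fderiv_point h.mem']
  exact h5

theorem CRTangent_map (h : IsLocalBiholomorphism e M p M' p') {ξ : ℂ × ℂ}
    (hξ : M.CRTangent p ξ) : M'.CRTangent p' (fderiv ℝ e (M.point p) ξ) := by
  refine ⟨h.fderiv_rho_map hξ.1, ?_⟩
  rw [← h.fderiv_smul]
  exact h.fderiv_rho_map hξ.2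

theorem not_CRTangent_map (h : IsLocalBiholomorphism e M p M' p') {ξ : ℂ × ℂ}
    (hξ : ¬ M.CRTangent p ξ) : ¬ M'.CRTangent p' (fderiv ℝ e (M.point p) ξ) := by
  intro h'
  have := h.symm.CRTangent_map h'
  rw [h.fderiv_symm_fderiv] at this
  exact hξ this

theorem fderiv_rho_velocity (h : IsLocalBiholomorphism e M p M' p') (z₁ : ℂ) :
    fderiv ℝ M'.rho (M'.point p') (fderiv ℝ e (M.point p) (M.velocity p z₁)) = 0 := by
  apply h.fderiv_rho_map
  rw [M.fderiv_rho_eq_zero_iff h.mem, velocity_eq_tangentLift, base_tangentLift]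

/-- The image of a CR-transversal 1-jet, when it is a jet of curves parametrized by `u`, is
CR-transversal. -/
theorem CRTransversal_map (h : IsLocalBiholomorphism e M p M' p') {z₁ : ℂ}
    (hz : M.CRTransversal p z₁) (h0 : M.ImageParamByU e p z₁) (z₂ : ℂ) :
    M'.CRTransversal p' (M.prolong e p (z₁, z₂)).1 := by
  have e1 := M.prolong_eq (z₁, z₂) h.analyticAt_comp_point.contDiffAt (by
    rw [h.firstOrder_eq]
    exact h0)
  rw [e1]
  set X := firstOrder (e ∘ M.point) p z₁ with hX
  have hX0 : X.2.re ≠ 0 := by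
    rw [hX, h.firstOrder_eq]
    exact h0
  have h1 : M'.tangentLift p' (base X) = X := by
    rw [← M'.fderiv_rho_eq_zero_iff h.mem', hX, h.firstOrder_eq]
    exact h.fderiv_rho_velocity z₁
  have h2 : base X = X.2.re • (X.1 / (X.2.re : ℂ), (1 : ℝ)) := by
    have hX' : (X.2.re : ℂ) ≠ 0 := by exact_mod_cast hX0
    ext1
    · simp; field_simp
    · simp
  intro h3
  refine h.not_CRTangent_map hz ?_
  rw [← h.firstOrder_eq, ← hX, ← h1, h2, tangentLift_smul, ← velocity_eq_tangentLift]
  exact M'.CRTangent_smul _ h3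

end IsLocalBiholomorphism

/-! ### First-order geometry of normalized hypersurfaces. -/

section Normalized

variable {N : AnalyticGraph}

theorem IsNormalized.isBigO_sq (hN : N.IsNormalized) :
    N.F =O[𝓝 0] fun q : ℂ × ℝ => ‖q - 0‖ ^ 2 := by
  have h1 : (fun q : ℂ × ℝ => ‖q.1‖ ^ 6 + |q.2| ^ 3) =O[𝓝 0] fun q : ℂ × ℝ => ‖q - 0‖ ^ 2 := by
    refine IsBigO.of_bound 2 ?_
    filter_upwards [Metric.closedBall_mem_nhds (0 : ℂ × ℝ) one_pos] with q hq
    have hq1 : ‖q‖ ≤ 1 := by simpa using hq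
    have h1 : ‖q.1‖ ^ 6 ≤ ‖q‖ ^ 2 := calc
      ‖q.1‖ ^ 6 ≤ ‖q‖ ^ 6 := by gcongr; exact norm_fst_le q
      _ ≤ ‖q‖ ^ 2 := pow_le_pow_of_le_one (norm_nonneg _) hq1 (by norm_num)
    have h2 : |q.2| ^ 3 ≤ ‖q‖ ^ 2 := calc
      |q.2| ^ 3 ≤ ‖q‖ ^ 3 := by gcongr; exact norm_snd_le q
      _ ≤ ‖q‖ ^ 2 := pow_le_pow_of_le_one (norm_nonneg _) hq1 (by norm_num)
    rw [Real.norm_of_nonneg (by positivity), Real.norm_of_nonneg (by positivity), sub_zero]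
    linarith
  have h2 : (fun q : ℂ × ℝ => ‖q.1‖ ^ 2) =O[𝓝 0] fun q : ℂ × ℝ => ‖q - 0‖ ^ 2 := by
    refine IsBigO.of_bound 1 (Eventually.of_forall fun q => ?_)
    rw [Real.norm_of_nonneg (by positivity), Real.norm_of_nonneg (by positivity), sub_zero, one_mul]
    gcongr
    exact norm_fst_le q
  simpa using (IsBigO.trans hN h1).add h2

theorem IsNormalized.F_zero (hN : N.IsNormalized) : N.F 0 = 0 := by
  obtain ⟨c, hc⟩ := hN.isBigO_sq.bound
  simpa using hc.self_of_nhds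

theorem IsNormalized.point_zero (hN : N.IsNormalized) : N.point 0 = 0 := by
  ext1 <;> simp [point, hN.F_zero]

theorem IsNormalized.fderiv_zero (hN : N.IsNormalized) : fderiv ℝ N.F 0 = 0 :=
  (hN.isBigO_sq.hasFDerivAt (by norm_num)).fderiv

/-- At the origin `F` and `dF` vanish, so the tangent space is `v = 0` and its complex part is `w =
0`. A tangent vector with `u̇ = 0` is therefore CR. -/
theorem IsNormalized.snd_re_ne_zero (hN : N.IsNormalized) (h0 : (0 : ℂ × ℝ) ∈ N.Ω) {ξ : ℂ × ℂ}
    (h1 : fderiv ℝ N.rho (N.point 0) ξ = 0) (h2 : ¬ N.CRTangent 0 ξ) : ξ.2.re ≠ 0 := by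
  intro h3
  apply h2
  refine ⟨h1, ?_⟩
  rw [N.fderiv_rho_point h0, hN.fderiv_zero]
  simp [h3]

/-- Consequently prolonging a CR-transversal jet by a normalizing map never meets a vanishing
`u`-derivative. -/
theorem IsLocalBiholomorphism.imageParamByU {e : OpenPartialHomeomorph (ℂ × ℂ) (ℂ × ℂ)}
    {M : AnalyticGraph} {p : ℂ × ℝ} (h : IsLocalBiholomorphism e M p N 0) (hN : N.IsNormalized)
    {z₁ : ℂ} (hz : M.CRTransversal p z₁) : M.ImageParamByU e p z₁ :=
  hN.snd_re_ne_zero h.mem' (h.fderiv_rho_velocity z₁) (h.not_CRTangent_map hz)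

end Normalized

end AnalyticGraph

/-! ### Weighted orders of vanishing -/

/-- The weighted size of `(z, u)`, with the weights `[z] = 1`, `[u] = 2`. -/
noncomputable def wt (q : ℂ × ℝ) : ℝ := ‖q.1‖ + √|q.2|

/-- `f = O(k)` at the origin, for the weights `[z] = 1`, `[u] = 2`. -/
def WO {E : Type*} [Norm E] (k : ℕ) (f : ℂ × ℝ → E) : Prop :=
  f =O[𝓝 0] fun q => wt q ^ k

theorem wt_nonneg (q : ℂ × ℝ) : 0 ≤ wt q := by unfold wt; positivity

theorem continuous_wt : Continuous wt := by unfold wt; fun_prop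

theorem tendsto_wt : Tendsto wt (𝓝 0) (𝓝 0) := by
  have := continuous_wt.tendsto 0
  simpa [wt] using this

theorem norm_fst_le_wt (q : ℂ × ℝ) : ‖q.1‖ ≤ wt q := by unfold wt; linarith [Real.sqrt_nonneg |q.2|]

theorem abs_snd_le_wt (q : ℂ × ℝ) : |q.2| ≤ wt q ^ 2 := by
  have h : √|q.2| ≤ wt q := by unfold wt; linarith [norm_nonneg q.1]
  calc |q.2| = √|q.2| ^ 2 := (Real.sq_sqrt (abs_nonneg _)).symm
    _ ≤ wt q ^ 2 := by gcongr

theorem eventually_wt_le {ε : ℝ} (hε : 0 < ε) : ∀ᶠ q in 𝓝 (0 : ℂ × ℝ), wt q ≤ ε :=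
  tendsto_wt.eventually (Iic_mem_nhds hε)

theorem eventually_norm_le_wt : ∀ᶠ q in 𝓝 (0 : ℂ × ℝ), ‖q‖ ≤ wt q := by
  filter_upwards [eventually_wt_le one_pos] with q hq
  refine max_le (norm_fst_le_wt q) ?_
  calc ‖q.2‖ ≤ wt q ^ 2 := abs_snd_le_wt q
    _ ≤ wt q := by nlinarith [wt_nonneg q]

namespace WO

section

variable {E : Type*} [SeminormedAddCommGroup E] {k l : ℕ} {f g : ℂ × ℝ → E}

theorem mono (h : k ≤ l) (hf : WO l f) : WO k f := by
  refine IsBigO.trans hf (IsBigO.of_bound 1 ?_)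
  filter_upwards [eventually_wt_le one_pos] with q hq
  have := wt_nonneg q
  rw [Real.norm_of_nonneg (by positivity), Real.norm_of_nonneg (by positivity), one_mul]
  exact pow_le_pow_of_le_one this hq h

theorem add (hf : WO k f) (hg : WO k g) : WO k fun q => f q + g q := IsBigO.add hf hg

theorem sub (hf : WO k f) (hg : WO k g) : WO k fun q => f q - g q := IsBigO.sub hf hg

theorem zero : WO k fun _ => (0 : E) := isBigO_zero _ _

theorem sum {ι : Type*} {s : Finset ι} {f : ι → ℂ × ℝ → E} (h : ∀ i ∈ s, WO k (f i)) :
    WO k fun q => ∑ i ∈ s, f i q := IsBigO.fun_sum h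

theorem of_norm_le {F : Type*} [SeminormedAddCommGroup F] {g : ℂ × ℝ → F} (hf : WO k f)
    (h : ∀ q, ‖g q‖ ≤ ‖f q‖) : WO k g := (IsBigO.of_bound 1 (Eventually.of_forall fun q => by
      simpa using h q)).trans hf

theorem congr (hf : WO k f) (h : ∀ q, f q = g q) : WO k g := by
  rwa [show g = f from (funext h).symm]

end

section Ring

variable {E : Type*} [NormedRing E] {k l : ℕ} {f g f' g' : ℂ × ℝ → E}

theorem mul (hf : WO k f) (hg : WO l g) : WO (k + l) fun q => f q * g q := by
  unfold WO
  simp only [pow_add]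
  exact IsBigO.mul hf hg

theorem const_mul (c : E) (hf : WO k f) : WO k fun q => c * f q := IsBigO.const_mul_left hf c

theorem pow [NormOneClass E] (hf : WO k f) (n : ℕ) : WO (k * n) fun q => f q ^ n := by
  have := IsBigO.pow hf n
  simpa only [WO, pow_mul] using this

/-- A perturbation of the factors of one weight higher perturbs the product by one weight higher.
This permits replacing a hypersurface by the quadric in leading terms. -/
theorem mul_sub_mul (hf : WO k f) (hf' : WO (k + 1) fun q => f' q - f q) (hg : WO l g)
    (hg' : WO (l + 1) fun q => g' q - g q) :
    WO (k + l + 1) fun q => f' q * g' q - f q * g q := by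
  have h1 : WO (k + l + 1) fun q => (f' q - f q) * (g' q - g q) :=
    (hf'.mul hg').mono (by omega)
  have h2 : WO (k + l + 1) fun q => f q * (g' q - g q) := (hf.mul hg').mono (by omega)
  have h3 : WO (k + l + 1) fun q => (f' q - f q) * g q := (hf'.mul hg).mono (by omega)
  exact ((h1.add h2).add h3).congr fun q => by noncomm_ring

theorem pow_sub_pow [NormOneClass E] (hf : WO k f) (hf' : WO (k + 1) fun q => f' q - f q) (n : ℕ) :
    WO (k * n + 1) fun q => f' q ^ n - f q ^ n := by
  induction n with
  | zero => simpa using (WO.zero (E := E) (k := 1))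
  | succ n ih =>
    have := mul_sub_mul (hf.pow n) ih hf hf'
    simpa only [pow_succ, Nat.mul_succ] using this

end Ring

theorem re {k : ℕ} {f : ℂ × ℝ → ℂ} (hf : WO k f) : WO k fun q => (f q).re :=
  hf.of_norm_le fun q => Complex.abs_re_le_norm (f q)

theorem im {k : ℕ} {f : ℂ × ℝ → ℂ} (hf : WO k f) : WO k fun q => (f q).im :=
  hf.of_norm_le fun q => Complex.abs_im_le_norm (f q)

theorem conj {k : ℕ} {f : ℂ × ℝ → ℂ} (hf : WO k f) : WO k fun q => (starRingEnd ℂ) (f q) :=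
  hf.of_norm_le fun q => by simp

theorem ofReal {k : ℕ} {f : ℂ × ℝ → ℝ} (hf : WO k f) : WO k fun q => (f q : ℂ) :=
  hf.of_norm_le fun q => by simp

end WO

theorem WO_fst : WO 1 fun q : ℂ × ℝ => q.1 :=
  IsBigO.of_bound 1 (Eventually.of_forall fun q => by
    simpa [abs_of_nonneg (wt_nonneg q)] using norm_fst_le_wt q)

theorem WO_snd : WO 2 fun q : ℂ × ℝ => q.2 :=
  IsBigO.of_bound 1 (Eventually.of_forall fun q => by
    simpa using abs_snd_le_wt q)

theorem WO_of_isBigO_norm_pow {E : Type*} [SeminormedAddCommGroup E] {f : ℂ × ℝ → E} {k : ℕ}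
    (h : f =O[𝓝 0] fun q => ‖q‖ ^ k) : WO k f := by
  refine h.trans (IsBigO.of_bound 1 ?_)
  filter_upwards [eventually_norm_le_wt] with q hq
  have := wt_nonneg q
  rw [Real.norm_of_nonneg (by positivity), Real.norm_of_nonneg (by positivity), one_mul]
  gcongr

theorem wt_scale (q : ℂ × ℝ) {t : ℝ} (ht : 0 ≤ t) : wt ((t : ℂ) * q.1, t ^ 2 * q.2) = t * wt q := by
  simp only [wt, norm_mul, Complex.norm_real, Real.norm_eq_abs, abs_mul, abs_of_nonneg ht, abs_pow]
  rw [Real.sqrt_mul (by positivity), Real.sqrt_sq ht]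
  ring

theorem tendsto_scale (q : ℂ × ℝ) :
    Tendsto (fun t : ℝ => (((t : ℂ) * q.1, t ^ 2 * q.2) : ℂ × ℝ)) (𝓝[>] 0) (𝓝 0) := by
  have h : Continuous fun t : ℝ => (((t : ℂ) * q.1, t ^ 2 * q.2) : ℂ × ℝ) := by fun_prop
  have := h.tendsto 0
  simp only [Complex.ofReal_zero, zero_mul, ne_eq, OfNat.ofNat_ne_zero, not_false_eq_true,
    zero_pow] at this
  exact this.mono_left nhdsWithin_le_nhds

/-- Along an orbit of the dilations `(z, u) ↦ (t z, t² u)` a weighted order becomes an ordinary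
order in `t`, so weighted homogeneous parts can be separated as coefficients of powers of `t`. -/
theorem WO.scale {E : Type*} [SeminormedAddCommGroup E] {k : ℕ} {f : ℂ × ℝ → E} (hf : WO k f)
    (q : ℂ × ℝ) : (fun t : ℝ => f ((t : ℂ) * q.1, t ^ 2 * q.2)) =O[𝓝[>] 0] fun t : ℝ => t ^ k := by
  have h1 := IsBigO.comp_tendsto hf (tendsto_scale q)
  refine h1.trans (IsBigO.of_bound (wt q ^ k) ?_)
  filter_upwards [self_mem_nhdsWithin] with t ht
  rw [Function.comp_apply, wt_scale q (le_of_lt ht), mul_pow, norm_mul, mul_comm,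
    Real.norm_of_nonneg (pow_nonneg (wt_nonneg q) k)]

theorem coeff_eq_zero_of_isBigO {n k : ℕ} {c : ℕ → ℝ}
    (h : (fun t : ℝ => ∑ m ∈ Finset.range n, c m * t ^ m) =O[𝓝[>] 0] fun t : ℝ => t ^ k) :
    ∀ m < k, m < n → c m = 0 := by
  induction k generalizing n c with
  | zero => intro m hm; omega
  | succ k ih =>
    rcases n with _ | n
    · intro m _ hm; omega
    have h0 : c 0 = 0 := by
      have h1 : Tendsto (fun t : ℝ => t ^ (k + 1)) (𝓝[>] 0) (𝓝 0) := by
        have : Continuous fun t : ℝ => t ^ (k + 1) := by fun_prop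
        have := this.tendsto 0
        simp only [ne_eq, Nat.add_eq_zero_iff, one_ne_zero, and_false, not_false_eq_true,
          zero_pow] at this
        exact this.mono_left nhdsWithin_le_nhds
      have h2 := h.trans_tendsto h1
      have h3 : Continuous fun t : ℝ => ∑ m ∈ Finset.range (n + 1), c m * t ^ m := by fun_prop
      have h4 := (h3.tendsto 0).mono_left (nhdsWithin_le_nhds (s := Ioi 0))
      have h5 := tendsto_nhds_unique h4 h2
      rw [Finset.sum_range_succ'] at h5
      simpa using h5
    have h1 : (fun t : ℝ => ∑ m ∈ Finset.range n, c (m + 1) * t ^ m) =O[𝓝[>] 0]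
        fun t : ℝ => t ^ k := by
      have h2 := (isBigO_refl (fun t : ℝ => t⁻¹) (𝓝[>] 0)).mul h
      refine (h2.congr' ?_ ?_)
      · filter_upwards [self_mem_nhdsWithin] with t ht
        have ht' : t ≠ 0 := ne_of_gt ht
        rw [Finset.sum_range_succ', h0, zero_mul, add_zero, Finset.mul_sum]
        refine Finset.sum_congr rfl fun m _ => ?_
        field_simp
        ring
      · filter_upwards [self_mem_nhdsWithin] with t ht
        have ht' : t ≠ 0 := ne_of_gt ht
        field_simp
        ring
    intro m hm hmn
    rcases m with _ | m
    · exact h0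
    · exact ih h1 m (by omega) (by omega)

/-! ### Weighted Taylor expansion with parameters -/

theorem ContinuousMultilinearMap.apply_sum_smul {𝕜 V W : Type*} [NontriviallyNormedField 𝕜]
    [NormedAddCommGroup V] [NormedSpace 𝕜 V] [NormedAddCommGroup W] [NormedSpace 𝕜 W] {n d : ℕ}
    (m : V [×n]→L[𝕜] W) (e : Fin d → V) (y : Fin d → 𝕜) :
    m (fun _ => ∑ j, y j • e j) = ∑ r : Fin n → Fin d, (∏ i, y (r i)) • m fun i => e (r i) := by
  rw [m.map_sum (fun _ j => y j • e j)]
  refine Finset.sum_congr rfl fun r _ => ?_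
  rw [m.map_smul_univ (fun i => y (r i)) (fun i => e (r i))]

/-- The number of occurrences of `j` among the values of `r`. -/
def occ {n d : ℕ} (r : Fin n → Fin d) (j : Fin d) : ℕ := (Finset.univ.filter fun i => r i = j).card

theorem occ_le {n d : ℕ} (r : Fin n → Fin d) (j : Fin d) : occ r j ≤ n := by
  have := Finset.card_le_univ (Finset.univ.filter fun i => r i = j)
  rwa [Fintype.card_fin] at this

theorem prod_eq_prod_pow_occ {𝕜 : Type*} [CommMonoid 𝕜] {n d : ℕ} (r : Fin n → Fin d)
    (y : Fin d → 𝕜) : ∏ i, y (r i) = ∏ j, y j ^ occ r j := by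
  rw [← Finset.prod_fiberwise Finset.univ r]
  refine Finset.prod_congr rfl fun j _ => ?_
  rw [occ, ← Finset.prod_const]
  refine Finset.prod_congr rfl fun i hi => ?_
  rw [(Finset.mem_filter.1 hi).2]

/-- The exponents of the monomials `x ^ a * y ^ b * u ^ c`. -/
abbrev Expo := ℕ × ℕ × ℕ

/-- A finite set of exponents which contains all those of weight at most `5`. -/
def expos : Finset Expo := Finset.range 6 ×ˢ Finset.range 6 ×ˢ Finset.range 6

/-- The weight of an exponent. -/
def Expo.weight (i : Expo) : ℕ := i.1 + i.2.1 + 2 * i.2.2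

/-- The monomial `x ^ a * y ^ b * u ^ c`. -/
def realMonomial (i : Expo) (q : ℂ × ℝ) : ℝ := q.1.re ^ i.1 * q.1.im ^ i.2.1 * q.2 ^ i.2.2

/-- The weighted homogeneous polynomial of weight `k` with coefficients `C`. -/
noncomputable def realPoly (k : ℕ) (C : Expo → ℝ) (q : ℂ × ℝ) : ℝ :=
  ∑ i ∈ expos.filter fun i => i.weight = k, C i * realMonomial i q

theorem WO_realMonomial (i : Expo) : WO i.weight (realMonomial i) := by
  have := ((WO_fst.re.pow i.1).mul (WO_fst.im.pow i.2.1)).mul (WO_snd.pow i.2.2)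
  simp only [one_mul] at this
  exact this

theorem WO_realPoly (k : ℕ) (C : Expo → ℝ) : WO k (realPoly k C) := by
  refine WO.sum fun i hi => ?_
  have h := WO_realMonomial i
  rw [(Finset.mem_filter.1 hi).2] at h
  exact h.const_mul (C i)

theorem realPoly_scale (k : ℕ) (C : Expo → ℝ) (q : ℂ × ℝ) (t : ℝ) :
    realPoly k C ((t : ℂ) * q.1, t ^ 2 * q.2) = realPoly k C q * t ^ k := by
  unfold realPoly
  rw [Finset.sum_mul]
  refine Finset.sum_congr rfl fun i hi => ?_
  rw [← (Finset.mem_filter.1 hi).2]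
  simp only [realMonomial, Expo.weight, Complex.re_ofReal_mul, Complex.im_ofReal_mul]
  ring

/-- The joint power series at `(p₀, 0)` is recentred at `(p, 0)`; its recentred coefficients are
analytic in `p`. Degree at least 6 implies weight at least 6, and the finitely many remaining
monomials of weight at least 6 join the remainder. -/
theorem exists_weighted_taylor {P : Type*} [NormedAddCommGroup P] [NormedSpace ℝ P]
    {E : P × (ℂ × ℝ) → ℝ} {p₀ : P} (hE : AnalyticAt ℝ E (p₀, 0)) :
    ∃ C : Expo → P → ℝ, (∀ i, AnalyticAt ℝ (C i) p₀) ∧ ∀ᶠ p in 𝓝 p₀,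
      WO 6 fun q => E (p, q) - ∑ k ∈ Finset.range 6, realPoly k (fun i => C i p) q := by
  obtain ⟨ser, R, hser⟩ := hE
  let e : Fin 3 → P × (ℂ × ℝ) := ![(0, (1, 0)), (0, (Complex.I, 0)), (0, (0, 1))]
  let y : ℂ × ℝ → Fin 3 → ℝ := fun q => ![q.1.re, q.1.im, q.2]
  have hye : ∀ q : ℂ × ℝ, ∑ j, y q j • e j = (0, q) := by
    intro q
    simp only [y, e, Fin.sum_univ_three, Matrix.cons_val_zero, Matrix.cons_val_one,
      Matrix.cons_val, Prod.smul_mk, Prod.mk_add_mk, smul_zero, add_zero, smul_eq_mul, mul_one]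
    ext1
    · rfl
    · ext1
      · simp
      · simp
  let c : (n : ℕ) → (Fin n → Fin 3) → P → ℝ := fun n r p =>
    ser.changeOrigin (p - p₀, 0) n fun i => e (r i)
  let ex : (n : ℕ) → (Fin n → Fin 3) → Expo := fun n r => (occ r 0, occ r 1, occ r 2)
  let C : Expo → P → ℝ := fun i p =>
    ∑ n ∈ Finset.range 6, ∑ r : Fin n → Fin 3, if ex n r = i then c n r p else 0
  have hc : ∀ n r, AnalyticAt ℝ (c n r) p₀ := by
    intro n r
    have h1 : AnalyticAt ℝ (fun x => ser.changeOrigin x n) 0 :=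
      ser.analyticAt_changeOrigin hser.radius_pos n
    have h2 : AnalyticAt ℝ (fun p : P => ((p - p₀, 0) : P × (ℂ × ℝ))) p₀ := by fun_prop
    have h3 : AnalyticAt ℝ (fun p : P => ser.changeOrigin (p - p₀, 0) n) p₀ := by
      refine AnalyticAt.fun_comp (g := fun x => ser.changeOrigin x n) ?_ h2
      rw [sub_self]
      exact h1
    exact ((ContinuousMultilinearMap.apply ℝ (fun _ : Fin n => P × (ℂ × ℝ)) ℝ
      (fun i => e (r i))).analyticAt _).fun_comp h3
  refine ⟨C, ?_, ?_⟩
  · intro i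
    refine Finset.analyticAt_fun_sum _ fun n _ => Finset.analyticAt_fun_sum _ fun r _ => ?_
    split_ifs
    · exact hc n r
    · exact analyticAt_const
  have hnear : ∀ᶠ p in 𝓝 p₀, (‖((p - p₀, 0) : P × (ℂ × ℝ))‖₊ : ENNReal) < R := by
    have h1 : Tendsto (fun p : P => (‖((p - p₀, 0) : P × (ℂ × ℝ))‖₊ : ENNReal)) (𝓝 p₀)
        (𝓝 ((‖((p₀ - p₀, 0) : P × (ℂ × ℝ))‖₊ : ENNReal))) :=
      Continuous.tendsto (by fun_prop) p₀
    exact h1.eventually (gt_mem_nhds (by simpa using hser.r_pos))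
  filter_upwards [hnear] with p hp
  have h1 := (hser.changeOrigin hp).hasFPowerSeriesAt.isBigO_sub_partialSum_pow 6
  have h2 : Tendsto (fun q : ℂ × ℝ => ((0, q) : P × (ℂ × ℝ))) (𝓝 0) (𝓝 0) := by
    have : Continuous fun q : ℂ × ℝ => ((0, q) : P × (ℂ × ℝ)) := by fun_prop
    exact this.tendsto 0
  have h3 : WO 6 fun q => E (p, q) - (ser.changeOrigin (p - p₀, 0)).partialSum 6 (0, q) := by
    refine WO_of_isBigO_norm_pow ((IsBigO.comp_tendsto h1 h2).congr ?_ ?_)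
    · intro q
      simp
    · intro q
      simp
  have h4 : ∀ q, (ser.changeOrigin (p - p₀, 0)).partialSum 6 (0, q) =
      ∑ i ∈ expos, C i p * realMonomial i q := by
    intro q
    simp only [C, Finset.sum_mul]
    rw [Finset.sum_comm]
    refine Finset.sum_congr rfl fun n hn => ?_
    rw [Finset.sum_comm, ← hye q, ContinuousMultilinearMap.apply_sum_smul]
    refine Finset.sum_congr rfl fun r _ => ?_
    -- The degree is below 6, hence so is each exponent.
    have hmem : ex n r ∈ expos := by
      have hn6 := Finset.mem_range.1 hn
      simp only [expos, ex, Finset.mem_product, Finset.mem_range]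
      exact ⟨(occ_le r 0).trans_lt hn6, (occ_le r 1).trans_lt hn6, (occ_le r 2).trans_lt hn6⟩
    simp only [ite_mul, zero_mul]
    rw [Finset.sum_ite_eq expos (ex n r), if_pos hmem, prod_eq_prod_pow_occ]
    simp only [Fin.prod_univ_three, y, Matrix.cons_val_zero, Matrix.cons_val_one, Matrix.cons_val,
      realMonomial, ex, c, smul_eq_mul]
    ring
  have h5 : ∀ q, ∑ i ∈ expos, C i p * realMonomial i q =
      ∑ k ∈ Finset.range 6, realPoly k (fun i => C i p) q +
        ∑ i ∈ expos.filter fun i => ¬ i.weight < 6, C i p * realMonomial i q := by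
    intro q
    rw [← Finset.sum_filter_add_sum_filter_not expos (fun i => i.weight < 6)]
    congr 1
    rw [← Finset.sum_fiberwise_of_maps_to (s := expos.filter fun i => i.weight < 6)
      (t := Finset.range 6) (g := Expo.weight) (fun i hi => by
        simpa using (Finset.mem_filter.1 hi).2)]
    refine Finset.sum_congr rfl fun k hk => ?_
    unfold realPoly
    refine Finset.sum_congr ?_ fun _ _ => rfl
    rw [Finset.filter_filter]
    refine Finset.filter_congr fun i _ => ?_
    have := Finset.mem_range.1 hk
    constructor
    · exact fun h => h.2
    · exact fun h => ⟨by omega, h⟩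
  have h6 : WO 6 fun q => ∑ i ∈ expos.filter fun i => ¬ i.weight < 6, C i p * realMonomial i q := by
    refine WO.sum fun i hi => ?_
    exact ((WO_realMonomial i).const_mul (C i p)).mono (not_lt.1 (Finset.mem_filter.1 hi).2)
  exact (h3.add h6).congr fun q => by rw [h4, h5]; ring

/-- If an expansion is `O(k)`, its part of weight `k` is the leading one. -/
theorem realPoly_leading {f : ℂ × ℝ → ℝ} {C : Expo → ℝ} {k : ℕ} (hk : k < 6)
    (hf : WO 6 fun q => f q - ∑ k ∈ Finset.range 6, realPoly k C q) (hfk : WO k f) :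
    WO (k + 1) fun q => f q - realPoly k C q := by
  have h0 : WO k fun q => ∑ k ∈ Finset.range 6, realPoly k C q :=
    (hfk.sub (hf.mono hk.le)).congr fun q => by ring
  have h1 : ∀ m < k, ∀ q, realPoly m C q = 0 := by
    intro m hm q
    have h2 := h0.scale q
    simp only [realPoly_scale] at h2
    exact coeff_eq_zero_of_isBigO h2 m hm (by omega)
  have h2 : WO (k + 1) fun q => ∑ m ∈ (Finset.range 6).filter (fun m => k < m), realPoly m C q :=
    WO.sum fun m hm => (WO_realPoly m C).mono (Finset.mem_filter.1 hm).2
  refine ((hf.mono (by omega : k + 1 ≤ 6)).add h2).congr fun q => ?_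
  have h3 : ∑ m ∈ Finset.range 6, realPoly m C q =
      realPoly k C q + ∑ m ∈ (Finset.range 6).filter (fun m => k < m), realPoly m C q := by
    rw [← Finset.sum_filter_add_sum_filter_not (Finset.range 6) (fun m => k < m), add_comm]
    congr 1
    rw [Finset.sum_eq_single_of_mem k (by simp [hk])]
    intro m hm hmk
    have := (Finset.mem_filter.1 hm).2
    exact h1 m (by omega) q
  rw [h3]
  ring
open scoped ComplexConjugate

/-! ### The homological equation in weights three, four and five -/

theorem realPoly_three (C : Expo → ℝ) (q : ℂ × ℝ) : realPoly 3 C q =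
    C (3, 0, 0) * q.1.re ^ 3 + C (2, 1, 0) * q.1.re ^ 2 * q.1.im
      + C (1, 2, 0) * q.1.re * q.1.im ^ 2 + C (0, 3, 0) * q.1.im ^ 3
      + C (1, 0, 1) * q.1.re * q.2 + C (0, 1, 1) * q.1.im * q.2 := by
  have h : expos.filter (fun i => i.weight = 3) =
      {(3, 0, 0), (2, 1, 0), (1, 2, 0), (0, 3, 0), (1, 0, 1), (0, 1, 1)} := by decide
  rw [realPoly, h]
  simp [realMonomial]
  ring

theorem realPoly_four (C : Expo → ℝ) (q : ℂ × ℝ) : realPoly 4 C q =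
    C (4, 0, 0) * q.1.re ^ 4 + C (3, 1, 0) * q.1.re ^ 3 * q.1.im
      + C (2, 2, 0) * q.1.re ^ 2 * q.1.im ^ 2 + C (1, 3, 0) * q.1.re * q.1.im ^ 3
      + C (0, 4, 0) * q.1.im ^ 4 + C (2, 0, 1) * q.1.re ^ 2 * q.2
      + C (1, 1, 1) * q.1.re * q.1.im * q.2 + C (0, 2, 1) * q.1.im ^ 2 * q.2
      + C (0, 0, 2) * q.2 ^ 2 := by
  have h : expos.filter (fun i => i.weight = 4) =
      {(4, 0, 0), (3, 1, 0), (2, 2, 0), (1, 3, 0), (0, 4, 0), (2, 0, 1), (1, 1, 1), (0, 2, 1),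
        (0, 0, 2)} := by decide
  rw [realPoly, h]
  simp [realMonomial]
  ring

theorem realPoly_five (C : Expo → ℝ) (q : ℂ × ℝ) : realPoly 5 C q =
    C (5, 0, 0) * q.1.re ^ 5 + C (4, 1, 0) * q.1.re ^ 4 * q.1.im
      + C (3, 2, 0) * q.1.re ^ 3 * q.1.im ^ 2 + C (2, 3, 0) * q.1.re ^ 2 * q.1.im ^ 3
      + C (1, 4, 0) * q.1.re * q.1.im ^ 4 + C (0, 5, 0) * q.1.im ^ 5
      + C (3, 0, 1) * q.1.re ^ 3 * q.2 + C (2, 1, 1) * q.1.re ^ 2 * q.1.im * q.2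
      + C (1, 2, 1) * q.1.re * q.1.im ^ 2 * q.2 + C (0, 3, 1) * q.1.im ^ 3 * q.2
      + C (1, 0, 2) * q.1.re * q.2 ^ 2 + C (0, 1, 2) * q.1.im * q.2 ^ 2 := by
  have h : expos.filter (fun i => i.weight = 5) =
      {(5, 0, 0), (4, 1, 0), (3, 2, 0), (2, 3, 0), (1, 4, 0), (0, 5, 0), (3, 0, 1), (2, 1, 1),
        (1, 2, 1), (0, 3, 1), (1, 0, 2), (0, 1, 2)} := by decide
  rw [realPoly, h]
  simp [realMonomial]
  ring

/-- The weighted homogeneous polynomial of weight `m` in `(z, w)` with coefficients `a`. -/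
noncomputable def complexPoly (m : ℕ) (a : ℕ × ℕ → ℂ) (P : ℂ × ℂ) : ℂ :=
  ∑ i ∈ (Finset.range 6 ×ˢ Finset.range 3).filter (fun i => i.1 + 2 * i.2 = m),
    a i * (P.1 ^ i.1 * P.2 ^ i.2)

theorem complexPoly_two (a : ℕ × ℕ → ℂ) (P : ℂ × ℂ) :
    complexPoly 2 a P = a (2, 0) * P.1 ^ 2 + a (0, 1) * P.2 := by
  have h : (Finset.range 6 ×ˢ Finset.range 3).filter (fun i => i.1 + 2 * i.2 = 2) =
      {(2, 0), (0, 1)} := by decide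
  rw [complexPoly, h]
  simp

theorem complexPoly_three (a : ℕ × ℕ → ℂ) (P : ℂ × ℂ) :
    complexPoly 3 a P = a (3, 0) * P.1 ^ 3 + a (1, 1) * (P.1 * P.2) := by
  have h : (Finset.range 6 ×ˢ Finset.range 3).filter (fun i => i.1 + 2 * i.2 = 3) =
      {(3, 0), (1, 1)} := by decide
  rw [complexPoly, h]
  simp

theorem complexPoly_four (a : ℕ × ℕ → ℂ) (P : ℂ × ℂ) :
    complexPoly 4 a P = a (4, 0) * P.1 ^ 4 + a (2, 1) * (P.1 ^ 2 * P.2) + a (0, 2) * P.2 ^ 2 := by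
  have h : (Finset.range 6 ×ˢ Finset.range 3).filter (fun i => i.1 + 2 * i.2 = 4) =
      {(4, 0), (2, 1), (0, 2)} := by decide
  rw [complexPoly, h]
  simp
  ring

theorem complexPoly_five (a : ℕ × ℕ → ℂ) (P : ℂ × ℂ) :
    complexPoly 5 a P =
      a (5, 0) * P.1 ^ 5 + a (3, 1) * (P.1 ^ 3 * P.2) + a (1, 2) * (P.1 * P.2 ^ 2) := by
  have h : (Finset.range 6 ×ˢ Finset.range 3).filter (fun i => i.1 + 2 * i.2 = 5) =
      {(5, 0), (3, 1), (1, 2)} := by decide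
  rw [complexPoly, h]
  simp
  ring

/-- The point of the hyperquadric `v = z z̄` above `(z, u)`. -/
noncomputable def quadricPoint (q : ℂ × ℝ) : ℂ × ℂ := (q.1, q.2 + q.1 * conj q.1 * Complex.I)

section Homological

variable {P : Type*} [NormedAddCommGroup P] [NormedSpace ℝ P] {p₀ : P}

theorem AnalyticAt.conj_complex {f : P → ℂ} (hf : AnalyticAt ℝ f p₀) :
    AnalyticAt ℝ (fun p => conj (f p)) p₀ :=
  (Complex.conjCLE.toContinuousLinearMap.analyticAt _).fun_comp hf

/-- The homological equation in weight `k`: the coefficients `a`, `b` of the transformation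
`(z + f, w + g)` removing the terms `realPoly k C` from `v = z z̄ + realPoly k C + O(k + 1)`. -/
def SolvesHomological (k : ℕ) (C : Expo → ℝ) (a b : ℕ × ℕ → ℂ) : Prop :=
  ∀ q : ℂ × ℝ, realPoly k C q + (complexPoly k b (quadricPoint q)).im -
    2 * (conj q.1 * complexPoly (k - 1) a (quadricPoint q)).re = 0

/-- On the quadric `w = u + i z z̄`. Put the cubic as `2 Re(A z³ + B z² z̄ + D z u)`. The `g`-terms
`-2iA z³` and `-2iD z w` cancel `A` and `D`; the latter leaves a multiple of `z² z̄`, which `f`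
cancels together with `B`. -/
theorem exists_solvesHomological_three (C : Expo → P → ℝ) (hC : ∀ i, AnalyticAt ℝ (C i) p₀) :
    ∃ a b : ℕ × ℕ → P → ℂ, (∀ i, AnalyticAt ℝ (a i) p₀) ∧ (∀ i, AnalyticAt ℝ (b i) p₀) ∧
      ∀ p, SolvesHomological 3 (fun i => C i p) (fun i => a i p) (fun i => b i p) := by
  let c : Expo → P → ℂ := fun i p => (C i p : ℂ)
  have hc : ∀ i, AnalyticAt ℝ (c i) p₀ := fun i =>
    (Complex.ofRealCLM.analyticAt _).fun_comp (hC i)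
  let A : P → ℂ := fun p => (c (3, 0, 0) p - c (2, 1, 0) p * Complex.I - c (1, 2, 0) p +
    c (0, 3, 0) p * Complex.I) / 8
  let B : P → ℂ := fun p => (3 * c (3, 0, 0) p - c (2, 1, 0) p * Complex.I + c (1, 2, 0) p -
    3 * c (0, 3, 0) p * Complex.I) / 8
  let D : P → ℂ := fun p => (c (1, 0, 1) p - c (0, 1, 1) p * Complex.I) / 2
  have hA : AnalyticAt ℝ A p₀ := by fun_prop (disch := norm_num)
  have hB : AnalyticAt ℝ B p₀ := by fun_prop (disch := norm_num)
  have hD : AnalyticAt ℝ D p₀ := by fun_prop (disch := norm_num)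
  have key : ∀ p (q : ℂ × ℝ), realPoly 3 (fun i => C i p) q =
      2 * (A p * q.1 ^ 3 + B p * (q.1 ^ 2 * conj q.1) + D p * (q.1 * q.2)).re := by
    intro p q
    rw [realPoly_three]
    simp [A, B, D, c, pow_succ]
    ring
  refine ⟨fun i p => if i = (2, 0) then B p - Complex.I * D p else 0,
    fun i p => if i = (3, 0) then -2 * Complex.I * A p else -2 * Complex.I * D p, ?_, ?_, ?_⟩
  · intro i
    dsimp only
    split_ifs <;> fun_prop
  · intro i
    dsimp only
    split_ifs <;> fun_prop
  · intro p q
    rw [key, complexPoly_three, complexPoly_two]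
    simp [quadricPoint, pow_succ]
    ring

/-- As in weight three, with three further real terms `d |z|⁴`, `e |z|² u`, `m u²`. The coefficient
of `w²` in `g` absorbs `m`, and the real and imaginary parts of the coefficient of `z w` in `f`
absorb `e` and `d + m`. -/
theorem exists_solvesHomological_four (C : Expo → P → ℝ) (hC : ∀ i, AnalyticAt ℝ (C i) p₀) :
    ∃ a b : ℕ × ℕ → P → ℂ, (∀ i, AnalyticAt ℝ (a i) p₀) ∧ (∀ i, AnalyticAt ℝ (b i) p₀) ∧
      ∀ p, SolvesHomological 4 (fun i => C i p) (fun i => a i p) (fun i => b i p) := by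
  let c : Expo → P → ℂ := fun i p => (C i p : ℂ)
  have hc : ∀ i, AnalyticAt ℝ (c i) p₀ := fun i =>
    (Complex.ofRealCLM.analyticAt _).fun_comp (hC i)
  let A : P → ℂ := fun p => (c (4, 0, 0) p - c (3, 1, 0) p * Complex.I - c (2, 2, 0) p +
    c (1, 3, 0) p * Complex.I + c (0, 4, 0) p) / 16
  let B : P → ℂ := fun p => (4 * c (4, 0, 0) p - 2 * c (3, 1, 0) p * Complex.I -
    2 * c (1, 3, 0) p * Complex.I - 4 * c (0, 4, 0) p) / 16
  let D : P → ℂ := fun p => (c (2, 0, 1) p - c (1, 1, 1) p * Complex.I - c (0, 2, 1) p) / 4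
  let d : P → ℂ := fun p => (6 * c (4, 0, 0) p + 2 * c (2, 2, 0) p + 6 * c (0, 4, 0) p) / 16
  let e : P → ℂ := fun p => (2 * c (2, 0, 1) p + 2 * c (0, 2, 1) p) / 4
  let m : P → ℂ := fun p => c (0, 0, 2) p
  have hA : AnalyticAt ℝ A p₀ := by fun_prop (disch := norm_num)
  have hB : AnalyticAt ℝ B p₀ := by fun_prop (disch := norm_num)
  have hD : AnalyticAt ℝ D p₀ := by fun_prop (disch := norm_num)
  have hd : AnalyticAt ℝ d p₀ := by fun_prop (disch := norm_num)
  have he : AnalyticAt ℝ e p₀ := by fun_prop (disch := norm_num)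
  have hm : AnalyticAt ℝ m p₀ := by fun_prop
  have key : ∀ p (q : ℂ × ℝ), realPoly 4 (fun i => C i p) q =
      2 * (A p * q.1 ^ 4 + B p * (q.1 ^ 3 * conj q.1) + D p * (q.1 ^ 2 * q.2)).re
        + (d p).re * (q.1.re ^ 2 + q.1.im ^ 2) ^ 2 + (e p).re * (q.1.re ^ 2 + q.1.im ^ 2) * q.2
        + (m p).re * q.2 ^ 2 := by
    intro p q
    rw [realPoly_four]
    simp [A, B, D, d, e, m, c, pow_succ]
    ring
  have him : ∀ p, (d p).im = 0 ∧ (e p).im = 0 ∧ (m p).im = 0 := by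
    intro p
    simp [d, e, m, c]
  refine ⟨fun i p => if i = (3, 0) then B p - Complex.I * D p else
      e p / 2 - Complex.I * (d p + m p) / 2,
    fun i p => if i = (4, 0) then -2 * Complex.I * A p else
      if i = (2, 1) then -2 * Complex.I * D p else -Complex.I * m p, ?_, ?_, ?_⟩
  · intro i
    dsimp only
    split_ifs <;> fun_prop (disch := norm_num)
  · intro i
    dsimp only
    split_ifs <;> fun_prop
  · intro p q
    obtain ⟨h1, h2, h3⟩ := him p
    rw [key, complexPoly_four, complexPoly_three]
    simp [quadricPoint, pow_succ, h1, h2, h3]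
    ring

/-- The terms in `z⁵`, `z⁴ z̄`, `z³ u` are removed as before. Those in `z³ z̄²`, `z² z̄ u`, `z u²`
give three linear equations for the coefficients of `z² w`, `w²` in `f` and of `z w²` in `g`, and
this system is invertible. -/
theorem exists_solvesHomological_five (C : Expo → P → ℝ) (hC : ∀ i, AnalyticAt ℝ (C i) p₀) :
    ∃ a b : ℕ × ℕ → P → ℂ, (∀ i, AnalyticAt ℝ (a i) p₀) ∧ (∀ i, AnalyticAt ℝ (b i) p₀) ∧
      ∀ p, SolvesHomological 5 (fun i => C i p) (fun i => a i p) (fun i => b i p) := by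
  let c : Expo → P → ℂ := fun i p => (C i p : ℂ)
  have hc : ∀ i, AnalyticAt ℝ (c i) p₀ := fun i =>
    (Complex.ofRealCLM.analyticAt _).fun_comp (hC i)
  let A : P → ℂ := fun p => (c (5, 0, 0) p - c (4, 1, 0) p * Complex.I - c (3, 2, 0) p +
    c (2, 3, 0) p * Complex.I + c (1, 4, 0) p - c (0, 5, 0) p * Complex.I) / 32
  let B : P → ℂ := fun p => (5 * c (5, 0, 0) p - 3 * c (4, 1, 0) p * Complex.I - c (3, 2, 0) p -
    c (2, 3, 0) p * Complex.I - 3 * c (1, 4, 0) p + 5 * c (0, 5, 0) p * Complex.I) / 32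
  let G : P → ℂ := fun p => (10 * c (5, 0, 0) p - 2 * c (4, 1, 0) p * Complex.I +
    2 * c (3, 2, 0) p - 2 * c (2, 3, 0) p * Complex.I + 2 * c (1, 4, 0) p -
    10 * c (0, 5, 0) p * Complex.I) / 32
  let D : P → ℂ := fun p => (c (3, 0, 1) p - c (2, 1, 1) p * Complex.I - c (1, 2, 1) p +
    c (0, 3, 1) p * Complex.I) / 8
  let H : P → ℂ := fun p => (3 * c (3, 0, 1) p - c (2, 1, 1) p * Complex.I + c (1, 2, 1) p -
    3 * c (0, 3, 1) p * Complex.I) / 8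
  let K : P → ℂ := fun p => (c (1, 0, 2) p - c (0, 1, 2) p * Complex.I) / 2
  have hA : AnalyticAt ℝ A p₀ := by fun_prop (disch := norm_num)
  have hB : AnalyticAt ℝ B p₀ := by fun_prop (disch := norm_num)
  have hG : AnalyticAt ℝ G p₀ := by fun_prop (disch := norm_num)
  have hD : AnalyticAt ℝ D p₀ := by fun_prop (disch := norm_num)
  have hH : AnalyticAt ℝ H p₀ := by fun_prop (disch := norm_num)
  have hK : AnalyticAt ℝ K p₀ := by fun_prop (disch := norm_num)
  have key : ∀ p (q : ℂ × ℝ), realPoly 5 (fun i => C i p) q =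
      2 * (A p * q.1 ^ 5 + B p * (q.1 ^ 4 * conj q.1) + G p * (q.1 ^ 3 * conj q.1 ^ 2)
        + D p * (q.1 ^ 3 * q.2) + H p * (q.1 ^ 2 * conj q.1 * q.2) + K p * (q.1 * q.2 ^ 2)).re := by
    intro p q
    rw [realPoly_five]
    simp [A, B, G, D, H, K, c, pow_succ]
    ring
  -- With `a` the coefficient of `w²` in `f`, the equations are `K - ig/2 - ā = 0`, `H + g - f + 2iā
  -- = 0`, `G + ig/2 - if + ā = 0`. Eliminating `ā` gives `f`, then `g`.
  let f : P → ℂ := fun p => -Complex.I * (K p + G p)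
  let g : P → ℂ := fun p => (f p - H p - 2 * Complex.I * K p) / 2
  have hf : AnalyticAt ℝ f p₀ := by fun_prop
  have hg : AnalyticAt ℝ g p₀ := by fun_prop (disch := norm_num)
  have hg' : AnalyticAt ℝ (fun p => conj (g p)) p₀ := hg.conj_complex
  have hK' : AnalyticAt ℝ (fun p => conj (K p)) p₀ := hK.conj_complex
  refine ⟨fun i p => if i = (4, 0) then B p - Complex.I * D p else
      if i = (2, 1) then f p else conj (K p) + Complex.I * conj (g p) / 2,
    fun i p => if i = (5, 0) then -2 * Complex.I * A p else
      if i = (3, 1) then -2 * Complex.I * D p else g p, ?_, ?_, ?_⟩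
  · intro i
    dsimp only
    split_ifs
    · fun_prop
    · fun_prop
    · exact hK'.add ((analyticAt_const.mul hg').div analyticAt_const two_ne_zero)
  · intro i
    dsimp only
    split_ifs <;> fun_prop
  · intro p q
    have h1 : (g p).re = ((f p).re - (H p).re + 2 * (K p).im) / 2 := by simp [g]
    have h2 : (g p).im = ((f p).im - (H p).im - 2 * (K p).re) / 2 := by simp [g]
    have h3 : (f p).re = (K p).im + (G p).im := by simp [f]
    have h4 : (f p).im = -((K p).re + (G p).re) := by simp [f]
    rw [key, complexPoly_five, complexPoly_four]
    simp [quadricPoint, pow_succ]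
    rw [h1, h2, h3, h4]
    ring

end Homological

/-! ### Normalization weight by weight -/

theorem WO_quadricPoint_snd : WO 2 fun q => (quadricPoint q).2 := by
  have h := (WO_fst.mul WO_fst.conj).mul (k := 1 + 1) (l := 0) (g := fun _ => Complex.I)
    (by simpa [WO] using isBigO_const_const Complex.I (one_ne_zero (α := ℝ)) (𝓝 (0 : ℂ × ℝ)))
  exact WO_snd.ofReal.add h

/-- `X`, a parametrization of a hypersurface of `ℂ²`, agrees to leading order with that of the
hyperquadric, and the hypersurface is `v = z z̄ + O(k)`. -/
structure IsNearQuadric (k : ℕ) (X : ℂ × ℝ → ℂ × ℂ) : Prop where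
  fst : WO 2 fun q => (X q).1 - q.1
  snd : WO 3 fun q => (X q).2 - (quadricPoint q).2
  defect : WO k fun q => (X q).2.im - ‖(X q).1‖ ^ 2

theorem IsNearQuadric.complexPoly_sub {k : ℕ} {X : ℂ × ℝ → ℂ × ℂ} (hX : IsNearQuadric k X)
    (m : ℕ) (a : ℕ × ℕ → ℂ) :
    WO (m + 1) fun q => complexPoly m a (X q) - complexPoly m a (quadricPoint q) := by
  simp only [complexPoly, ← Finset.sum_sub_distrib, ← mul_sub]
  refine WO.sum fun i hi => WO.const_mul _ ?_
  have h := WO.mul_sub_mul (WO_fst.pow i.1) (WO_fst.pow_sub_pow hX.fst i.1)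
    (WO_quadricPoint_snd.pow i.2) (WO_quadricPoint_snd.pow_sub_pow hX.snd i.2)
  rwa [one_mul, (Finset.mem_filter.1 hi).2] at h

theorem WO_complexPoly_quadricPoint (m : ℕ) (a : ℕ × ℕ → ℂ) :
    WO m fun q => complexPoly m a (quadricPoint q) := by
  refine WO.sum fun i hi => WO.const_mul _ ?_
  have h := (WO_fst.pow i.1).mul (WO_quadricPoint_snd.pow i.2)
  rwa [one_mul, (Finset.mem_filter.1 hi).2] at h

/-- The map `(z, w) ↦ (z + f, w + g)` with `f`, `g` weighted homogeneous of weights `k - 1`, `k`. -/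
noncomputable def shear (k : ℕ) (a b : ℕ × ℕ → ℂ) (P : ℂ × ℂ) : ℂ × ℂ :=
  (P.1 + complexPoly (k - 1) a P, P.2 + complexPoly k b P)

theorem differentiable_complexPoly (m : ℕ) (a : ℕ × ℕ → ℂ) :
    Differentiable ℂ (complexPoly m a) := by
  unfold complexPoly
  fun_prop

theorem differentiable_shear (k : ℕ) (a b : ℕ × ℕ → ℂ) : Differentiable ℂ (shear k a b) :=
  (differentiable_fst.add (differentiable_complexPoly _ _)).prodMk
    (differentiable_snd.add (differentiable_complexPoly _ _))

/-- A shear changes `v - |z|²` by `Im g - 2 Re(z̄ f) - |f|²`. Modulo weight `k + 1` the first two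
terms may be evaluated on the quadric, where the homological equation cancels the weight `k` part.
-/
theorem IsNearQuadric.shear {k : ℕ} (hk : 3 ≤ k) {X : ℂ × ℝ → ℂ × ℂ} (hX : IsNearQuadric k X)
    {C : Expo → ℝ} (hC : WO (k + 1) fun q => (X q).2.im - ‖(X q).1‖ ^ 2 - realPoly k C q)
    {a b : ℕ × ℕ → ℂ} (hab : SolvesHomological k C a b) :
    IsNearQuadric (k + 1) fun q => shear k a b (X q) := by
  have hf := hX.complexPoly_sub (k - 1) a
  have hg := hX.complexPoly_sub k b
  rw [show k - 1 + 1 = k by omega] at hf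
  have hf1 : WO (k - 1) fun q => complexPoly (k - 1) a (X q) :=
    ((hf.mono (by omega)).add (WO_complexPoly_quadricPoint (k - 1) a)).congr fun q => by ring
  have hg1 : WO k fun q => complexPoly k b (X q) :=
    ((hg.mono (by omega)).add (WO_complexPoly_quadricPoint k b)).congr fun q => by ring
  refine ⟨?_, ?_, ?_⟩
  · exact (hX.fst.add (hf1.mono (by omega))).congr fun q => by simp only [_root_.shear]; ring
  · exact (hX.snd.add (hg1.mono (by omega))).congr fun q => by simp only [_root_.shear]; ring
  · have hconj : WO 2 fun q => conj (X q).1 - conj q.1 :=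
      hX.fst.conj.congr fun q => by simp
    have h1 := WO.mul_sub_mul (k := 1) (l := k - 1) WO_fst.conj hconj
      (WO_complexPoly_quadricPoint (k - 1) a) (by rwa [show k - 1 + 1 = k by omega])
    have h1' : WO (k + 1) fun q => conj (X q).1 * complexPoly (k - 1) a (X q) -
        conj q.1 * complexPoly (k - 1) a (quadricPoint q) := h1.mono (by omega)
    -- The quadratic term `|f|²` has weight `2k - 2`, at least `k + 1` because `k ≥ 3`.
    have h2 : WO (k + 1) fun q => complexPoly (k - 1) a (X q) * conj (complexPoly (k - 1) a (X q)) :=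
      (hf1.mul hf1.conj).mono (by omega)
    refine (((hC.add hg.im).sub (h1'.re.const_mul 2)).sub h2.re).congr fun q => ?_
    have h3 := hab q
    simp only [_root_.shear, Complex.sq_norm, Complex.normSq_apply, Complex.add_re, Complex.add_im,
      Complex.sub_re, Complex.sub_im, Complex.mul_re, Complex.conj_re, Complex.conj_im] at h3 ⊢
    linear_combination -h3

section Family

variable {P : Type*} [NormedAddCommGroup P] [NormedSpace ℝ P] {p₀ : P}

theorem analyticAt_shear {k : ℕ} {a b : ℕ × ℕ → P → ℂ} (ha : ∀ i, AnalyticAt ℝ (a i) p₀)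
    (hb : ∀ i, AnalyticAt ℝ (b i) p₀) (Q : ℂ × ℂ) :
    AnalyticAt ℝ (fun x : P × (ℂ × ℂ) => shear k (fun i => a i x.1) (fun i => b i x.1) x.2)
      (p₀, Q) := by
  have hz : AnalyticAt ℝ (fun x : P × (ℂ × ℂ) => x.2.1) (p₀, Q) :=
    analyticAt_fst.fun_comp analyticAt_snd
  have hw : AnalyticAt ℝ (fun x : P × (ℂ × ℂ) => x.2.2) (p₀, Q) :=
    analyticAt_snd.fun_comp analyticAt_snd
  have key : ∀ (m : ℕ) (c : ℕ × ℕ → P → ℂ), (∀ i, AnalyticAt ℝ (c i) p₀) →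
      AnalyticAt ℝ (fun x : P × (ℂ × ℂ) => complexPoly m (fun i => c i x.1) x.2) (p₀, Q) := by
    intro m c hc
    refine Finset.analyticAt_fun_sum _ fun i _ => ?_
    exact (AnalyticAt.fun_comp (f := Prod.fst) (x := (p₀, Q)) (hc i) analyticAt_fst).mul
      ((hz.pow _).mul (hw.pow _))
  exact (hz.add (key _ _ ha)).prod (hw.add (key _ _ hb))

/-- A family of parametrized hypersurfaces `v = z z̄ + O(k)` is transformed to one with
`v = z z̄ + O(l)`, `k ≤ l ≤ 6`. -/
theorem exists_normalizing_family {X : P → ℂ × ℝ → ℂ × ℂ}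
    (hX : AnalyticAt ℝ (fun x : P × (ℂ × ℝ) => X x.1 x.2) (p₀, 0))
    (hk : ∀ᶠ p in 𝓝 p₀, IsNearQuadric 3 (X p)) {l : ℕ} (hl : 3 ≤ l) (hl6 : l ≤ 6) :
    ∃ S : P → ℂ × ℂ → ℂ × ℂ, (∀ p, Differentiable ℂ (S p)) ∧
      (∀ Q, AnalyticAt ℝ (fun x : P × (ℂ × ℂ) => S x.1 x.2) (p₀, Q)) ∧
      ∀ᶠ p in 𝓝 p₀, IsNearQuadric l fun q => S p (X p q) := by
  induction l, hl using Nat.le_induction with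
  | base => exact ⟨fun _ Q => Q, fun _ => differentiable_id, fun Q => analyticAt_snd, hk⟩
  | succ k hk3 ih =>
    obtain ⟨S, hS1, hS2, hS3⟩ := ih (by omega)
    have hY : AnalyticAt ℝ (fun x : P × (ℂ × ℝ) => S x.1 (X x.1 x.2)) (p₀, 0) :=
      AnalyticAt.fun_comp (g := fun x : P × (ℂ × ℂ) => S x.1 x.2)
        (f := fun x : P × (ℂ × ℝ) => (x.1, X x.1 x.2)) (hS2 _) (analyticAt_fst.prod hX)
    have hE : AnalyticAt ℝ (fun x : P × (ℂ × ℝ) =>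
        (S x.1 (X x.1 x.2)).2.im - ‖(S x.1 (X x.1 x.2)).1‖ ^ 2) (p₀, 0) := by
      have h1 : AnalyticAt ℝ (fun x : P × (ℂ × ℝ) => (S x.1 (X x.1 x.2)).2.im) (p₀, 0) :=
        ((Complex.imCLM.comp (ContinuousLinearMap.snd ℝ ℂ ℂ)).analyticAt _).fun_comp hY
      have h2 : AnalyticAt ℝ (fun x : P × (ℂ × ℝ) => (S x.1 (X x.1 x.2)).1.im) (p₀, 0) :=
        ((Complex.imCLM.comp (ContinuousLinearMap.fst ℝ ℂ ℂ)).analyticAt _).fun_comp hY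
      have h3 : AnalyticAt ℝ (fun x : P × (ℂ × ℝ) => (S x.1 (X x.1 x.2)).1.re) (p₀, 0) :=
        ((Complex.reCLM.comp (ContinuousLinearMap.fst ℝ ℂ ℂ)).analyticAt _).fun_comp hY
      simp only [Complex.sq_norm, Complex.normSq_apply]
      exact h1.fun_sub ((h3.fun_mul h3).fun_add (h2.fun_mul h2))
    obtain ⟨C, hC, hT⟩ := exists_weighted_taylor hE
    -- Weights 3, 4 and 5 are the only ones met before reaching `O(6)`.
    obtain ⟨a, b, ha, hb, hab⟩ : ∃ a b : ℕ × ℕ → P → ℂ, (∀ i, AnalyticAt ℝ (a i) p₀) ∧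
        (∀ i, AnalyticAt ℝ (b i) p₀) ∧
        ∀ p, SolvesHomological k (fun i => C i p) (fun i => a i p) (fun i => b i p) := by
      have : k = 3 ∨ k = 4 ∨ k = 5 := by omega
      rcases this with rfl | rfl | rfl
      · exact exists_solvesHomological_three C hC
      · exact exists_solvesHomological_four C hC
      · exact exists_solvesHomological_five C hC
    refine ⟨fun p Q => shear k (fun i => a i p) (fun i => b i p) (S p Q),
      fun p => (differentiable_shear _ _ _).comp (hS1 p), fun Q => ?_, ?_⟩
    · exact AnalyticAt.fun_comp
        (g := fun x : P × (ℂ × ℂ) => shear k (fun i => a i x.1) (fun i => b i x.1) x.2)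
        (f := fun x : P × (ℂ × ℂ) => (x.1, S x.1 x.2)) (analyticAt_shear ha hb _)
        (analyticAt_fst.prod (hS2 Q))
    · filter_upwards [hS3, hT] with p h1 h2
      exact h1.shear hk3 (realPoly_leading (by omega) h2 h1.defect) (hab p)

end Family
open scoped ContDiff

/-! ### Hypersurfaces close to the hyperquadric as graphs -/

theorem wt_sq_le (q : ℂ × ℝ) : wt q ^ 2 ≤ 2 * ‖q.1‖ ^ 2 + 2 * |q.2| := by
  have h := Real.sq_sqrt (abs_nonneg q.2)
  unfold wt
  nlinarith [sq_nonneg (‖q.1‖ - √|q.2|)]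

theorem WO.eq_zero {E : Type*} [NormedAddCommGroup E] {k : ℕ} (hk : k ≠ 0) {f : ℂ × ℝ → E}
    (hf : WO k f) : f 0 = 0 := by
  obtain ⟨c, hc⟩ := IsBigO.bound hf
  simpa [wt, hk] using hc.self_of_nhds

/-- Weight 3 is needed: `wt² = O(‖q‖)` while `wt → 0`, so `wt³ = o(‖q‖)`. Weight 2 would not
suffice, since `u` itself has weight 2. -/
theorem WO.hasFDerivAt {E : Type*} [NormedAddCommGroup E] [NormedSpace ℝ E] {f : ℂ × ℝ → E}
    (hf : WO 3 f) : HasFDerivAt f (0 : ℂ × ℝ →L[ℝ] E) 0 := by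
  have h1 : (fun q => wt q ^ 2) =O[𝓝 0] fun q : ℂ × ℝ => q := by
    refine IsBigO.of_bound 4 ?_
    filter_upwards [Metric.closedBall_mem_nhds (0 : ℂ × ℝ) one_pos] with q hq
    have hq1 : ‖q‖ ≤ 1 := by simpa using hq
    rw [Real.norm_of_nonneg (by positivity)]
    have h2 := wt_sq_le q
    have h3 : ‖q.1‖ ≤ ‖q‖ := norm_fst_le q
    have h4 : |q.2| ≤ ‖q‖ := norm_snd_le q
    nlinarith [norm_nonneg q.1, norm_nonneg q]
  have h2 : (fun q => wt q ^ 3) =o[𝓝 0] fun q : ℂ × ℝ => q := by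
    have h3 : (fun q => wt q) =o[𝓝 0] fun _ : ℂ × ℝ => (1 : ℝ) :=
      (isLittleO_one_iff ℝ).2 tendsto_wt
    have h4 := h3.mul_isBigO (IsBigO.norm_right h1)
    simp only [one_mul] at h4
    exact (h4.congr_left fun q => by ring).of_norm_right
  refine HasFDerivAt.of_isLittleO ?_
  simpa [hf.eq_zero] using IsBigO.trans_isLittleO hf h2

namespace IsNearQuadric

variable {k : ℕ} {X : ℂ × ℝ → ℂ × ℂ}

theorem apply_zero (hX : IsNearQuadric k X) : X 0 = 0 := by
  ext1
  · simpa using hX.fst.eq_zero (by norm_num)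
  · simpa [quadricPoint] using hX.snd.eq_zero (by norm_num)

theorem fderiv_snd (hX : IsNearQuadric k X) (hd : DifferentiableAt ℝ X 0) (v : ℂ × ℝ) :
    (fderiv ℝ X 0 v).2 = v.2 := by
  have h1 : HasFDerivAt (fun q => (X q).2) ((ContinuousLinearMap.snd ℝ ℂ ℂ).comp (fderiv ℝ X 0)) 0 :=
    (ContinuousLinearMap.snd ℝ ℂ ℂ).hasFDerivAt.comp 0 hd.hasFDerivAt
  have h2 : HasFDerivAt (fun q : ℂ × ℝ => q.1 * conj q.1 * Complex.I)
      (0 : ℂ × ℝ →L[ℝ] ℂ) 0 := by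
    refine IsBigO.hasFDerivAt (n := 2) ?_ (by norm_num)
    refine IsBigO.of_bound 1 (Eventually.of_forall fun q => ?_)
    have := norm_fst_le q
    simp only [norm_mul, RCLike.norm_conj, Complex.norm_I, mul_one, sub_zero, one_mul, norm_pow,
      norm_norm]
    nlinarith [norm_nonneg q.1]
  have h3 : HasFDerivAt (fun q : ℂ × ℝ => (q.2 : ℂ))
      (Complex.ofRealCLM.comp (ContinuousLinearMap.snd ℝ ℂ ℝ)) 0 :=
    (Complex.ofRealCLM.comp (ContinuousLinearMap.snd ℝ ℂ ℝ)).hasFDerivAt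
  have h4 := hX.snd.hasFDerivAt.add (h3.add h2)
  have h5 : HasFDerivAt (fun q => (X q).2) _ 0 := h4.congr_of_eventuallyEq
    (Eventually.of_forall fun q => by simp [quadricPoint])
  have h6 := DFunLike.congr_fun (h1.unique h5) v
  simpa using h6

/-- Only directions `(ζ, 0)` are controlled, since `z`-corrections of weight 2 may contain a linear
term in `u`. On the line `u = 0` weight 2 is ordinary order 2. -/
theorem fderiv_fst (hX : IsNearQuadric k X) (hd : DifferentiableAt ℝ X 0) (ζ : ℂ) :
    (fderiv ℝ X 0 (ζ, 0)).1 = ζ := by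
  have hline : HasDerivAt (fun t : ℝ => (((t : ℂ) * ζ, 0) : ℂ × ℝ)) (ζ, 0) 0 := by
    refine HasDerivAt.prodMk ?_ (hasDerivAt_const _ _)
    simpa using (hasDerivAt_id (0 : ℝ)).ofReal_comp.mul_const ζ
  have h1 : HasDerivAt (fun t : ℝ => (X ((t : ℂ) * ζ, 0)).1) (fderiv ℝ X 0 (ζ, 0)).1 0 := by
    have h2 : HasFDerivAt (fun q => (X q).1) ((ContinuousLinearMap.fst ℝ ℂ ℂ).comp (fderiv ℝ X 0))
        ((((0 : ℝ) : ℂ) * ζ, 0) : ℂ × ℝ) := by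
      rw [Complex.ofReal_zero, zero_mul]
      exact (ContinuousLinearMap.fst ℝ ℂ ℂ).hasFDerivAt.comp 0 hd.hasFDerivAt
    exact HasFDerivAt.comp_hasDerivAt (f := fun t : ℝ => (((t : ℂ) * ζ, 0) : ℂ × ℝ)) (0 : ℝ) h2 hline
  have h2 : (fun t : ℝ => (X ((t : ℂ) * ζ, 0)).1 - t * ζ) =O[𝓝 0] fun t : ℝ => ‖t - 0‖ ^ 2 := by
    have hc : Tendsto (fun t : ℝ => (((t : ℂ) * ζ, 0) : ℂ × ℝ)) (𝓝 0) (𝓝 0) := by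
      have := hline.continuousAt.tendsto
      rwa [Complex.ofReal_zero, zero_mul] at this
    refine (IsBigO.comp_tendsto hX.fst hc).trans (IsBigO.of_bound (‖ζ‖ ^ 2)
      (Eventually.of_forall fun t => ?_))
    simp [wt, mul_pow, mul_comm]
  have h3 : HasDerivAt (fun t : ℝ => (X ((t : ℂ) * ζ, 0)).1 - t * ζ) 0 0 := by
    have := (h2.hasFDerivAt (by norm_num)).hasDerivAt
    simpa using this
  have h4 : HasDerivAt (fun t : ℝ => (t : ℂ) * ζ) ζ 0 := by
    simpa using (hasDerivAt_id (0 : ℝ)).ofReal_comp.mul_const ζ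
  have h5 := (h1.sub h4).unique h3
  exact sub_eq_zero.1 h5

/-- The coordinates of `X v` differ from `v` by `O(wt²)` and `O(wt³)`; near `0` these errors are
absorbed into half of `wt²`. This transfers weighted estimates from the parameter to the graph
coordinates. -/
theorem wt_sq_le_base (hX : IsNearQuadric k X) : ∀ᶠ v in 𝓝 (0 : ℂ × ℝ),
    wt v ^ 2 ≤ 8 * ‖(X v).1‖ ^ 2 + 4 * |(X v).2.re| := by
  obtain ⟨c, hc, h1⟩ := IsBigO.exists_pos hX.fst
  obtain ⟨d, hd, h2⟩ := IsBigO.exists_pos hX.snd.re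
  have hsmall : ∀ᶠ v in 𝓝 (0 : ℂ × ℝ), 8 * c ^ 2 * wt v ^ 2 + 4 * d * wt v ≤ 1 := by
    have h : Tendsto (fun v => 8 * c ^ 2 * wt v ^ 2 + 4 * d * wt v) (𝓝 0) (𝓝 0) := by
      have := ((tendsto_wt.pow 2).const_mul (8 * c ^ 2)).add (tendsto_wt.const_mul (4 * d))
      simpa using this
    exact h.eventually (Iic_mem_nhds one_pos)
  filter_upwards [h1.bound, h2.bound, hsmall] with v e1 e2 e3
  have hw := wt_nonneg v
  rw [Real.norm_of_nonneg (pow_nonneg hw _)] at e1 e2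
  have e4 : ‖v.1‖ ≤ ‖(X v).1‖ + c * wt v ^ 2 := by
    have := norm_sub_le ((X v).1) ((X v).1 - v.1)
    simp only [sub_sub_cancel] at this
    linarith
  have e5 : |v.2| ≤ |(X v).2.re| + d * wt v ^ 3 := by
    have e6 : ((X v).2 - (quadricPoint v).2).re = (X v).2.re - v.2 := by
      simp [quadricPoint, mul_comm]
    rw [e6, Real.norm_eq_abs] at e2
    have := abs_sub_abs_le_abs_sub v.2 (X v).2.re
    rw [abs_sub_comm] at this
    linarith
  have e6 := wt_sq_le v
  have e7 : ‖v.1‖ ^ 2 ≤ 2 * ‖(X v).1‖ ^ 2 + 2 * (c * wt v ^ 2) ^ 2 := by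
    have : ‖v.1‖ ^ 2 ≤ (‖(X v).1‖ + c * wt v ^ 2) ^ 2 := by gcongr
    nlinarith [sq_nonneg (‖(X v).1‖ - c * wt v ^ 2)]
  nlinarith [mul_le_mul_of_nonneg_right e3 (sq_nonneg (wt v))]

theorem isBigO_base (hX : IsNearQuadric k X) : (fun v => wt v ^ 6) =O[𝓝 0]
    fun v => ‖(X v).1‖ ^ 6 + |(X v).2.re| ^ 3 := by
  refine IsBigO.of_bound 2048 ?_
  filter_upwards [hX.wt_sq_le_base] with v hv
  rw [Real.norm_of_nonneg (by positivity), Real.norm_of_nonneg (by positivity)]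
  set a := ‖(X v).1‖ ^ 2 with ha
  set b := |(X v).2.re|
  have ha0 : 0 ≤ a := by positivity
  have hb0 : 0 ≤ b := abs_nonneg _
  calc wt v ^ 6 = (wt v ^ 2) ^ 3 := by ring
    _ ≤ (8 * a + 4 * b) ^ 3 := by gcongr
    _ ≤ 2048 * (a ^ 3 + b ^ 3) := by
      nlinarith [mul_nonneg (add_nonneg ha0 hb0) (sq_nonneg (2 * a - b)),
        mul_nonneg ha0 (sq_nonneg (2 * a - b)), mul_nonneg hb0 (sq_nonneg (2 * a - b)),
        pow_nonneg ha0 3, pow_nonneg hb0 3]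
    _ = _ := by rw [ha]; ring

end IsNearQuadric

/-- The graph normalized by a holomorphic map in which the hypersurface is close to the quadric. -/
theorem AnalyticGraph.exists_isNormalizing (M : AnalyticGraph) {p : ℂ × ℝ} (hp : p ∈ M.Ω)
    {par : ℂ × ℝ → ℂ × ℝ} (hpar : AnalyticAt ℝ par 0) (hpar0 : par 0 = p)
    {φ : ℂ × ℂ → ℂ × ℂ} (hφ : Differentiable ℂ φ)
    (hX : IsNearQuadric 6 fun q => φ (M.point (par q))) :
    ∃ e : OpenPartialHomeomorph (ℂ × ℂ) (ℂ × ℂ), (e : ℂ × ℂ → ℂ × ℂ) = φ ∧ M.IsNormalizing p e := by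
  subst hpar0
  set p := par 0 with hpdef
  set X : ℂ × ℝ → ℂ × ℂ := fun q => φ (M.point (par q)) with hXdef
  have hφa : ∀ x, AnalyticAt ℂ φ x := fun x =>
    DifferentiableOn.analyticAt_prod_prod isOpen_univ hφ.differentiableOn (mem_univ x)
  have hpt := M.analyticAt_point hp
  have hXa : AnalyticAt ℝ X 0 :=
    (hφa _).restrictScalars.fun_comp (AnalyticAt.fun_comp (g := M.point) hpt hpar)
  have hX0 : φ (M.point p) = 0 := hX.apply_zero
  -- derivatives
  have hDX : fderiv ℝ X 0 = ((fderiv ℂ φ (M.point p)).restrictScalars ℝ).comp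
      ((fderiv ℝ M.point p).comp (fderiv ℝ par 0)) := by
    have h1 : HasFDerivAt φ ((fderiv ℂ φ (M.point p)).restrictScalars ℝ) (M.point (par 0)) :=
      (hφ _).hasFDerivAt.restrictScalars ℝ
    have h2 := hpt.differentiableAt.hasFDerivAt
    have h3 := hpar.differentiableAt.hasFDerivAt
    exact (HasFDerivAt.comp (0 : ℂ × ℝ) h1 (HasFDerivAt.comp (0 : ℂ × ℝ) h2 h3)).fderiv
  -- Modulo the `u`-direction `dX` is the identity in `z`, and it preserves the `u`-component; so
  -- `base ∘ X` is a local diffeomorphism and the image is a graph.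
  have hinj : Function.Injective (AnalyticGraph.base.comp (fderiv ℝ X 0)) := by
    rw [injective_iff_map_eq_zero]
    intro v hv
    have h1 := congrArg Prod.snd hv
    have h2 := congrArg Prod.fst hv
    simp only [ContinuousLinearMap.comp_apply, AnalyticGraph.base_apply, Prod.fst_zero,
      Prod.snd_zero, hX.fderiv_snd hXa.differentiableAt, Complex.ofReal_re] at h1 h2
    have h3 : v = (v.1, 0) := by ext1 <;> simp [h1]
    rw [h3, hX.fderiv_fst hXa.differentiableAt] at h2
    rw [h3, h2]
    rfl
  have hinjpar : Function.Injective (fderiv ℝ par 0) := by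
    intro v w hvw
    apply hinj
    simp only [ContinuousLinearMap.comp_apply, hDX, hvw]
  -- The range of the complex-linear `dφ` contains all `(ζ, 0)` and a vector with second component
  -- `1`; these span `ℂ²` over `ℂ`.
  have hsurj : Function.Surjective (fderiv ℂ φ (M.point p)) := by
    have hr : ∀ v, ∃ y, fderiv ℂ φ (M.point p) y = fderiv ℝ X 0 v := fun v =>
      ⟨_, by rw [hDX]; rfl⟩
    intro y
    obtain ⟨x₁, h₁⟩ := hr (0, 1)
    obtain ⟨x₂, h₂⟩ := hr (y.1 - y.2 * (fderiv ℝ X 0 (0, 1)).1, 0)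
    refine ⟨y.2 • x₁ + x₂, ?_⟩
    rw [map_add, map_smul, h₁, h₂]
    ext1
    · simp [hX.fderiv_fst hXa.differentiableAt]
    · simp [hX.fderiv_snd hXa.differentiableAt]
  -- local inverses
  obtain ⟨Lφ, hLφ⟩ : ∃ L : (ℂ × ℂ) ≃L[ℂ] (ℂ × ℂ), (L : ℂ × ℂ →L[ℂ] ℂ × ℂ) = fderiv ℂ φ (M.point p) :=
    ⟨(LinearEquiv.ofBijective ((fderiv ℂ φ (M.point p)) : ℂ × ℂ →ₗ[ℂ] ℂ × ℂ)
      ⟨LinearMap.injective_iff_surjective.2 hsurj, hsurj⟩).toContinuousLinearEquiv,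
      ContinuousLinearMap.ext fun _ => rfl⟩
  have real_equiv : ∀ L : ℂ × ℝ →L[ℝ] ℂ × ℝ, Function.Injective L →
      ∃ L' : (ℂ × ℝ) ≃L[ℝ] (ℂ × ℝ), (L' : ℂ × ℝ →L[ℝ] ℂ × ℝ) = L := fun L hL =>
    ⟨(LinearEquiv.ofBijective (L : ℂ × ℝ →ₗ[ℝ] ℂ × ℝ)
      ⟨hL, LinearMap.injective_iff_surjective.1 hL⟩).toContinuousLinearEquiv,
      ContinuousLinearMap.ext fun _ => rfl⟩
  obtain ⟨LB, hLB⟩ := real_equiv _ hinj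
  obtain ⟨Lp, hLp⟩ := real_equiv _ hinjpar
  have hBd : HasFDerivAt (fun q => AnalyticGraph.base (X q)) (LB : ℂ × ℝ →L[ℝ] ℂ × ℝ) 0 := by
    rw [hLB]
    exact AnalyticGraph.base.hasFDerivAt.comp 0 hXa.differentiableAt.hasFDerivAt
  have hBa : AnalyticAt ℝ (fun q => AnalyticGraph.base (X q)) 0 :=
    (AnalyticGraph.base.analyticAt _).fun_comp hXa
  have hpd : HasFDerivAt par (Lp : ℂ × ℝ →L[ℝ] ℂ × ℝ) 0 := by
    rw [hLp]; exact hpar.differentiableAt.hasFDerivAt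
  have hφd : HasFDerivAt φ (Lφ : ℂ × ℂ →L[ℂ] ℂ × ℂ) (M.point p) := by
    rw [hLφ]; exact (hφ _).hasFDerivAt
  have hω : (ω : WithTop ℕ∞) ≠ 0 := by simp
  set eφ := (hφa (M.point p)).contDiffAt.toOpenPartialHomeomorph φ hφd hω with heφ
  set eB := hBa.contDiffAt.toOpenPartialHomeomorph _ hBd hω with heB
  set eP := hpar.contDiffAt.toOpenPartialHomeomorph _ hpd hω with heP
  have hφs : M.point p ∈ eφ.source :=
    (hφa (M.point p)).contDiffAt.mem_toOpenPartialHomeomorph_source hφd hω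
  have hBs : (0 : ℂ × ℝ) ∈ eB.source := hBa.contDiffAt.mem_toOpenPartialHomeomorph_source hBd hω
  have hPs : (0 : ℂ × ℝ) ∈ eP.source := hpar.contDiffAt.mem_toOpenPartialHomeomorph_source hpd hω
  have hBv : ∀ v, eB v = AnalyticGraph.base (X v) := fun v => rfl
  have hB0 : eB 0 = 0 := by rw [hBv, hX.apply_zero, map_zero]
  have hB0' : eB.symm 0 = 0 := by
    have := eB.left_inv hBs
    rwa [hB0] at this
  have hsymmφ : ∀ᶠ y in 𝓝 (φ (M.point p)), DifferentiableAt ℂ eφ.symm y := by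
    have h : ContDiffAt ℂ ω eφ.symm (φ (M.point p)) :=
      (hφa (M.point p)).contDiffAt.to_localInverse hφd hω
    filter_upwards [h.eventually (by simp)] with y hy
    exact hy.differentiableAt hω
  have hsymmB : ∀ᶠ y in 𝓝 (eB 0), AnalyticAt ℝ eB.symm y := by
    have h : ContDiffAt ℝ ω eB.symm (eB 0) := hBa.contDiffAt.to_localInverse hBd hω
    exact h.analyticAt.eventually_analyticAt
  obtain ⟨W, hW, hWo, hW0⟩ := eventually_nhds_iff.1 hsymmφ
  have hBc : ContinuousAt eB 0 := eB.continuousAt hBs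
  have hall : ∀ᶠ v in 𝓝 (0 : ℂ × ℝ), v ∈ eB.source ∧ v ∈ eP.source ∧ par v ∈ M.Ω ∧
      M.point (par v) ∈ eφ.source ∧ AnalyticAt ℝ X v ∧ AnalyticAt ℝ eB.symm (eB v) := by
    have h1 : ContinuousAt (fun v => M.point (par v)) 0 :=
      ContinuousAt.comp (g := M.point) hpt.continuousAt hpar.continuousAt
    filter_upwards [eB.open_source.mem_nhds hBs, eP.open_source.mem_nhds hPs,
      hpar.continuousAt.eventually (M.isOpen.mem_nhds hp),
      h1.eventually (eφ.open_source.mem_nhds hφs), hXa.eventually_analyticAt,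
      hBc.eventually hsymmB] with v a1 a2 a3 a4 a5 a6
    exact ⟨a1, a2, a3, a4, a5, a6⟩
  obtain ⟨V, hV, hVo, hV0⟩ := eventually_nhds_iff.1 hall
  have hVB : IsOpen (eB '' V) := eB.isOpen_image_of_subset_source hVo fun v hv => (hV v hv).1
  have hVP : IsOpen (eP '' V) := eP.isOpen_image_of_subset_source hVo fun v hv => (hV v hv).2.1
  let N : AnalyticGraph :=
    { Ω := eB '' V
      isOpen := hVB
      F := fun y => (X (eB.symm y)).2.im
      analytic := by
        rintro _ ⟨v, hv, rfl⟩
        have h1 : AnalyticAt ℝ X (eB.symm (eB v)) := by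
          rw [eB.left_inv (hV v hv).1]
          exact (hV v hv).2.2.2.2.1
        exact ((Complex.imCLM.comp (ContinuousLinearMap.snd ℝ ℂ ℂ)).analyticAt _).fun_comp
          (h1.fun_comp (hV v hv).2.2.2.2.2) }
  have hNF : ∀ v ∈ V, N.F (eB v) = (X v).2.im := by
    intro v hv
    change (X (eB.symm (eB v))).2.im = _
    rw [eB.left_inv (hV v hv).1]
  have hXN : ∀ v ∈ V, X v ∈ N.carrier := fun v hv => ⟨⟨v, hv, rfl⟩, (hNF v hv).symm⟩
  -- The domain is cut so that the inverse is holomorphic on the target (`W`) and every point of `M`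
  -- in it is `M.point (par v)` with `v ∈ V`. The second condition makes the two hypersurfaces
  -- correspond exactly.
  let s : Set (ℂ × ℂ) := (eφ.source ∩ eφ ⁻¹' W) ∩ AnalyticGraph.base ⁻¹' (eP '' V)
  have hs : IsOpen s := (eφ.isOpen_inter_preimage hWo).inter
    (hVP.preimage AnalyticGraph.base.continuous)
  refine ⟨eφ.restrOpen s hs, rfl, N, ?_, ?_⟩
  · have h1 : Tendsto eB.symm (𝓝 0) (𝓝 0) := by
      have := (eB.continuousAt_symm (x := 0) (by rw [← hB0]; exact eB.map_source hBs)).tendsto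
      rwa [hB0'] at this
    have h2 := IsBigO.comp_tendsto (IsBigO.trans hX.defect hX.isBigO_base) h1
    have hmem : eB '' V ∈ 𝓝 (0 : ℂ × ℝ) := hVB.mem_nhds ⟨0, hV0, hB0⟩
    refine h2.congr' ?_ ?_
    · filter_upwards [hmem] with y hy
      obtain ⟨v, hv, rfl⟩ := hy
      rw [hNF v hv, Function.comp_apply, eB.left_inv (hV v hv).1]
      rfl
    · filter_upwards [hmem] with y hy
      obtain ⟨v, hv, rfl⟩ := hy
      rw [Function.comp_apply, eB.left_inv (hV v hv).1]
      rfl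
  · refine ⟨hφ.differentiableOn, ?_, hp, ⟨0, hV0, hB0⟩, ?_, ?_, ?_⟩
    · rintro y ⟨hy1, hy2⟩
      refine (hW y ?_).differentiableWithinAt
      have h1 : eφ (eφ.symm y) ∈ W := hy2.1.2
      rwa [eφ.right_inv hy1] at h1
    · refine ⟨hφs, ⟨hφs, hW0⟩, ?_⟩
      rw [mem_preimage, AnalyticGraph.base_point]
      exact ⟨0, hV0, rfl⟩
    · change φ (M.point p) = N.point 0
      have h1 : N.F 0 = 0 := by
        have := hNF 0 hV0
        rwa [hB0, hX.apply_zero] at this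
      rw [hX0]
      ext1 <;> simp [AnalyticGraph.point, h1]
    · rintro x ⟨hx, -, v, hv, hvx⟩
      change φ x ∈ N.carrier ↔ x ∈ M.carrier
      constructor
      · rintro ⟨⟨v', hv', h1⟩, h2⟩
        have h3 : X v' = φ x := by
          have h4 : (X v').1 = (φ x).1 := congrArg (fun y : ℂ × ℝ => y.1) h1
          have h5 : (X v').2.re = (φ x).2.re := congrArg (fun y : ℂ × ℝ => y.2) h1
          have h6 : (X v').2.im = (φ x).2.im := by
            rw [h2, ← h1, hNF v' hv']
          exact Prod.ext h4 (Complex.ext h5 h6)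
        have h7 : M.point (par v') = x :=
          eφ.injOn (hV v' hv').2.2.2.1 hx h3
        rw [← h7]
        exact M.point_mem_carrier (hV v' hv').2.2.1
      · intro hxM
        have h1 : M.point (par v) = x := by
          rw [← AnalyticGraph.point_base hxM, ← hvx]
          rfl
        rw [← h1]
        exact hXN v hv

/-! ### The leading order normalization, with analytic dependence on the point -/

theorem AnalyticAt.clm_apply_fun {E F G : Type*} [NormedAddCommGroup E] [NormedSpace ℝ E]
    [NormedAddCommGroup F] [NormedSpace ℝ F] [NormedAddCommGroup G] [NormedSpace ℝ G]
    [CompleteSpace F] [CompleteSpace G] {f : E → F →L[ℝ] G} {v : E → F} {p : E}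
    (hf : AnalyticAt ℝ f p) (hv : AnalyticAt ℝ v p) : AnalyticAt ℝ (fun q => f q (v q)) p :=
  (hf.contDiffAt.clm_apply (n := ω) hv.contDiffAt).analyticAt

theorem AnalyticAt.isBigO_taylor_two {E F : Type*} [NormedAddCommGroup E] [NormedSpace ℝ E]
    [NormedAddCommGroup F] [NormedSpace ℝ F] [CompleteSpace F] {f : E → F} {p : E}
    (hf : AnalyticAt ℝ f p) :
    (fun y => f (p + y) - f p - fderiv ℝ f p y - (1 / 2 : ℝ) • fderiv ℝ (fderiv ℝ f) p y y)
      =O[𝓝 0] fun y => ‖y‖ ^ 3 := by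
  obtain ⟨ser, r, hser⟩ := hf
  refine (hser.hasFPowerSeriesAt.isBigO_sub_partialSum_pow 3).congr_left fun y => ?_
  have h0 := hser.factorial_smul y 0
  have h1 := hser.factorial_smul y 1
  have h2 := hser.factorial_smul y 2
  simp only [Nat.factorial_zero, one_smul, iteratedFDeriv_zero_apply, Nat.factorial_one,
    iteratedFDeriv_one_apply, Nat.factorial_two, iteratedFDeriv_two_apply] at h0 h1 h2
  simp only [FormalMultilinearSeries.partialSum, Finset.sum_range_succ, Finset.sum_range_zero, h0,
    h1, ← h2]
  module

namespace AnalyticGraph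

variable (M : AnalyticGraph)

/-- The partial derivative `F_u`. -/
noncomputable def Fu (p : ℂ × ℝ) : ℝ := fderiv ℝ M.F p (0, 1)

/-- The partial derivative `F_x`. -/
noncomputable def Fx (p : ℂ × ℝ) : ℝ := fderiv ℝ M.F p (1, 0)

/-- The partial derivative `F_y`. -/
noncomputable def Fy (p : ℂ × ℝ) : ℝ := fderiv ℝ M.F p (Complex.I, 0)

/-- The base vector of the CR-tangent vector with `z`-component `1`. -/
noncomputable def crX (p : ℂ × ℝ) : ℂ × ℝ :=
  (1, (M.Fy p - M.Fu p * M.Fx p) / (1 + M.Fu p ^ 2))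

/-- The base vector of the CR-tangent vector with `z`-component `i`. -/
noncomputable def crY (p : ℂ × ℝ) : ℂ × ℝ :=
  (Complex.I, -(M.Fx p + M.Fu p * M.Fy p) / (1 + M.Fu p ^ 2))

/-- The Hessian of `F`. -/
noncomputable def hess (p : ℂ × ℝ) : ℂ × ℝ →L[ℝ] ℂ × ℝ →L[ℝ] ℝ := fderiv ℝ (fderiv ℝ M.F) p

/-- The Levi coefficient. -/
noncomputable def leviCoeff (p : ℂ × ℝ) : ℝ :=
  (M.hess p (M.crX p) (M.crX p) + M.hess p (M.crY p) (M.crY p)) / 4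

/-- The coefficient of the pluriharmonic quadratic term. -/
noncomputable def harmCoeff (p : ℂ × ℝ) : ℂ :=
  ((M.hess p (M.crX p) (M.crX p) - M.hess p (M.crY p) (M.crY p) : ℝ) : ℂ) / 8 -
    ((M.hess p (M.crX p) (M.crY p) + M.hess p (M.crY p) (M.crX p) : ℝ) : ℂ) * Complex.I / 8

/-- The coefficient `F_z`. -/
noncomputable def Fz (p : ℂ × ℝ) : ℂ := ((M.Fx p : ℂ) - (M.Fy p : ℂ) * Complex.I) / 2

/-- The quadratic terms along the CR-tangent space. -/
noncomputable def quadTerm (p : ℂ × ℝ) (ζ : ℂ) : ℝ :=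
  M.leviCoeff p * (ζ.re ^ 2 + ζ.im ^ 2) + 2 * (M.harmCoeff p * ζ ^ 2).re

/-- The weight two correction in the `u`-coordinate of `param`. -/
noncomputable def paramShift (p q : ℂ × ℝ) : ℝ :=
  (M.leviCoeff p * q.2 - M.Fu p * M.quadTerm p q.1 - 2 * (M.harmCoeff p * q.1 ^ 2).im) /
    (1 + M.Fu p ^ 2)

/-- The increment of the base point, in adapted coordinates `(ζ, s)`. -/
noncomputable def paramStep (p q : ℂ × ℝ) : ℂ × ℝ :=
  (q.1.re • M.crX p + q.1.im • M.crY p) + M.paramShift p q • ((0, 1) : ℂ × ℝ)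

/-- The adapted coordinates `(ζ, s)` at the point `p`. -/
noncomputable def param (p q : ℂ × ℝ) : ℂ × ℝ := p + M.paramStep p q

/-- The quadratic map which normalizes `M` at `p` to leading order. -/
noncomputable def quadMap (p : ℂ × ℝ) (P : ℂ × ℂ) : ℂ × ℂ :=
  (P.1 - p.1, ((1 - M.Fu p * Complex.I) * (P.2 - (M.point p).2) -
    2 * Complex.I * M.Fz p * (P.1 - p.1) - 2 * Complex.I * M.harmCoeff p * (P.1 - p.1) ^ 2) /
      M.leviCoeff p)

variable {M}

theorem fderiv_F_apply (p v : ℂ × ℝ) :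
    fderiv ℝ M.F p v = v.1.re * M.Fx p + v.1.im * M.Fy p + v.2 * M.Fu p := by
  have hv : v = v.1.re • ((1, 0) : ℂ × ℝ) + v.1.im • ((Complex.I, 0) : ℂ × ℝ) +
      v.2 • ((0, 1) : ℂ × ℝ) := by
    ext1 <;> simp
  conv_lhs => rw [hv]
  simp only [map_add, map_smul, smul_eq_mul, Fx, Fy, Fu]

theorem one_add_Fu_sq_pos (p : ℂ × ℝ) : 0 < 1 + M.Fu p ^ 2 := by positivity

theorem fderiv_fderiv_rho {p : ℂ × ℝ} (hp : p ∈ M.Ω) (ξ η : ℂ × ℂ) :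
    fderiv ℝ (fderiv ℝ M.rho) (M.point p) ξ η = M.hess p (base ξ) (base η) := by
  have h1 : fderiv ℝ M.rho =ᶠ[𝓝 (M.point p)] fun P => (fderiv ℝ M.F (base P)).comp base -
      Complex.imCLM.comp (ContinuousLinearMap.snd ℝ ℂ ℂ) := by
    have h2 : ∀ᶠ P in 𝓝 (M.point p), base P ∈ M.Ω :=
      base.continuous.continuousAt.eventually (M.isOpen.mem_nhds (by rwa [base_point]))
    filter_upwards [h2] with P hP
    exact (M.hasFDerivAt_rho hP).fderiv
  rw [h1.fderiv_eq]
  have h3 : HasFDerivAt (fderiv ℝ M.F) (M.hess p) (base (M.point p)) := by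
    rw [base_point]
    exact (M.analytic p hp).fderiv.differentiableAt.hasFDerivAt
  have h4 : HasFDerivAt (fun P => fderiv ℝ M.F (base P)) ((M.hess p).comp base) (M.point p) :=
    h3.comp _ base.hasFDerivAt
  have h5 := (h4.clm_comp (hasFDerivAt_const base (M.point p))).sub_const
    (Complex.imCLM.comp (ContinuousLinearMap.snd ℝ ℂ ℂ))
  rw [h5.fderiv]
  simp

/-- The lifts of `crX` and `crY` are `ξ` and `iξ` for a CR-tangent `ξ ≠ 0`, so the Levi form of `ξ`
is four times this coefficient. -/
theorem leviCoeff_ne_zero (hM : M.LeviNondegenerate) {p : ℂ × ℝ} (hp : p ∈ M.Ω) :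
    M.leviCoeff p ≠ 0 := by
  have hpos := (one_add_Fu_sq_pos (M := M) p).ne'
  set ξ := M.tangentLift p (M.crX p) with hξ
  have hI : Complex.I • ξ = M.tangentLift p (M.crY p) := by
    ext1
    · simp [hξ, tangentLift, crX, crY]
    · have hre : ∀ v, (M.tangentLift p v).2.re = v.2 := fun v => by simp [tangentLift]
      have him : ∀ v, (M.tangentLift p v).2.im = fderiv ℝ M.F p v := fun v => by simp [tangentLift]
      apply Complex.ext
      · simp only [Prod.smul_snd, smul_eq_mul, Complex.I_mul_re, hre, him, hξ, fderiv_F_apply]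
        simp only [crX, crY, Complex.one_re, Complex.one_im]
        field_simp
        ring
      · simp only [Prod.smul_snd, smul_eq_mul, Complex.I_mul_im, hre, him, hξ, fderiv_F_apply]
        simp only [crX, crY, Complex.I_re, Complex.I_im]
        field_simp
        ring
  have hCR : M.CRTangent p ξ := by
    refine ⟨?_, ?_⟩
    · rw [M.fderiv_rho_eq_zero_iff hp, hξ, base_tangentLift]
    · rw [hI, M.fderiv_rho_eq_zero_iff hp, base_tangentLift]
  have h0 : ξ ≠ 0 := by
    intro h
    have := congrArg Prod.fst h
    simp [hξ, tangentLift, crX] at this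
  have h1 := hM p hp ξ hCR h0
  rw [leviForm, hI, fderiv_fderiv_rho hp, fderiv_fderiv_rho hp, hξ, base_tangentLift,
    base_tangentLift] at h1
  unfold leviCoeff
  intro h2
  apply h1
  linarith

section Analytic

variable {p₀ : ℂ × ℝ}

theorem analyticAt_fderiv_F (hp : p₀ ∈ M.Ω) : AnalyticAt ℝ (fderiv ℝ M.F) p₀ := (M.analytic p₀ hp).fderiv

theorem analyticAt_Fu (hp : p₀ ∈ M.Ω) : AnalyticAt ℝ M.Fu p₀ :=
  (analyticAt_fderiv_F hp).clm_apply_fun analyticAt_const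

theorem analyticAt_Fx (hp : p₀ ∈ M.Ω) : AnalyticAt ℝ M.Fx p₀ :=
  (analyticAt_fderiv_F hp).clm_apply_fun analyticAt_const

theorem analyticAt_Fy (hp : p₀ ∈ M.Ω) : AnalyticAt ℝ M.Fy p₀ :=
  (analyticAt_fderiv_F hp).clm_apply_fun analyticAt_const

theorem analyticAt_crX (hp : p₀ ∈ M.Ω) : AnalyticAt ℝ M.crX p₀ := by
  have h1 := analyticAt_Fu hp
  have h2 := analyticAt_Fx hp
  have h3 := analyticAt_Fy hp
  exact analyticAt_const.prod ((h3.sub (h1.mul h2)).div (analyticAt_const.add (h1.pow 2))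
    (one_add_Fu_sq_pos p₀).ne')

theorem analyticAt_crY (hp : p₀ ∈ M.Ω) : AnalyticAt ℝ M.crY p₀ := by
  have h1 := analyticAt_Fu hp
  have h2 := analyticAt_Fx hp
  have h3 := analyticAt_Fy hp
  exact analyticAt_const.prod ((h2.add (h1.mul h3)).neg.div (analyticAt_const.add (h1.pow 2))
    (one_add_Fu_sq_pos p₀).ne')

theorem analyticAt_hess_apply (hp : p₀ ∈ M.Ω) {v w : ℂ × ℝ → ℂ × ℝ} (hv : AnalyticAt ℝ v p₀)
    (hw : AnalyticAt ℝ w p₀) : AnalyticAt ℝ (fun p => M.hess p (v p) (w p)) p₀ :=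
  (AnalyticAt.clm_apply_fun (analyticAt_fderiv_F hp).fderiv hv).clm_apply_fun hw

theorem analyticAt_leviCoeff (hp : p₀ ∈ M.Ω) : AnalyticAt ℝ M.leviCoeff p₀ :=
  ((analyticAt_hess_apply hp (analyticAt_crX hp) (analyticAt_crX hp)).add
    (analyticAt_hess_apply hp (analyticAt_crY hp) (analyticAt_crY hp))).div analyticAt_const
      (by norm_num)

theorem analyticAt_harmCoeff (hp : p₀ ∈ M.Ω) : AnalyticAt ℝ M.harmCoeff p₀ := by
  have hx := analyticAt_crX hp
  have hy := analyticAt_crY hp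
  have h1 := (Complex.ofRealCLM.analyticAt _).fun_comp
    ((analyticAt_hess_apply hp hx hx).fun_sub (analyticAt_hess_apply hp hy hy))
  have h2 := (Complex.ofRealCLM.analyticAt _).fun_comp
    ((analyticAt_hess_apply hp hx hy).fun_add (analyticAt_hess_apply hp hy hx))
  exact (h1.div analyticAt_const (by norm_num)).sub
    ((h2.mul analyticAt_const).div analyticAt_const (by norm_num))

theorem analyticAt_Fz (hp : p₀ ∈ M.Ω) : AnalyticAt ℝ M.Fz p₀ :=
  (((Complex.ofRealCLM.analyticAt _).fun_comp (analyticAt_Fx hp)).sub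
    (((Complex.ofRealCLM.analyticAt _).fun_comp (analyticAt_Fy hp)).mul analyticAt_const)).div
      analyticAt_const (by norm_num)

theorem analyticAt_quadMap (hp : p₀ ∈ M.Ω) (hM : M.LeviNondegenerate) (Q : ℂ × ℂ) :
    AnalyticAt ℝ (fun x : (ℂ × ℝ) × (ℂ × ℂ) => M.quadMap x.1 x.2) (p₀, Q) := by
  have key : ∀ {f : ℂ × ℝ → ℂ}, AnalyticAt ℝ f p₀ →
      AnalyticAt ℝ (fun x : (ℂ × ℝ) × (ℂ × ℂ) => f x.1) (p₀, Q) := fun hf =>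
    AnalyticAt.fun_comp (f := Prod.fst) (x := (p₀, Q)) hf analyticAt_fst
  have h1 := key ((Complex.ofRealCLM.analyticAt _).fun_comp (analyticAt_Fu hp))
  have h2 := key (analyticAt_Fz hp)
  have h3 := key (analyticAt_harmCoeff hp)
  have h4 := key ((Complex.ofRealCLM.analyticAt _).fun_comp (analyticAt_leviCoeff hp))
  have h5 := key (analyticAt_snd.fun_comp (M.analyticAt_point hp))
  have h6 : AnalyticAt ℝ (fun x : (ℂ × ℝ) × (ℂ × ℂ) => x.2.1 - x.1.1) (p₀, Q) :=
    (analyticAt_fst.fun_comp analyticAt_snd).fun_sub (key analyticAt_fst)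
  have h7 : AnalyticAt ℝ (fun x : (ℂ × ℝ) × (ℂ × ℂ) => x.2.2) (p₀, Q) :=
    analyticAt_snd.fun_comp analyticAt_snd
  refine h6.prod (((((analyticAt_const.sub (h1.mul analyticAt_const)).mul (h7.sub h5)).sub
    ((analyticAt_const.mul h2).mul h6)).sub ((analyticAt_const.mul h3).mul (h6.pow 2))).div h4 ?_)
  exact_mod_cast leviCoeff_ne_zero hM hp

theorem analyticAt_param (hp : p₀ ∈ M.Ω) (q : ℂ × ℝ) :
    AnalyticAt ℝ (fun x : (ℂ × ℝ) × (ℂ × ℝ) => M.param x.1 x.2) (p₀, q) := by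
  have key : ∀ {E : Type} [NormedAddCommGroup E] [NormedSpace ℝ E] {f : ℂ × ℝ → E},
      AnalyticAt ℝ f p₀ → AnalyticAt ℝ (fun x : (ℂ × ℝ) × (ℂ × ℝ) => f x.1) (p₀, q) := fun hf =>
    AnalyticAt.fun_comp (f := Prod.fst) (x := (p₀, q)) hf analyticAt_fst
  have hre : ∀ {f : (ℂ × ℝ) × (ℂ × ℝ) → ℂ}, AnalyticAt ℝ f (p₀, q) →
      AnalyticAt ℝ (fun x => (f x).re) (p₀, q) := fun hf =>
    (Complex.reCLM.analyticAt _).fun_comp hf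
  have him : ∀ {f : (ℂ × ℝ) × (ℂ × ℝ) → ℂ}, AnalyticAt ℝ f (p₀, q) →
      AnalyticAt ℝ (fun x => (f x).im) (p₀, q) := fun hf =>
    (Complex.imCLM.analyticAt _).fun_comp hf
  have hζ : AnalyticAt ℝ (fun x : (ℂ × ℝ) × (ℂ × ℝ) => x.2.1) (p₀, q) :=
    analyticAt_fst.fun_comp analyticAt_snd
  have hs : AnalyticAt ℝ (fun x : (ℂ × ℝ) × (ℂ × ℝ) => x.2.2) (p₀, q) :=
    analyticAt_snd.fun_comp analyticAt_snd
  have hx := key (analyticAt_crX hp)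
  have hy := key (analyticAt_crY hp)
  have hu := key (analyticAt_Fu hp)
  have hc := key (analyticAt_leviCoeff hp)
  have hd := (key (analyticAt_harmCoeff hp)).mul (hζ.pow 2)
  have hQ : AnalyticAt ℝ (fun x : (ℂ × ℝ) × (ℂ × ℝ) => M.quadTerm x.1 x.2.1) (p₀, q) :=
    (hc.mul (((hre hζ).pow 2).add ((him hζ).pow 2))).add (analyticAt_const.mul (hre hd))
  have hsh : AnalyticAt ℝ (fun x : (ℂ × ℝ) × (ℂ × ℝ) => M.paramShift x.1 x.2) (p₀, q) :=
    (((hc.mul hs).sub (hu.mul hQ)).sub (analyticAt_const.mul (him hd))).div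
      (analyticAt_const.add (hu.pow 2)) (one_add_Fu_sq_pos p₀).ne'
  exact (key analyticAt_id).add ((((hre hζ).smul hx).add ((him hζ).smul hy)).add
    (hsh.smul analyticAt_const))

end Analytic

theorem param_zero (p : ℂ × ℝ) : M.param p 0 = p := by
  simp [param, paramStep, paramShift, quadTerm]

theorem paramStep_fst (p q : ℂ × ℝ) : (M.paramStep p q).1 = q.1 := by
  simp [paramStep, crX, crY]

theorem WO_paramShift (p : ℂ × ℝ) : WO 2 (M.paramShift p) := by
  have hd : WO 2 fun q : ℂ × ℝ => M.harmCoeff p * q.1 ^ 2 := (WO_fst.pow 2).const_mul _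
  have hr : WO 2 fun q : ℂ × ℝ => q.1.re ^ 2 + q.1.im ^ 2 := (WO_fst.re.pow 2).add (WO_fst.im.pow 2)
  have hQ : WO 2 fun q : ℂ × ℝ => M.quadTerm p q.1 := (hr.const_mul _).add (hd.re.const_mul 2)
  have h := (((WO_snd.const_mul (M.leviCoeff p)).sub (hQ.const_mul (M.Fu p))).sub
    (hd.im.const_mul 2)).const_mul (1 + M.Fu p ^ 2)⁻¹
  exact h.congr fun q => by rw [paramShift, div_eq_inv_mul]

theorem WO_paramStep (p : ℂ × ℝ) : WO 1 (M.paramStep p) := by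
  have key : ∀ {f : ℂ × ℝ → ℝ} (v : ℂ × ℝ), WO 1 f → WO 1 fun q => f q • v := fun v hf =>
    (hf.const_mul ‖v‖).of_norm_le fun q => by simp [norm_smul, mul_comm]
  exact ((key _ WO_fst.re).add (key _ WO_fst.im)).add (key _ ((WO_paramShift p).mono (by norm_num)))

/-- A real quadratic form on `ℂ` splits as a multiple of `|ζ|²` plus the real part of a multiple of
`ζ²`; here the form is the Hessian restricted to the CR directions. -/
theorem quadTerm_eq (p : ℂ × ℝ) (ζ : ℂ) : M.quadTerm p ζ =
    M.hess p (ζ.re • M.crX p + ζ.im • M.crY p) (ζ.re • M.crX p + ζ.im • M.crY p) / 2 := by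
  simp only [quadTerm, harmCoeff, leviCoeff, map_add, map_smul, add_apply, smul_apply, smul_eq_mul]
  simp [pow_two]
  ring

/-- Multiplication by `1 - iF_u` and the term in `F_z` remove the linear part of `F`, and the `ζ²`
term removes the pluriharmonic one. This leaves `v = c|ζ|²` up to the Taylor remainder, which
division by the Levi coefficient `c` turns into `v = z z̄`. `paramShift` is chosen so that the new
`u` is `s` up to the same remainder. -/
theorem isNearQuadric_quadMap (hM : M.LeviNondegenerate) {p : ℂ × ℝ} (hp : p ∈ M.Ω) :
    IsNearQuadric 3 fun q => M.quadMap p (M.point (M.param p q)) := by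
  have hpos := (one_add_Fu_sq_pos (M := M) p).ne'
  have hc := leviCoeff_ne_zero hM hp
  have hc' : (M.leviCoeff p : ℂ) ≠ 0 := by exact_mod_cast hc
  -- the remainder in the second order expansion of `F`
  set R : ℂ × ℝ → ℝ := fun q => M.F (M.param p q) - M.F p - fderiv ℝ M.F p (M.paramStep p q) -
    M.quadTerm p q.1 with hR
  have hRWO : WO 3 R := by
    have ht : Tendsto (M.paramStep p) (𝓝 0) (𝓝 0) := by
      refine IsBigO.trans_tendsto (WO_paramStep p) ?_
      simpa using tendsto_wt
    have h1 : WO 3 fun q => M.F (p + M.paramStep p q) - M.F p - fderiv ℝ M.F p (M.paramStep p q) -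
        fderiv ℝ (fderiv ℝ M.F) p (M.paramStep p q) (M.paramStep p q) / 2 := by
      have h0 := IsBigO.comp_tendsto (M.analytic p hp).isBigO_taylor_two ht
      simp only [smul_eq_mul, one_div_mul_eq_div] at h0
      refine IsBigO.trans h0 ?_
      have := (WO_paramStep (M := M) p).norm_left.pow 3
      simp only [pow_one] at this
      exact this
    have h2 : ∀ v w : ℂ × ℝ, ∀ f : ℂ × ℝ → ℝ, WO 3 f → WO 3 fun q => f q * M.hess p v w :=
      fun v w f hf => (hf.const_mul (M.hess p v w)).congr fun q => mul_comm _ _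
    have hsx : WO 3 fun q => M.paramShift p q * q.1.re := (WO_paramShift p).mul WO_fst.re
    have hsy : WO 3 fun q => M.paramShift p q * q.1.im := (WO_paramShift p).mul WO_fst.im
    have hss : WO 3 fun q => M.paramShift p q * M.paramShift p q :=
      ((WO_paramShift p).mul (WO_paramShift p)).mono (by norm_num)
    -- The Hessian terms involving the shift have weight at least 3, since the shift has weight 2.
    have h3 := (((((h2 (M.crX p) (0, 1) _ hsx).add (h2 (M.crY p) (0, 1) _ hsy)).add
      (h2 (0, 1) (M.crX p) _ hsx)).add (h2 (0, 1) (M.crY p) _ hsy)).add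
      (h2 (0, 1) (0, 1) _ hss)).const_mul (1 / 2)
    refine (h1.add h3).congr fun q => ?_
    simp only [hR, quadTerm_eq, param]
    change _ - M.hess p (M.paramStep p q) (M.paramStep p q) / 2 + _ = _
    have e : M.hess p (M.paramStep p q) (M.paramStep p q) =
        M.hess p (q.1.re • M.crX p + q.1.im • M.crY p) (q.1.re • M.crX p + q.1.im • M.crY p) +
        M.paramShift p q * (q.1.re * M.hess p (M.crX p) (0, 1) + q.1.im * M.hess p (M.crY p) (0, 1) +
          q.1.re * M.hess p (0, 1) (M.crX p) + q.1.im * M.hess p (0, 1) (M.crY p) +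
          M.paramShift p q * M.hess p (0, 1) (0, 1)) := by
      conv_lhs => rw [paramStep]
      simp only [map_add, map_smul, add_apply, smul_apply, smul_eq_mul]
      ring
    rw [e]
    ring
  have hsnd : ∀ q, (M.quadMap p (M.point (M.param p q))).2 - (quadricPoint q).2 =
      (M.Fu p + Complex.I) / M.leviCoeff p * (R q : ℂ) := by
    intro q
    have hF : M.F (M.param p q) = R q + M.F p + fderiv ℝ M.F p (M.paramStep p q) +
      M.quadTerm p q.1 := by rw [hR]; ring
    have hz : (M.param p q).1 - p.1 = q.1 := by
      rw [param, Prod.fst_add, paramStep_fst, add_sub_cancel_left]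
    have hu : (M.param p q).2 = p.2 + (q.1.re * ((M.Fy p - M.Fu p * M.Fx p) / (1 + M.Fu p ^ 2)) +
        q.1.im * (-(M.Fx p + M.Fu p * M.Fy p) / (1 + M.Fu p ^ 2)) + M.paramShift p q) := by
      simp [param, paramStep, crX, crY]
    have hD : fderiv ℝ M.F p (M.paramStep p q) = q.1.re * M.Fx p + q.1.im * M.Fy p +
        ((M.param p q).2 - p.2) * M.Fu p := by
      rw [fderiv_F_apply, paramStep_fst, param, Prod.snd_add]
      ring
    have hμ : (1 + M.Fu p ^ 2) * ((M.param p q).2 - p.2) = q.1.re * (M.Fy p - M.Fu p * M.Fx p) -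
        q.1.im * (M.Fx p + M.Fu p * M.Fy p) + (M.leviCoeff p * q.2 - M.Fu p * M.quadTerm p q.1 -
        2 * (M.harmCoeff p * q.1 ^ 2).im) := by
      rw [hu, paramShift]
      field_simp
      ring
    set μ := (M.param p q).2 - p.2 with hμdef
    have hw : (M.point (M.param p q)).2 - (M.point p).2 =
        (μ : ℂ) + ((R q + fderiv ℝ M.F p (M.paramStep p q) + M.quadTerm p q.1 : ℝ) : ℂ) *
          Complex.I := by
      simp only [point, hF, hμdef]
      push_cast
      ring
    have hz' : (M.point (M.param p q)).1 - p.1 = q.1 := hz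
    simp only [quadMap]
    rw [hz', hw, hD]
    rw [div_sub' hc', div_mul_eq_mul_div]
    congr 1
    apply Complex.ext
    · simp [quadricPoint, Fz, pow_two, quadTerm] at hμ ⊢
      linear_combination hμ
    · simp [quadricPoint, Fz, pow_two, quadTerm] at hμ ⊢
      ring
  have h3 : WO 3 fun q => (M.quadMap p (M.point (M.param p q))).2 - (quadricPoint q).2 :=
    (hRWO.ofReal.const_mul _).congr fun q => (hsnd q).symm
  have hfst : ∀ q, (M.quadMap p (M.point (M.param p q))).1 = q.1 := by
    intro q
    change (M.param p q).1 - p.1 = q.1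
    rw [param, Prod.fst_add, paramStep_fst, add_sub_cancel_left]
  refine ⟨WO.zero.congr fun q => (by rw [hfst]; ring), h3, h3.im.congr fun q => ?_⟩
  rw [hfst]
  simp [quadricPoint, Complex.sq_norm, Complex.normSq_apply]

theorem differentiable_quadMap (p : ℂ × ℝ) : Differentiable ℂ (M.quadMap p) := by
  unfold quadMap
  fun_prop

/-- Normalizing maps exist at all points, and can be chosen analytic in the point. -/
theorem exists_analytic_normalizing (hM : M.LeviNondegenerate) {p₀ : ℂ × ℝ} (hp : p₀ ∈ M.Ω) :
    ∃ Φ : ℂ × ℝ → ℂ × ℂ → ℂ × ℂ,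
      AnalyticAt ℝ (fun x : (ℂ × ℝ) × (ℂ × ℝ) => Φ x.1 (M.point x.2)) (p₀, p₀) ∧
      ∀ᶠ p in 𝓝 p₀, ∃ e : OpenPartialHomeomorph (ℂ × ℂ) (ℂ × ℂ),
        (e : ℂ × ℂ → ℂ × ℂ) = Φ p ∧ M.IsNormalizing p e := by
  have hpar := analyticAt_param (M := M) hp 0
  have hpt : AnalyticAt ℝ M.point (M.param (p₀, (0 : ℂ × ℝ)).1 (p₀, (0 : ℂ × ℝ)).2) := by
    rw [param_zero]
    exact M.analyticAt_point hp
  have hX : AnalyticAt ℝ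
      (fun x : (ℂ × ℝ) × (ℂ × ℝ) => M.quadMap x.1 (M.point (M.param x.1 x.2))) (p₀, 0) :=
    AnalyticAt.fun_comp (g := fun x : (ℂ × ℝ) × (ℂ × ℂ) => M.quadMap x.1 x.2)
      (f := fun x : (ℂ × ℝ) × (ℂ × ℝ) => (x.1, M.point (M.param x.1 x.2)))
      (analyticAt_quadMap hp hM _) (analyticAt_fst.prod (AnalyticAt.fun_comp hpt hpar))
  have hΩ : ∀ᶠ p in 𝓝 p₀, p ∈ M.Ω := M.isOpen.mem_nhds hp
  obtain ⟨S, hS1, hS2, hS3⟩ := exists_normalizing_family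
    (X := fun p q => M.quadMap p (M.point (M.param p q))) hX
    (hΩ.mono fun p h => isNearQuadric_quadMap hM h) (l := 6) (by norm_num) le_rfl
  refine ⟨fun p P => S p (M.quadMap p P), ?_, ?_⟩
  · have h1 : AnalyticAt ℝ (fun x : (ℂ × ℝ) × (ℂ × ℝ) => M.quadMap x.1 (M.point x.2)) (p₀, p₀) :=
      AnalyticAt.fun_comp (g := fun x : (ℂ × ℝ) × (ℂ × ℂ) => M.quadMap x.1 x.2)
        (f := fun x : (ℂ × ℝ) × (ℂ × ℝ) => (x.1, M.point x.2))
        (analyticAt_quadMap hp hM _) (analyticAt_fst.prod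
          (AnalyticAt.fun_comp (g := M.point) (M.analyticAt_point hp) analyticAt_snd))
    exact AnalyticAt.fun_comp (g := fun x : (ℂ × ℝ) × (ℂ × ℂ) => S x.1 x.2)
      (f := fun x : (ℂ × ℝ) × (ℂ × ℝ) => (x.1, M.quadMap x.1 (M.point x.2))) (hS2 _)
      (analyticAt_fst.prod h1)
  · filter_upwards [hΩ, hS3] with p h1 h2
    have hparp : AnalyticAt ℝ (M.param p) 0 :=
      AnalyticAt.fun_comp (g := fun x : (ℂ × ℝ) × (ℂ × ℝ) => M.param x.1 x.2)
        (f := fun q : ℂ × ℝ => (p, q)) (analyticAt_param h1 0) (analyticAt_const.prod analyticAt_id)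
    exact M.exists_isNormalizing h1 hparp (param_zero p)
      ((hS1 p).comp (differentiable_quadMap p)) h2

end AnalyticGraph

/-! ### Coefficients of vanishing polynomials -/

theorem coeff_linear {a : ℂ} (h : ∀ z : ℂ, (a * z).re = 0) : a = 0 := by
  have h1 := h 1
  have h2 := h Complex.I
  simp at h1 h2
  exact Complex.ext h1 h2

theorem coeff_quadratic {a : ℂ} {c : ℝ} (h : ∀ z : ℂ, (a * z ^ 2).re + c * Complex.normSq z = 0) :
    a = 0 ∧ c = 0 := by
  have h1 := h 1
  have h2 := h Complex.I
  have h3 := h (1 + Complex.I)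
  simp [pow_two, Complex.normSq_apply] at h1 h2 h3
  exact ⟨Complex.ext (by simp; linarith) (by simp; linarith), by linarith⟩

theorem coeff_cubic {a b : ℂ} (h : ∀ z : ℂ, (a * z ^ 3 + b * (z ^ 2 * conj z)).re = 0) :
    a = 0 ∧ b = 0 := by
  have h1 := h 1
  have h2 := h Complex.I
  have h3 := h (1 + Complex.I)
  have h4 := h (1 - Complex.I)
  simp [pow_succ] at h1 h2 h3 h4
  refine ⟨Complex.ext ?_ ?_, Complex.ext ?_ ?_⟩ <;> simp <;> linarith

theorem coeff_quartic {a b : ℂ} {c : ℝ}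
    (h : ∀ z : ℂ, (a * z ^ 4 + b * (z ^ 3 * conj z)).re + c * Complex.normSq z ^ 2 = 0) :
    b = 0 ∧ c = 0 := by
  have h1 := h 1
  have h2 := h Complex.I
  have h3 := h (1 + Complex.I)
  have h4 := h (1 - Complex.I)
  simp [pow_succ, Complex.normSq_apply] at h1 h2 h3 h4
  exact ⟨Complex.ext (by simp; linarith) (by simp; linarith), by linarith⟩

theorem coeff_quintic {a b c : ℂ}
    (h : ∀ z : ℂ, (a * z ^ 5 + b * (z ^ 4 * conj z) + c * (z ^ 3 * conj z ^ 2)).re = 0) :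
    c = 0 := by
  have h1 := h 1
  have h2 := h Complex.I
  have h3 := h (1 + Complex.I)
  have h4 := h (1 - Complex.I)
  have h5 := h (2 + Complex.I)
  have h6 := h (1 + 2 * Complex.I)
  simp [pow_succ] at h1 h2 h3 h4 h5 h6
  refine Complex.ext ?_ ?_ <;> simp <;> linarith

/-! ### Expansion of a holomorphic function along a normalized hypersurface -/

theorem complexPoly_zero (a : ℕ × ℕ → ℂ) (P : ℂ × ℂ) : complexPoly 0 a P = a (0, 0) := by
  have h : (Finset.range 6 ×ˢ Finset.range 3).filter (fun i => i.1 + 2 * i.2 = 0) =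
      {(0, 0)} := by decide
  rw [complexPoly, h]
  simp

theorem complexPoly_one (a : ℕ × ℕ → ℂ) (P : ℂ × ℂ) : complexPoly 1 a P = a (1, 0) * P.1 := by
  have h : (Finset.range 6 ×ˢ Finset.range 3).filter (fun i => i.1 + 2 * i.2 = 1) =
      {(1, 0)} := by decide
  rw [complexPoly, h]
  simp

theorem complexPoly_scale (m : ℕ) (a : ℕ × ℕ → ℂ) (q : ℂ × ℝ) (t : ℝ) :
    complexPoly m a (quadricPoint ((t : ℂ) * q.1, t ^ 2 * q.2)) =
      complexPoly m a (quadricPoint q) * (t : ℂ) ^ m := by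
  unfold complexPoly
  rw [Finset.sum_mul]
  refine Finset.sum_congr rfl fun i hi => ?_
  rw [← (Finset.mem_filter.1 hi).2]
  have : (quadricPoint ((t : ℂ) * q.1, t ^ 2 * q.2)).2 = (t : ℂ) ^ 2 * (quadricPoint q).2 := by
    simp only [quadricPoint, map_mul, Complex.conj_ofReal]
    push_cast
    ring
  rw [this, show (quadricPoint ((t : ℂ) * q.1, t ^ 2 * q.2)).1 = (t : ℂ) * (quadricPoint q).1 from
    rfl]
  ring

theorem exists_complex_taylor {f : ℂ × ℂ → ℂ} (hf : AnalyticAt ℂ f 0) :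
    ∃ a : ℕ × ℕ → ℂ, (fun P => f P - ∑ i ∈ Finset.range 6 ×ˢ Finset.range 6,
      a i * (P.1 ^ i.1 * P.2 ^ i.2)) =O[𝓝 0] fun P => ‖P‖ ^ 6 := by
  obtain ⟨ser, R, hser⟩ := hf
  let e : Fin 2 → ℂ × ℂ := ![(1, 0), (0, 1)]
  let y : ℂ × ℂ → Fin 2 → ℂ := fun q => ![q.1, q.2]
  have hye : ∀ q : ℂ × ℂ, ∑ j, y q j • e j = q := by
    intro q
    simp [y, e, Fin.sum_univ_two]
  let c : (n : ℕ) → (Fin n → Fin 2) → ℂ := fun n r => ser n fun i => e (r i)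
  let ex : (n : ℕ) → (Fin n → Fin 2) → ℕ × ℕ := fun n r => (occ r 0, occ r 1)
  refine ⟨fun i => ∑ n ∈ Finset.range 6, ∑ r : Fin n → Fin 2, if ex n r = i then c n r else 0, ?_⟩
  refine (hser.hasFPowerSeriesAt.isBigO_sub_partialSum_pow 6).congr_left fun q => ?_
  rw [zero_add]
  congr 1
  simp only [Finset.sum_mul]
  rw [Finset.sum_comm]
  refine Finset.sum_congr rfl fun n hn => ?_
  rw [Finset.sum_comm]
  conv_lhs => rw [← hye q, ContinuousMultilinearMap.apply_sum_smul]
  refine Finset.sum_congr rfl fun r _ => ?_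
  have hmem : ex n r ∈ Finset.range 6 ×ˢ Finset.range 6 := by
    have hn6 := Finset.mem_range.1 hn
    simp only [ex, Finset.mem_product, Finset.mem_range]
    exact ⟨(occ_le r 0).trans_lt hn6, (occ_le r 1).trans_lt hn6⟩
  simp only [ite_mul, zero_mul]
  rw [Finset.sum_ite_eq _ (ex n r), if_pos hmem, prod_eq_prod_pow_occ]
  simp only [Fin.prod_univ_two, y, Matrix.cons_val_zero, Matrix.cons_val_one, ex, c, smul_eq_mul]
  ring

/-- Weight below 6 forces the exponent of `w` to be at most 2, which explains the range used in
`complexPoly`. -/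
theorem sum_complexPoly (a : ℕ × ℕ → ℂ) (P : ℂ × ℂ) :
    ∑ m ∈ Finset.range 6, complexPoly m a P =
      ∑ i ∈ (Finset.range 6 ×ˢ Finset.range 6).filter (fun i => i.1 + 2 * i.2 < 6),
        a i * (P.1 ^ i.1 * P.2 ^ i.2) := by
  rw [← Finset.sum_fiberwise_of_maps_to (t := Finset.range 6) (g := fun i : ℕ × ℕ => i.1 + 2 * i.2)
    (fun i hi => by simpa using (Finset.mem_filter.1 hi).2)]
  refine Finset.sum_congr rfl fun m hm => ?_
  unfold complexPoly
  refine Finset.sum_congr ?_ fun _ _ => rfl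
  ext i
  have := Finset.mem_range.1 hm
  simp only [Finset.mem_filter, Finset.mem_product, Finset.mem_range]
  omega

theorem AnalyticGraph.IsNormalized.WO_point_sub {N : AnalyticGraph} (hN : N.IsNormalized) :
    WO 6 fun q => N.point q - quadricPoint q := by
  have h1 : WO 6 fun q : ℂ × ℝ => N.F q - ‖q.1‖ ^ 2 := by
    refine IsBigO.trans hN ?_
    have h2 : WO 6 fun q : ℂ × ℝ => ‖q.1‖ ^ 6 := by
      have := (WO_fst.pow 6).norm_left
      simp only [norm_pow] at this
      exact this
    have h3 : WO 6 fun q : ℂ × ℝ => |q.2| ^ 3 := by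
      have := (WO_snd.pow 3).norm_left
      simp only [norm_pow, Real.norm_eq_abs] at this
      exact this
    exact h2.add h3
  refine h1.of_norm_le fun q => ?_
  have : N.point q - quadricPoint q = (0, ((N.F q - ‖q.1‖ ^ 2 : ℝ) : ℂ) * Complex.I) := by
    ext1
    · simp [point, quadricPoint]
    · simp only [point, quadricPoint, Complex.mul_conj, Complex.normSq_eq_norm_sq, Prod.snd_sub]
      push_cast
      ring
  rw [this, Prod.norm_def]
  simp only [norm_zero, norm_mul, Complex.norm_real, Complex.norm_I, mul_one]
  exact max_le (norm_nonneg _) le_rfl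

/-- A holomorphic function is locally Lipschitz and `N` agrees with the quadric modulo weight 6, so
its expansion may be evaluated on the quadric. -/
theorem AnalyticGraph.IsNormalized.exists_expansion {N : AnalyticGraph} (hN : N.IsNormalized)
    (h0 : (0 : ℂ × ℝ) ∈ N.Ω) {f : ℂ × ℂ → ℂ} (hf : AnalyticAt ℂ f 0) :
    ∃ a : ℕ × ℕ → ℂ, WO 6 fun q =>
      f (N.point q) - ∑ m ∈ Finset.range 6, complexPoly m a (quadricPoint q) := by
  obtain ⟨a, ha⟩ := exists_complex_taylor hf
  refine ⟨a, ?_⟩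
  have hq1 : WO 1 quadricPoint := by
    have h1 := WO_fst
    have h2 := WO_quadricPoint_snd.mono (by norm_num : 1 ≤ 2)
    exact IsBigO.prod_left h1 h2
  have ht : Tendsto quadricPoint (𝓝 0) (𝓝 0) := by
    refine IsBigO.trans_tendsto hq1 ?_
    simpa using tendsto_wt
  have ht' : Tendsto N.point (𝓝 0) (𝓝 0) := by
    have := (N.analyticAt_point h0).continuousAt.tendsto
    rwa [hN.point_zero] at this
  have h1 : WO 6 fun q => f (N.point q) - f (quadricPoint q) := by
    have h2 := hf.hasStrictFDerivAt.isBigO_sub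
    have h3 : Tendsto (fun q => (N.point q, quadricPoint q)) (𝓝 0) (𝓝 ((0 : ℂ × ℂ), (0 : ℂ × ℂ))) := by
      exact ht'.prodMk_nhds ht
    exact (IsBigO.comp_tendsto h2 h3).trans hN.WO_point_sub
  have h2 : WO 6 fun q => f (quadricPoint q) - ∑ i ∈ Finset.range 6 ×ˢ Finset.range 6,
      a i * ((quadricPoint q).1 ^ i.1 * (quadricPoint q).2 ^ i.2) := by
    refine (IsBigO.comp_tendsto ha ht).trans ?_
    have := IsBigO.pow (IsBigO.norm_left hq1) 6
    simp only [pow_one] at this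
    exact this
  have h3 : WO 6 fun q => ∑ i ∈ (Finset.range 6 ×ˢ Finset.range 6).filter
      (fun i => ¬ i.1 + 2 * i.2 < 6),
      a i * ((quadricPoint q).1 ^ i.1 * (quadricPoint q).2 ^ i.2) := by
    refine WO.sum fun i hi => WO.const_mul _ ?_
    have h := (WO_fst.pow i.1).mul (WO_quadricPoint_snd.pow i.2)
    rw [one_mul] at h
    exact h.mono (not_lt.1 (Finset.mem_filter.1 hi).2)
  refine ((h1.add h2).add h3).congr fun q => ?_
  rw [sum_complexPoly, ← Finset.sum_filter_add_sum_filter_not (Finset.range 6 ×ˢ Finset.range 6)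
    (fun i => i.1 + 2 * i.2 < 6)]
  ring

/-- The homogeneous parts of the equation `Im g = f f̄ + O(6)`. -/
theorem im_eq_sum_of_isBigO {F G : ℕ → ℂ}
    (h : (fun t : ℝ => (∑ m ∈ Finset.range 6, G m * (t : ℂ) ^ m).im -
      Complex.normSq (∑ m ∈ Finset.range 6, F m * (t : ℂ) ^ m)) =O[𝓝[>] 0] fun t : ℝ => t ^ 6) :
    ∀ m < 6, (G m).im = ∑ i ∈ Finset.range 6, ∑ j ∈ Finset.range 6,
      if i + j = m then (F i * conj (F j)).re else 0 := by
  let c : ℕ → ℝ := fun m => (if m < 6 then (G m).im else 0) - ∑ i ∈ Finset.range 6,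
    ∑ j ∈ Finset.range 6, if i + j = m then (F i * conj (F j)).re else 0
  have key : ∀ t : ℝ, (∑ m ∈ Finset.range 6, G m * (t : ℂ) ^ m).im -
      Complex.normSq (∑ m ∈ Finset.range 6, F m * (t : ℂ) ^ m) =
        ∑ m ∈ Finset.range 11, c m * t ^ m := by
    intro t
    simp only [c, sub_mul, Finset.sum_sub_distrib]
    congr 1
    · simp only [← Complex.ofReal_pow, Complex.im_sum, Complex.im_mul_ofReal, ite_mul, zero_mul]
      rw [← Finset.sum_filter]
      refine Finset.sum_congr (by decide) fun _ _ => rfl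
    · have h1 : ∀ w : ℂ, Complex.normSq w = (w * conj w).re := fun w => by
        rw [Complex.mul_conj, Complex.ofReal_re]
      rw [h1, map_sum, Finset.sum_mul_sum]
      simp only [Complex.re_sum, Finset.sum_mul]
      conv_rhs => rw [Finset.sum_comm]
      refine Finset.sum_congr rfl fun i hi => ?_
      conv_rhs => rw [Finset.sum_comm]
      refine Finset.sum_congr rfl fun j hj => ?_
      simp only [ite_mul, zero_mul]
      rw [Finset.sum_ite_eq, if_pos (by simp only [Finset.mem_range] at *; omega)]
      rw [← Complex.re_mul_ofReal]
      congr 1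
      push_cast
      simp only [map_mul, map_pow, Complex.conj_ofReal]
      ring
  simp only [key] at h
  intro m hm
  have := coeff_eq_zero_of_isBigO h m hm (by omega)
  simp only [c, if_pos hm] at this
  linarith

/-- The relations between the low order coefficients of a map preserving `v = z z̄ + O(6)`. -/
structure JetRelations (f g : ℕ × ℕ → ℂ) : Prop where
  g01_im : (g (0, 1)).im = 0
  g01_re : (g (0, 1)).re = Complex.normSq (f (1, 0))
  g20 : g (2, 0) = 0
  g11 : -Complex.I * g (1, 1) - 2 * f (1, 0) * conj (f (0, 1)) = 0
  f20 : g (1, 1) - 2 * conj (f (1, 0)) * f (2, 0) + 2 * Complex.I * f (1, 0) * conj (f (0, 1)) = 0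
  g02_im : (g (0, 2)).im = Complex.normSq (f (0, 1))
  g21 : -Complex.I * g (2, 1) - 2 * f (2, 0) * conj (f (0, 1)) = 0
  f11_re : 2 * (g (0, 2)).re - 2 * (f (1, 0) * conj (f (1, 1))).re = 0
  f30 : g (2, 1) + 2 * Complex.I * f (2, 0) * conj (f (0, 1)) - 2 * conj (f (1, 0)) * f (3, 0) = 0
  f11_im : -(g (0, 2)).im - Complex.normSq (f (2, 0)) - Complex.normSq (f (0, 1)) -
    2 * (f (1, 0) * conj (f (1, 1))).im = 0
  g12 : -Complex.I * g (1, 2) - 2 * f (1, 0) * conj (f (0, 2)) - 2 * conj (f (0, 1)) * f (1, 1) = 0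
  f21 : 2 * g (1, 2) - 2 * conj (f (1, 0)) * f (2, 1) + 4 * Complex.I * f (1, 0) * conj (f (0, 2)) -
    2 * f (2, 0) * conj (f (1, 1)) = 0
  f02 : Complex.I * g (1, 2) - 2 * Complex.I * conj (f (1, 0)) * f (2, 1) +
    2 * f (1, 0) * conj (f (0, 2)) + 2 * Complex.I * f (2, 0) * conj (f (1, 1)) -
    2 * conj (f (2, 0)) * f (3, 0) - 2 * conj (f (0, 1)) * f (1, 1) = 0

/-- In each weight the powers of `u` are separated by the values `u = 0, ±1`, and then the monomials
in `z`, `z̄` by the vanishing-polynomial lemmas. Only the relations bearing on 2-jets are kept. -/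
theorem jetRelations_of_im_eq {f g : ℕ × ℕ → ℂ} (hf : f (0, 0) = 0)
    (H : ∀ q, ∀ m < 6, (complexPoly m g (quadricPoint q)).im =
      ∑ i ∈ Finset.range 6, ∑ j ∈ Finset.range 6, if i + j = m then
        (complexPoly i f (quadricPoint q) * conj (complexPoly j f (quadricPoint q))).re else 0) :
    JetRelations f g := by
  have h2 := fun q => H q 2 (by norm_num)
  have h3 := fun q => H q 3 (by norm_num)
  have h4 := fun q => H q 4 (by norm_num)
  have h5 := fun q => H q 5 (by norm_num)
  simp [Finset.sum_range_succ, complexPoly_zero, complexPoly_one, complexPoly_two,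
    complexPoly_three, complexPoly_four, complexPoly_five, hf, quadricPoint, pow_succ]
    at h2 h3 h4 h5
  have a0 := h2 0 1
  have a1 := h4 0 1
  simp at a0 a1
  obtain ⟨b1, b2⟩ := coeff_quadratic (a := -Complex.I * g (2, 0))
    (c := (g (0, 1)).re - Complex.normSq (f (1, 0))) (fun z => by
      have := h2 z 0
      simp [pow_succ, Complex.normSq_apply] at this ⊢
      linear_combination this)
  have b3 := coeff_linear (a := -Complex.I * g (1, 1) - 2 * f (1, 0) * conj (f (0, 1))) (fun z => by
      have e1 := h3 z 0
      have e2 := h3 z 1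
      simp at e1 e2 ⊢
      linear_combination e2 - e1)
  obtain ⟨-, b4⟩ := coeff_cubic (a := -Complex.I * g (3, 0))
    (b := g (1, 1) - 2 * conj (f (1, 0)) * f (2, 0) + 2 * Complex.I * f (1, 0) * conj (f (0, 1)))
    (fun z => by
      have e1 := h3 z 0
      simp [pow_succ] at e1 ⊢
      linear_combination e1)
  obtain ⟨b5, b6⟩ := coeff_quadratic (a := -Complex.I * g (2, 1) - 2 * f (2, 0) * conj (f (0, 1)))
    (c := 2 * (g (0, 2)).re - 2 * (f (1, 0) * conj (f (1, 1))).re) (fun z => by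
      have e1 := h4 z (-1)
      have e2 := h4 z 1
      simp [pow_succ, Complex.normSq_apply] at e1 e2 ⊢
      linear_combination (e2 - e1) / 2)
  obtain ⟨b7, b8⟩ := coeff_quartic (a := -Complex.I * g (4, 0))
    (b := g (2, 1) + 2 * Complex.I * f (2, 0) * conj (f (0, 1)) - 2 * conj (f (1, 0)) * f (3, 0))
    (c := -(g (0, 2)).im - Complex.normSq (f (2, 0)) - Complex.normSq (f (0, 1)) -
      2 * (f (1, 0) * conj (f (1, 1))).im) (fun z => by
      have e1 := h4 z 0
      simp [pow_succ, Complex.normSq_apply] at e1 ⊢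
      linear_combination e1)
  -- Second difference in `u`: the coefficient of `u²`. The half-difference of `u = ±1` in the next
  -- step isolates that of `u`.
  have b9 := coeff_linear (a := -Complex.I * g (1, 2) - 2 * f (1, 0) * conj (f (0, 2)) -
      2 * conj (f (0, 1)) * f (1, 1)) (fun z => by
      have e0 := h5 z 0
      have e1 := h5 z (-1)
      have e2 := h5 z 1
      simp at e0 e1 e2 ⊢
      linear_combination (e1 + e2) / 2 - e0)
  obtain ⟨-, b10⟩ := coeff_cubic
    (a := -Complex.I * g (3, 1) - 2 * conj (f (0, 1)) * f (3, 0))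
    (b := 2 * g (1, 2) - 2 * conj (f (1, 0)) * f (2, 1) +
      4 * Complex.I * f (1, 0) * conj (f (0, 2)) - 2 * f (2, 0) * conj (f (1, 1)))
    (fun z => by
      have e1 := h5 z (-1)
      have e2 := h5 z 1
      simp [pow_succ] at e1 e2 ⊢
      linear_combination (e2 - e1) / 2)
  have b11 := coeff_quintic (a := -Complex.I * g (5, 0))
    (b := g (3, 1) - 2 * conj (f (1, 0)) * f (4, 0) + 2 * Complex.I * f (3, 0) * conj (f (0, 1)))
    (c := Complex.I * g (1, 2) - 2 * Complex.I * conj (f (1, 0)) * f (2, 1) +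
      2 * f (1, 0) * conj (f (0, 2)) + 2 * Complex.I * f (2, 0) * conj (f (1, 1)) -
      2 * conj (f (2, 0)) * f (3, 0) - 2 * conj (f (0, 1)) * f (1, 1)) (fun z => by
      have e1 := h5 z 0
      simp [pow_succ] at e1 ⊢
      linear_combination e1)
  exact ⟨a0, by linarith, by simpa using b1, b3, b4, by simpa [Complex.normSq_apply] using a1, b5,
    b6, b7, b8, b9, b10, b11⟩
namespace JetRelations

variable {f g : ℕ × ℕ → ℂ}

/-- The image of the jet `(z, 2 i z z̄ z)` under a map with the given coefficients. -/
theorem jet_identity (h : JetRelations f g) (h0 : f (1, 0) ≠ 0) (z : ℂ) :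
    f (1, 0) * conj (f (1, 0)) * (f (1, 0) * (2 * Complex.I * (z * conj z) * z) +
      2 * (Complex.I * f (0, 1) * (z * conj z) + f (2, 0) * z ^ 2 + f (1, 1) * z + f (0, 2))) -
      ((2 * (g (1, 1) * z + g (0, 2)).re : ℝ) : ℂ) * (f (1, 0) * z + f (0, 1)) =
    2 * Complex.I * ((f (1, 0) * z + f (0, 1)) * conj (f (1, 0) * z + f (0, 1))) *
      (f (1, 0) * z + f (0, 1)) := by
  have hL : conj (f (1, 0)) ≠ 0 := by simpa using h0
  -- With `λ = f(1, 0)`, the relations force the low coefficients of `λ(z + a w)/(1 - 2iāz - (r +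
  -- i|a|²)w)`: `λa` for `w`, `2iλā` for `z²`, `-4λā²` for `z³`, `λ(r + 3i|a|²)` for `zw`, `λa(r +
  -- i|a|²)` for `w²`.
  obtain ⟨a, ha⟩ : ∃ a, f (0, 1) = f (1, 0) * a := ⟨f (0, 1) / f (1, 0), by field_simp⟩
  have hγ : (Complex.normSq (f (1, 0)) : ℂ) = f (1, 0) * conj (f (1, 0)) := (Complex.mul_conj _).symm
  have hγ0 : Complex.normSq (f (1, 0)) ≠ 0 := by simpa using h0
  obtain ⟨r, hr⟩ : ∃ r : ℝ, (g (0, 2)).re = Complex.normSq (f (1, 0)) * r :=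
    ⟨(g (0, 2)).re / Complex.normSq (f (1, 0)), by field_simp⟩
  have e11 : g (1, 1) = 2 * Complex.I * (f (1, 0) * conj (f (1, 0))) * conj a := by
    have := h.g11
    rw [ha, map_mul] at this
    linear_combination Complex.I * this + g (1, 1) * Complex.I_sq
  have e20 : f (2, 0) = 2 * Complex.I * f (1, 0) * conj a := by
    apply mul_left_cancel₀ hL
    have := h.f20
    rw [ha, map_mul, e11] at this
    linear_combination -this / 2
  have e21 : g (2, 1) = 2 * Complex.I * f (2, 0) * conj (f (0, 1)) := by
    linear_combination Complex.I * h.g21 + g (2, 1) * Complex.I_sq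
  have e30 : f (3, 0) = -4 * f (1, 0) * conj a ^ 2 := by
    apply mul_left_cancel₀ hL
    have := h.f30
    rw [e21, ha, map_mul, e20] at this
    linear_combination -this / 2 + 4 * f (1, 0) * conj (f (1, 0)) * conj a ^ 2 * Complex.I_sq
  have e11' : f (1, 1) = f (1, 0) * (r + 3 * Complex.I * (a * conj a)) := by
    have h1 : f (1, 0) * conj (f (1, 1)) =
        f (1, 0) * conj (f (1, 0)) * (r - 3 * Complex.I * (a * conj a)) := by
      have h2 := h.f11_re
      have h3 := h.f11_im
      rw [h.g02_im, ha, e20, Complex.normSq_mul, Complex.normSq_mul, Complex.normSq_mul,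
        Complex.normSq_mul] at h3
      simp only [Complex.normSq_I, Complex.normSq_conj, Complex.normSq_ofNat] at h3
      rw [hr] at h2
      rw [Complex.mul_conj (f (1, 0)), Complex.mul_conj a]
      apply Complex.ext
      · rw [Complex.re_ofReal_mul]
        simp only [Complex.sub_re, Complex.ofReal_re, Complex.ofReal_im, Complex.mul_re, Complex.mul_im,
          Complex.I_re, Complex.I_im, Complex.re_ofNat, Complex.im_ofNat] at h2 ⊢
        linarith
      · rw [Complex.im_ofReal_mul]
        simp only [Complex.sub_im, Complex.ofReal_re, Complex.ofReal_im, Complex.mul_re, Complex.mul_im,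
          Complex.I_re, Complex.I_im, Complex.re_ofNat, Complex.im_ofNat] at h3 ⊢
        linarith
    have h2 := congrArg conj h1
    simp only [map_mul, map_sub, Complex.conj_conj, Complex.conj_ofReal, Complex.conj_I,
      Complex.conj_ofNat] at h2
    apply mul_left_cancel₀ hL
    linear_combination h2
  have e02 : f (0, 2) = f (1, 0) * a * (r + Complex.I * (a * conj a)) := by
    -- This combination of the weight 5 relations eliminates the irrelevant coefficients `g(1, 2)`
    -- and `f(2, 1)`.
    have h1 : 8 * f (1, 0) * conj (f (0, 2)) + 4 * Complex.I * f (2, 0) * conj (f (1, 1)) -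
        2 * conj (f (2, 0)) * f (3, 0) = 0 := by
      linear_combination h.f02 - Complex.I * h.f21 - h.g12 +
        4 * f (1, 0) * conj (f (0, 2)) * Complex.I_sq
    have h2 := congrArg conj h1
    rw [e20, e30, e11'] at h2
    simp only [map_mul, map_sub, map_add, Complex.conj_conj, Complex.conj_ofReal, Complex.conj_I,
      Complex.conj_ofNat, map_pow, map_neg, map_zero] at h2
    apply mul_left_cancel₀ hL
    linear_combination h2 / 8 - conj (f (1, 0)) * f (1, 0) * a *
      (r + 3 * Complex.I * (a * conj a)) * Complex.I_sq
  have eY : ((2 * (g (1, 1) * z + g (0, 2)).re : ℝ) : ℂ) = 2 * (f (1, 0) * conj (f (1, 0))) *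
      (Complex.I * conj a * z - Complex.I * a * conj z + r) := by
    rw [Complex.add_re, hr, mul_add]
    push_cast
    rw [hγ]
    have : (2 : ℂ) * ((g (1, 1) * z).re : ℂ) = g (1, 1) * z + conj (g (1, 1) * z) := by
      rw [Complex.add_conj]
      push_cast
      ring
    rw [this, e11]
    simp only [map_mul, Complex.conj_conj, Complex.conj_I, Complex.conj_ofNat]
    ring
  rw [eY, e20, e11', e02, ha]
  simp only [map_mul, map_add]
  ring

end JetRelations

/-! ### The 2-jets of a map between normalized hypersurfaces -/

namespace AnalyticGraph

/-- A bootstrap on the weight of the second component `g`: from `g = O(1)` one gets `Im g = |f|² +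
O(3)`, hence `g(1, 0) = 0` and `g = O(2)`, which improves the equation to `Im g = |f|² + O(6)`. -/
theorem IsLocalBiholomorphism.exists_jetRelations {e : OpenPartialHomeomorph (ℂ × ℂ) (ℂ × ℂ)}
    {N N' : AnalyticGraph} (h : IsLocalBiholomorphism e N 0 N' 0) (hN : N.IsNormalized)
    (hN' : N'.IsNormalized) : ∃ f g : ℕ × ℕ → ℂ, JetRelations f g ∧ g (1, 0) = 0 ∧
      (WO 6 fun q => (e (N.point q)).1 - ∑ m ∈ Finset.range 6, complexPoly m f (quadricPoint q)) ∧
      WO 6 fun q => (e (N.point q)).2 - ∑ m ∈ Finset.range 6, complexPoly m g (quadricPoint q) := by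
  have ha := h.analyticAt
  rw [hN.point_zero] at ha
  obtain ⟨f, hf⟩ := hN.exists_expansion h.mem (f := fun P => (e P).1)
    ((ContinuousLinearMap.fst ℂ ℂ ℂ).analyticAt _ |>.fun_comp ha)
  obtain ⟨g, hg⟩ := hN.exists_expansion h.mem (f := fun P => (e P).2)
    ((ContinuousLinearMap.snd ℂ ℂ ℂ).analyticAt _ |>.fun_comp ha)
  have he0 : e (N.point 0) = 0 := by rw [h.map_point, hN'.point_zero]
  have zero : ∀ {φ : ℂ × ℝ → ℂ} {c : ℕ × ℕ → ℂ}, φ 0 = 0 →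
      (WO 6 fun q => φ q - ∑ m ∈ Finset.range 6, complexPoly m c (quadricPoint q)) →
      c (0, 0) = 0 := by
    intro φ c h0 hc
    have := hc.eq_zero (by norm_num)
    simpa [h0, Finset.sum_range_succ, complexPoly_zero, complexPoly_one, complexPoly_two,
      complexPoly_three, complexPoly_four, complexPoly_five, quadricPoint] using this
  have hf0 := zero (by simp [he0]) hf
  have hg0 := zero (by simp [he0]) hg
  have low : ∀ {φ : ℂ × ℝ → ℂ} {c : ℕ × ℕ → ℂ} {k : ℕ}, k ≤ 6 →
      (∀ m < k, ∀ P, complexPoly m c P = 0) →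
      (WO 6 fun q => φ q - ∑ m ∈ Finset.range 6, complexPoly m c (quadricPoint q)) → WO k φ := by
    intro φ c k hk hm hc
    have h1 : WO k fun q => ∑ m ∈ Finset.range 6, complexPoly m c (quadricPoint q) := by
      refine WO.sum fun m _ => ?_
      rcases lt_or_ge m k with hmk | hmk
      · simp only [hm m hmk]
        exact WO.zero
      · exact (WO_complexPoly_quadricPoint m c).mono hmk
    exact ((hc.mono hk).add h1).congr fun q => by ring
  have hf1 : WO 1 fun q => (e (N.point q)).1 := low (k := 1) (by norm_num) (by
    intro m hm P
    obtain rfl : m = 0 := by omega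
    rw [complexPoly_zero, hf0]) hf
  have hg1 : WO 1 fun q => (e (N.point q)).2 := low (k := 1) (by norm_num) (by
    intro m hm P
    obtain rfl : m = 0 := by omega
    rw [complexPoly_zero, hg0]) hg
  have ht : Tendsto (fun q => base (e (N.point q))) (𝓝 0) (𝓝 0) := by
    have h1 := (base.continuous.continuousAt.comp h.analyticAt_comp_point.continuousAt).tendsto
    simpa only [Function.comp_def, he0, map_zero] using h1
  -- The remainder of the target contains `|Re g|³`, which has weight `3k` when `g = O(k)`; the
  -- other term has weight 6.
  have him : ∀ {k : ℕ}, (WO k fun q => (e (N.point q)).2) → WO (min 6 (k * 3)) fun q =>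
      (e (N.point q)).2.im - Complex.normSq (e (N.point q)).1 := by
    intro k hk
    have h1 := IsBigO.comp_tendsto hN' ht
    have h2 : WO (min 6 (k * 3)) fun q => ‖(e (N.point q)).1‖ ^ 6 := by
      have := (hf1.pow 6).mono (min_le_left 6 (k * 3))
      simpa only [WO, norm_pow] using this.norm_left
    have h3 : WO (min 6 (k * 3)) fun q => |(e (N.point q)).2.re| ^ 3 := by
      have := (hk.re.pow 3).mono (min_le_right 6 (k * 3))
      simpa only [WO, norm_pow, Real.norm_eq_abs] using this.norm_left
    refine IsBigO.congr' (h1.trans (h2.add h3)) ?_ EventuallyEq.rfl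
    filter_upwards [h.eventually_mem] with q hq
    simp only [Function.comp_apply, base_apply, Complex.normSq_eq_norm_sq]
    rw [hq.2]
  have hg10 : g (1, 0) = 0 := by
    have h1 : WO 2 fun q => (e (N.point q)).2.im := by
      have h2 : WO 2 fun q => Complex.normSq (e (N.point q)).1 := by
        have := hf1.norm_left.pow 2
        simpa only [WO, Complex.normSq_eq_norm_sq, pow_one] using this
      exact (((him hg1).mono (by norm_num : 2 ≤ min 6 (1 * 3))).add h2).congr fun q => by ring
    have h2 : WO 2 fun q => (∑ m ∈ Finset.range 6, complexPoly m g (quadricPoint q)).im :=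
      (h1.sub (hg.im.mono (by norm_num))).congr fun q => by simp
    have h3 : -Complex.I * g (1, 0) = 0 := coeff_linear fun z => by
      obtain ⟨q, hq⟩ : ∃ q : ℂ × ℝ, q.1 = z := ⟨(z, 0), rfl⟩
      have h4 := h2.scale q
      simp only [complexPoly_scale] at h4
      have h5 := coeff_eq_zero_of_isBigO (n := 6) (k := 2)
        (c := fun m => (complexPoly m g (quadricPoint q)).im) (h4.congr_left fun t => by
          simp only [Complex.im_sum, ← Complex.ofReal_pow, Complex.im_mul_ofReal]) 1 (by norm_num)
          (by norm_num)
      simpa [complexPoly_one, quadricPoint, hq] using h5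
    simpa using h3
  have hg2 : WO 2 fun q => (e (N.point q)).2 := low (k := 2) (by norm_num) (by
    intro m hm P
    obtain rfl | rfl : m = 0 ∨ m = 1 := by omega
    · rw [complexPoly_zero, hg0]
    · rw [complexPoly_one, hg10, zero_mul]) hg
  refine ⟨f, g, jetRelations_of_im_eq hf0 fun q => im_eq_sum_of_isBigO ?_, hg10, hf, hg⟩
  have h1 : WO 6 fun q => (e (N.point q)).2.im - Complex.normSq (e (N.point q)).1 := him hg2
  have h2 : WO 6 fun q => Complex.normSq (e (N.point q)).1 -
      Complex.normSq (∑ m ∈ Finset.range 6, complexPoly m f (quadricPoint q)) := by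
    have h3 : WO 0 fun q => ∑ m ∈ Finset.range 6, complexPoly m f (quadricPoint q) :=
      WO.sum fun m _ => (WO_complexPoly_quadricPoint m f).mono (Nat.zero_le _)
    have h4 := (hf.mul (hf1.mono (Nat.zero_le 1)).conj).add (h3.mul hf.conj)
    refine h4.re.congr fun q => ?_
    simp only [map_sub, Complex.normSq_apply, Complex.add_re, Complex.mul_re, Complex.sub_re,
      Complex.sub_im, Complex.conj_re, Complex.conj_im]
    ring
  have h3 : WO 6 fun q => (∑ m ∈ Finset.range 6, complexPoly m g (quadricPoint q)).im -
      Complex.normSq (∑ m ∈ Finset.range 6, complexPoly m f (quadricPoint q)) :=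
    ((h1.add h2).sub hg.im).congr fun q => by
      simp only [Complex.sub_im]
      ring
  have h4 := h3.scale q
  simp only [complexPoly_scale] at h4
  exact h4

/-- The expansion of a polynomial along a curve with a given 2-jet. -/
theorem exists_expansion_baseCurve (a : ℕ × ℕ → ℂ) (j : ℂ × ℂ) : ∃ r : ℝ → ℂ, Continuous r ∧
    ∀ t : ℝ, ∑ m ∈ Finset.range 6, complexPoly m a (quadricPoint (baseCurve 0 j t)) =
      a (0, 0) + (a (1, 0) * j.1 + a (0, 1)) * t +
      (a (1, 0) * j.2 / 2 + Complex.I * a (0, 1) * (j.1 * conj j.1) + a (2, 0) * j.1 ^ 2 +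
        a (1, 1) * j.1 + a (0, 2)) * t ^ 2 + t ^ 3 * r t := by
  -- Along the curve `z = t s(t)` and, on the quadric, `w = t v(t)`.
  let s : ℝ → ℂ := fun t => j.1 + j.2 * t / 2
  let S : ℝ → ℂ := fun t => s t * conj (s t)
  let v : ℝ → ℂ := fun t => 1 + Complex.I * t * S t
  have hs : Continuous s := by fun_prop
  have hS : Continuous S := hs.mul (Complex.continuous_conj.comp hs)
  have hv : Continuous v := by fun_prop
  refine ⟨fun t => a (3, 0) * s t ^ 3 + a (4, 0) * t * s t ^ 4 + a (5, 0) * t ^ 2 * s t ^ 5 +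
    a (2, 1) * s t ^ 2 * v t + a (3, 1) * t * s t ^ 3 * v t + a (1, 2) * s t * v t ^ 2 +
    a (2, 0) * (j.1 * j.2 + t * j.2 ^ 2 / 4) +
    a (0, 1) * Complex.I * ((j.1 * conj j.2 + conj j.1 * j.2) / 2 + t * (j.2 * conj j.2) / 4) +
    a (1, 1) * (j.2 / 2 + Complex.I * s t * S t) +
    a (0, 2) * (2 * Complex.I * S t + Complex.I ^ 2 * t * S t ^ 2), by fun_prop, fun t => ?_⟩
  simp only [Finset.sum_range_succ, Finset.sum_range_zero, complexPoly_zero, complexPoly_one,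
    complexPoly_two, complexPoly_three, complexPoly_four, complexPoly_five, quadricPoint, baseCurve,
    Prod.fst_zero, Prod.snd_zero, sub_zero, v, S, s, map_add, map_mul, map_div₀, map_pow, map_zero,
    Complex.conj_ofReal, Complex.conj_ofNat]
  ring

/-- On a curve with `u = t`, `z = O(t)`, the weighted size is `O(√t)`, so weight 6 becomes order 3:
remainders `O(6)` are invisible to 2-jets. -/
theorem isBigO_baseCurve {E : Type*} [SeminormedAddCommGroup E] {f : ℂ × ℝ → E} (hf : WO 6 f)
    (j : ℂ × ℂ) : (fun t => f (baseCurve 0 j t)) =O[𝓝[>] 0] fun t : ℝ => t ^ 3 := by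
  have hc : Tendsto (baseCurve 0 j) (𝓝[>] 0) (𝓝 0) := by
    have := (hasDerivAt_baseCurve 0 j 0).continuousAt.tendsto
    have h0 : baseCurve 0 j 0 = 0 := baseCurve_self 0 j
    rw [h0] at this
    exact this.mono_left nhdsWithin_le_nhds
  refine (IsBigO.comp_tendsto hf hc).trans (IsBigO.of_bound ((‖j.1‖ + ‖j.2‖ + 1) ^ 6) ?_)
  filter_upwards [Ioc_mem_nhdsGT one_pos] with t ht
  have h1 : t ≤ √t := Real.le_sqrt_of_sq_le (by nlinarith [ht.1, ht.2])
  have h2 : wt (baseCurve 0 j t) ≤ (‖j.1‖ + ‖j.2‖ + 1) * √t := by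
    have h3 : ‖(baseCurve 0 j t).1‖ ≤ (‖j.1‖ + ‖j.2‖) * √t := by
      have h4 : (baseCurve 0 j t).1 = j.1 * t + j.2 * (t * (t / 2)) := by
        simp [baseCurve]
        ring
      rw [h4]
      refine (norm_add_le _ _).trans ?_
      simp only [norm_mul, norm_div, Complex.norm_real, Real.norm_of_nonneg ht.1.le]
      have h5 : t * (t / ‖(2 : ℂ)‖) ≤ √t := by
        have : ‖(2 : ℂ)‖ = 2 := by simp
        rw [this]
        nlinarith [ht.1, ht.2]
      nlinarith [norm_nonneg j.1, norm_nonneg j.2]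
    have h4 : |(baseCurve 0 j t).2| = t := abs_of_pos ht.1
    unfold wt
    rw [h4]
    linarith
  have h3 := wt_nonneg (baseCurve 0 j t)
  rw [Function.comp_apply, Real.norm_of_nonneg (by positivity),
    Real.norm_of_nonneg (pow_nonneg ht.1.le 3)]
  calc wt (baseCurve 0 j t) ^ 6 ≤ ((‖j.1‖ + ‖j.2‖ + 1) * √t) ^ 6 := by gcongr
    _ = (‖j.1‖ + ‖j.2‖ + 1) ^ 6 * (√t ^ 2) ^ 3 := by ring
    _ = _ := by rw [Real.sq_sqrt ht.1.le]

theorem isBigO_sub_firstOrder_secondOrder {Ψ : ℂ × ℝ → ℂ × ℂ} (hΨ : AnalyticAt ℝ Ψ 0)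
    (h0 : Ψ 0 = 0) (j : ℂ × ℂ) :
    (fun t => Ψ (baseCurve 0 j t) - t • firstOrder Ψ 0 j.1 - (t ^ 2 / 2) • secondOrder Ψ 0 j)
      =O[𝓝[>] 0] fun t : ℝ => t ^ 3 := by
  have hc : Tendsto (baseCurve 0 j) (𝓝[>] 0) (𝓝 0) := by
    have := (hasDerivAt_baseCurve 0 j 0).continuousAt.tendsto
    have h0 : baseCurve 0 j 0 = 0 := baseCurve_self 0 j
    rw [h0] at this
    exact this.mono_left nhdsWithin_le_nhds
  have hb : ∀ t : ℝ, baseCurve 0 j t = t • (j.1, (1 : ℝ)) + (t ^ 2 / 2) • (j.2, (0 : ℝ)) := by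
    intro t
    ext1
    · simp [baseCurve]
      ring
    · simp [baseCurve]
  have h1 := IsBigO.comp_tendsto hΨ.isBigO_taylor_two hc
  have h2 : (baseCurve 0 j) =O[𝓝[>] 0] fun t : ℝ => t := by
    have := (hasDerivAt_baseCurve 0 j 0).isBigO_sub
    have h0 : baseCurve 0 j 0 = 0 := baseCurve_self 0 j
    simp only [h0, sub_zero] at this
    exact this.mono nhdsWithin_le_nhds
  have h3 := h1.trans (h2.norm_left.pow 3)
  let r : ℝ → ℂ × ℂ := fun t => (1 / 4 : ℝ) • (fderiv ℝ (fderiv ℝ Ψ) 0 (j.1, 1) (j.2, 0) +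
    fderiv ℝ (fderiv ℝ Ψ) 0 (j.2, 0) (j.1, 1)) +
      (t / 8) • fderiv ℝ (fderiv ℝ Ψ) 0 (j.2, 0) (j.2, 0)
  have hr : Continuous r := by fun_prop
  have h4 : (fun t => t ^ 3 • r t) =O[𝓝[>] 0] fun t : ℝ => t ^ 3 := by
    have h5 : r =O[𝓝[>] 0] fun _ : ℝ => (1 : ℝ) :=
      ((hr.tendsto 0).mono_left nhdsWithin_le_nhds).isBigO_one ℝ
    simpa only [smul_eq_mul, mul_one] using (isBigO_refl (fun t : ℝ => t ^ 3) (𝓝[>] 0)).smul h5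
  refine (h3.add h4).congr_left fun t => ?_
  simp only [Function.comp_apply, zero_add, h0, hb t, map_add, map_smul, add_apply, smul_apply,
    firstOrder, secondOrder, r]
  module

theorem eq_of_isBigO_quadratic {c : ℝ → ℂ} {X Y X' Y' : ℂ}
    (h : (fun t : ℝ => c t - X * t - Y / 2 * t ^ 2) =O[𝓝[>] 0] fun t : ℝ => t ^ 3)
    (h' : (fun t : ℝ => c t - X' * t - Y' * t ^ 2) =O[𝓝[>] 0] fun t : ℝ => t ^ 3) :
    X = X' ∧ Y = 2 * Y' := by
  have key : ∀ L : ℂ →L[ℝ] ℝ, L (X' - X) = 0 ∧ L (Y' - Y / 2) = 0 := by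
    intro L
    have h1 := (L.isBigO_comp _ (𝓝[>] 0)).trans (h.sub h')
    have h2 := coeff_eq_zero_of_isBigO (n := 3) (k := 3)
      (c := fun m => if m = 1 then L (X' - X) else if m = 2 then L (Y' - Y / 2) else 0)
      (h1.congr_left fun t => by
        have : c t - X * t - Y / 2 * t ^ 2 - (c t - X' * t - Y' * t ^ 2) =
            t • (X' - X) + (t ^ 2) • (Y' - Y / 2) := by
          simp only [Complex.real_smul]
          push_cast
          ring
        rw [this, map_add, map_smul, map_smul]
        simp [Finset.sum_range_succ]
        ring)
    exact ⟨by simpa using h2 1 (by norm_num) (by norm_num), by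
      simpa using h2 2 (by norm_num) (by norm_num)⟩
  have e1 : X' - X = 0 := Complex.ext (key Complex.reCLM).1 (key Complex.imCLM).1
  have e2 : Y' - Y / 2 = 0 := Complex.ext (key Complex.reCLM).2 (key Complex.imCLM).2
  exact ⟨(sub_eq_zero.1 e1).symm, by linear_combination -2 * e2⟩

/-- The complex form of `Σ₀`: `2i|z₁|²z₁` is the acceleration at `0` of the curve cut out of the
quadric by the complex line `z = z₁ w`. -/
theorem mem_sigmaZero_iff (j : ℂ × ℂ) :
    j ∈ sigmaZero ↔ j.2 = 2 * Complex.I * (j.1 * conj j.1) * j.1 := by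
  rw [Complex.ext_iff]
  simp [sigmaZero]
  constructor
  · rintro ⟨h1, h2⟩
    constructor <;> linarith
  · rintro ⟨h1, h2⟩
    constructor <;> linarith

/-- The first two derivatives of the image curve are read off by comparing its Taylor expansion with
the weighted expansion of the map; the claim then reduces to `jet_identity` divided by a power of
`Re X₂ = |f(1, 0)|²`. -/
theorem IsLocalBiholomorphism.prolong_mem_sigmaZero {e : OpenPartialHomeomorph (ℂ × ℂ) (ℂ × ℂ)}
    {N N' : AnalyticGraph} (h : IsLocalBiholomorphism e N 0 N' 0) (hN : N.IsNormalized)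
    (hN' : N'.IsNormalized) {j : ℂ × ℂ} (hj : N.CRTransversal 0 j.1) (hjs : j ∈ sigmaZero) :
    N.prolong e 0 j ∈ sigmaZero := by
  obtain ⟨f, g, hfg, hg10, hf, hg⟩ := h.exists_jetRelations hN hN'
  have hX0 : (firstOrder (e ∘ N.point) 0 j.1).2.re ≠ 0 := by
    rw [h.firstOrder_eq]
    exact h.imageParamByU hN' hj
  rw [N.prolong_eq j h.analyticAt_comp_point.contDiffAt hX0, mem_sigmaZero_iff]
  have he0 : e (N.point 0) = 0 := by rw [h.map_point, hN'.point_zero]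
  have hT := isBigO_sub_firstOrder_secondOrder h.analyticAt_comp_point he0 j
  set X := firstOrder (e ∘ N.point) 0 j.1
  set Y := secondOrder (e ∘ N.point) 0 j
  have coeffs : ∀ {φ : ℂ × ℝ → ℂ} {a : ℕ × ℕ → ℂ}, φ 0 = 0 →
      (WO 6 fun q => φ q - ∑ m ∈ Finset.range 6, complexPoly m a (quadricPoint q)) →
      (fun t : ℝ => φ (baseCurve 0 j t) - (a (1, 0) * j.1 + a (0, 1)) * t -
      (a (1, 0) * j.2 / 2 + Complex.I * a (0, 1) * (j.1 * conj j.1) + a (2, 0) * j.1 ^ 2 +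
        a (1, 1) * j.1 + a (0, 2)) * t ^ 2) =O[𝓝[>] 0] fun t : ℝ => t ^ 3 := by
    intro φ a h0 ha
    obtain ⟨r, hr, hr'⟩ := exists_expansion_baseCurve a j
    have ha0 : a (0, 0) = 0 := by
      have := ha.eq_zero (by norm_num)
      simpa [h0, Finset.sum_range_succ, complexPoly_zero, complexPoly_one, complexPoly_two,
        complexPoly_three, complexPoly_four, complexPoly_five, quadricPoint] using this
    have h1 := isBigO_baseCurve ha j
    have h4 : (fun t : ℝ => (t : ℂ) ^ 3 * r t) =O[𝓝[>] 0] fun t : ℝ => t ^ 3 := by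
      have h5 : r =O[𝓝[>] 0] fun _ : ℝ => (1 : ℝ) :=
        ((hr.tendsto 0).mono_left nhdsWithin_le_nhds).isBigO_one ℝ
      have h6 : (fun t : ℝ => (t : ℂ) ^ 3) =O[𝓝[>] 0] fun t : ℝ => t ^ 3 :=
        IsBigO.of_bound 1 (Eventually.of_forall fun t => by simp)
      simpa using h6.mul h5
    refine (h1.add h4).congr_left fun t => ?_
    rw [hr', ha0]
    ring
  obtain ⟨eX1, eY1⟩ := eq_of_isBigO_quadratic (c := fun t => (e (N.point (baseCurve 0 j t))).1)
    (X := X.1) (Y := Y.1) (hT.prod_left_fst.congr_left fun t => by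
      simp [Complex.real_smul]; ring) (coeffs (by simp [he0]) hf)
  obtain ⟨eX2, eY2⟩ := eq_of_isBigO_quadratic (c := fun t => (e (N.point (baseCurve 0 j t))).2)
    (X := X.2) (Y := Y.2) (hT.prod_left_snd.congr_left fun t => by
      simp [Complex.real_smul]; ring) (coeffs (by simp [he0]) hg)
  have hX2 : X.2.re = Complex.normSq (f (1, 0)) := by
    rw [eX2, hg10, zero_mul, zero_add, hfg.g01_re]
  have hf10 : f (1, 0) ≠ 0 := by
    intro h1
    rw [hX2, h1, map_zero] at hX0
    exact hX0 rfl
  have hY2 : Y.2.re = 2 * (g (1, 1) * j.1 + g (0, 2)).re := by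
    rw [eY2, hg10, hfg.g20, Complex.mul_conj]
    have := hfg.g01_im
    simp [this]
  have key := hfg.jet_identity hf10 j.1
  rw [← (mem_sigmaZero_iff j).1 hjs, ← hY2, ← eX1] at key
  have eY1' : f (1, 0) * j.2 + 2 * (Complex.I * f (0, 1) * (j.1 * conj j.1) + f (2, 0) * j.1 ^ 2 +
      f (1, 1) * j.1 + f (0, 2)) = Y.1 := by
    rw [eY1]
    ring
  rw [eY1', Complex.mul_conj, ← hX2] at key
  have hX0' : (X.2.re : ℂ) ≠ 0 := by exact_mod_cast hX0
  simp only [jetOf, map_div₀, Complex.conj_ofReal]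
  rw [key]
  field_simp

end AnalyticGraph

/-! ### Independence of the normalizing map -/

namespace AnalyticGraph

theorem prolong_congr {M : AnalyticGraph} {h h' : ℂ × ℂ → ℂ × ℂ} {p : ℂ × ℝ} (hp : p ∈ M.Ω)
    (heq : h =ᶠ[𝓝 (M.point p)] h') (j : ℂ × ℂ) : M.prolong h p j = M.prolong h' p j := by
  have h1 : h ∘ M.jetCurve p j =ᶠ[𝓝 p.2] h' ∘ M.jetCurve p j := by
    have h2 : Tendsto (M.jetCurve p j) (𝓝 p.2) (𝓝 (M.point p)) := by
      have h3 : Tendsto (baseCurve p j) (𝓝 p.2) (𝓝 p) := by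
        have := (hasDerivAt_baseCurve p j p.2).continuousAt.tendsto
        rwa [baseCurve_self] at this
      exact (M.analyticAt_point hp).continuousAt.tendsto.comp h3
    exact h2.eventually heq
  have hU : (fun s => ((h ∘ M.jetCurve p j) s).2.re) =ᶠ[𝓝 p.2]
      fun s => ((h' ∘ M.jetCurve p j) s).2.re := h1.mono fun s hs => by simp only [hs]
  have hZ : (fun s => ((h ∘ M.jetCurve p j) s).1) =ᶠ[𝓝 p.2]
      fun s => ((h' ∘ M.jetCurve p j) s).1 := h1.mono fun s hs => by simp only [hs]
  have hD : derivWrt (fun s => ((h ∘ M.jetCurve p j) s).2.re)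
      (fun s => ((h ∘ M.jetCurve p j) s).1) =ᶠ[𝓝 p.2]
      derivWrt (fun s => ((h' ∘ M.jetCurve p j) s).2.re)
        (fun s => ((h' ∘ M.jetCurve p j) s).1) := by
    filter_upwards [hU.deriv, hZ.deriv] with s h2 h3
    rw [derivWrt, derivWrt, h2, h3]
  unfold prolong curveJet
  ext1
  · exact hD.self_of_nhds
  · change derivWrt _ _ _ = derivWrt _ _ _
    rw [derivWrt, derivWrt, hU.deriv_eq, hD.deriv_eq]

theorem IsLocalBiholomorphism.prolong_trans {e e' : OpenPartialHomeomorph (ℂ × ℂ) (ℂ × ℂ)}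
    {M M' M'' : AnalyticGraph} {p p' p'' : ℂ × ℝ} (h : IsLocalBiholomorphism e M p M' p')
    (h' : IsLocalBiholomorphism e' M' p' M'' p'') (j : ℂ × ℂ) (h0 : M.ImageParamByU e p j.1)
    (h1 : M.ImageParamByU (e.trans e') p j.1) :
    M.prolong (e.trans e') p j = M'.prolong e' p' (M.prolong e p j) := by
  refine prolong_comp j h.analyticAt_comp_point.contDiffAt h'.analyticAt_comp_point.contDiffAt
    h.map_point h.eventually_mem ?_ ?_
  · rw [h.firstOrder_eq]
    exact h0
  · change (firstOrder (e.trans e' ∘ M.point) p j.1).2.re ≠ 0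
    rw [(h.trans h').firstOrder_eq]
    exact h1

/-- Near the point `φ'` is `φ` followed by the transition map, which relates two normalized
hypersurfaces and so preserves `Σ₀`. -/
theorem sigma_subset {M : AnalyticGraph} {p : ℂ × ℝ}
    {φ φ' : OpenPartialHomeomorph (ℂ × ℂ) (ℂ × ℂ)} (h : M.IsNormalizing p φ)
    (h' : M.IsNormalizing p φ') : M.sigma p φ ⊆ M.sigma p φ' := by
  obtain ⟨N, hN, hφ⟩ := h
  obtain ⟨N', hN', hφ'⟩ := h'
  rintro ⟨z₁, z₂⟩ ⟨hj, hjs⟩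
  refine ⟨hj, ?_⟩
  have hc := hφ.symm.trans hφ'
  have h1 : φ.trans (φ.symm.trans φ') =ᶠ[𝓝 (M.point p)] φ' := by
    filter_upwards [φ.open_source.mem_nhds hφ.mem_source] with x hx
    simp only [OpenPartialHomeomorph.coe_trans, Function.comp_apply, φ.left_inv hx]
  rw [← prolong_congr hφ.mem h1, hφ.prolong_trans hc _ (hφ.imageParamByU hN hj)
    ((hφ.trans hc).imageParamByU hN' hj)]
  exact hc.prolong_mem_sigmaZero hN hN' (hφ.CRTransversal_map hj (hφ.imageParamByU hN hj) z₂) hjs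

theorem sigma_eq {M : AnalyticGraph} {p : ℂ × ℝ}
    {φ φ' : OpenPartialHomeomorph (ℂ × ℂ) (ℂ × ℂ)} (h : M.IsNormalizing p φ)
    (h' : M.IsNormalizing p φ') : M.sigma p φ = M.sigma p φ' :=
  (sigma_subset h h').antisymm (sigma_subset h' h)

/-! ### The surface as a graph -/

/-- The numerator of the second component of `jetOf X Y`. -/
noncomputable def jetNumerator (X Y : ℂ × ℂ) : ℂ := (X.2.re : ℂ) * Y.1 - (Y.2.re : ℂ) * X.1

theorem jetNumerator_add (X Y Y' : ℂ × ℂ) :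
    jetNumerator X (Y + Y') = jetNumerator X Y + jetNumerator X Y' := by
  simp [jetNumerator]
  ring

theorem jetNumerator_smul (X Y : ℂ × ℂ) (c : ℝ) :
    jetNumerator X (c • Y) = c * jetNumerator X Y := by
  simp [jetNumerator]
  ring

theorem jetOf_mem_sigmaZero_iff {X Y : ℂ × ℂ} (hX : X.2.re ≠ 0) :
    jetOf X Y ∈ sigmaZero ↔ jetNumerator X Y = 2 * Complex.I * (X.1 * conj X.1) * X.1 := by
  have hX' : (X.2.re : ℂ) ≠ 0 := by exact_mod_cast hX
  rw [mem_sigmaZero_iff]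
  simp only [jetOf, map_div₀, Complex.conj_ofReal, jetNumerator]
  constructor
  · intro h
    field_simp at h
    linear_combination h
  · intro h
    rw [h]
    field_simp

/-- The determinant of the real-linear map of `ℂ` sending `1` to `α` and `i` to `β`. -/
def pairDet (α β : ℂ) : ℝ := α.re * β.im - α.im * β.re

/-- The solution `(x, y)` of `x α + y β = w`, given by Cramer's rule. -/
noncomputable def cramerSol (α β w : ℂ) : ℂ :=
  ((pairDet w β / pairDet α β : ℝ) : ℂ) + ((pairDet α w / pairDet α β : ℝ) : ℂ) * Complex.I

theorem eq_cramerSol_iff {α β w z : ℂ} (h : pairDet α β ≠ 0) :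
    (z.re : ℂ) * α + (z.im : ℂ) * β = w ↔ z = cramerSol α β w := by
  constructor
  · rintro rfl
    apply Complex.ext
    · simp only [cramerSol, Complex.add_re, Complex.ofReal_re, Complex.re_ofReal_mul, Complex.I_re,
        mul_zero, add_zero]
      rw [eq_div_iff h]
      simp [pairDet]
      ring
    · simp only [cramerSol, Complex.add_im, Complex.ofReal_im, Complex.im_ofReal_mul, Complex.I_im,
        mul_one, zero_add]
      rw [eq_div_iff h]
      simp [pairDet]
      ring
  · rintro rfl
    apply Complex.ext
    · simp only [cramerSol, Complex.add_re, Complex.ofReal_re, Complex.re_ofReal_mul, Complex.I_re,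
        mul_zero, add_zero, Complex.add_im, Complex.ofReal_im, Complex.im_ofReal_mul, Complex.I_im,
        mul_one, zero_add]
      field_simp
      simp [pairDet]
      ring
    · simp only [cramerSol, Complex.add_re, Complex.ofReal_re, Complex.re_ofReal_mul, Complex.I_re,
        mul_zero, add_zero, Complex.add_im, Complex.ofReal_im, Complex.im_ofReal_mul, Complex.I_im,
        mul_one, zero_add]
      field_simp
      simp [pairDet]
      ring

theorem pairDet_ne_zero {α β : ℂ} (h : ∀ x y : ℝ, (x : ℂ) * α + (y : ℂ) * β = 0 → x = 0 ∧ y = 0) :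
    pairDet α β ≠ 0 := by
  intro h0
  unfold pairDet at h0
  -- If the determinant vanishes, both `(Re β, -Re α)` and `(Im β, -Im α)` lie in the kernel; this
  -- forces `α = 0`, contradicting independence.
  have h1 := h β.re (-α.re) (Complex.ext (by simp; ring) (by simp; linarith))
  have h2 := h β.im (-α.im) (Complex.ext (by simp; linarith) (by simp; ring))
  have h3 := h 1 0 (Complex.ext (by simp; linarith [h1.2]) (by simp; linarith [h2.2]))
  exact one_ne_zero h3.1

/-- The solution `z₂` of `jetOf X (Y + Re z₂ • V + Im z₂ • W) ∈ Σ₀`, where this equation has a unique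
solution. -/
noncomputable def solveJet (X Y V W : ℂ × ℂ) : ℂ :=
  cramerSol (jetNumerator X V) (jetNumerator X W)
    (2 * Complex.I * (X.1 * conj X.1) * X.1 - jetNumerator X Y)

/-- A kernel vector would be a base vector `v` with zero `u`-component whose image is parallel to
`X`. Since `e` is an immersion on `M`, `v` would be parallel to `(z₁, 1)`, hence zero. -/
theorem IsLocalBiholomorphism.pairDet_ne_zero {e : OpenPartialHomeomorph (ℂ × ℂ) (ℂ × ℂ)}
    {M M' : AnalyticGraph} {p p' : ℂ × ℝ} (h : IsLocalBiholomorphism e M p M' p') {z₁ : ℂ}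
    (h0 : M.ImageParamByU e p z₁) :
    pairDet
      (jetNumerator (firstOrder (e ∘ M.point) p z₁) (fderiv ℝ (e ∘ M.point) p (1, 0)))
      (jetNumerator (firstOrder (e ∘ M.point) p z₁) (fderiv ℝ (e ∘ M.point) p (Complex.I, 0)))
      ≠ 0 := by
  have hD : ∀ v, fderiv ℝ (e ∘ M.point) p v = fderiv ℝ e (M.point p) (M.tangentLift p v) := by
    intro v
    rw [(h.hasFDerivAt.comp p (M.analyticAt_point h.mem).differentiableAt.hasFDerivAt).fderiv,
      ← M.fderiv_point h.mem]
    rfl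
  have hinj : ∀ v w, fderiv ℝ (e ∘ M.point) p v = fderiv ℝ (e ∘ M.point) p w → v = w := by
    intro v w hvw
    rw [hD, hD] at hvw
    have h1 := congrArg (fderiv ℝ e.symm (M'.point p')) hvw
    rw [h.fderiv_symm_fderiv, h.fderiv_symm_fderiv] at h1
    rw [← M.base_tangentLift p v, h1, M.base_tangentLift]
  have htan : ∀ v, M'.tangentLift p' (base (fderiv ℝ (e ∘ M.point) p v)) =
      fderiv ℝ (e ∘ M.point) p v := by
    intro v
    rw [← M'.fderiv_rho_eq_zero_iff h.mem', hD]
    apply h.fderiv_rho_map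
    rw [M.fderiv_rho_eq_zero_iff h.mem, base_tangentLift]
  have hX0 : (firstOrder (e ∘ M.point) p z₁).2.re ≠ 0 := by
    rw [h.firstOrder_eq]
    exact h0
  apply AnalyticGraph.pairDet_ne_zero
  intro x y hxy
  rw [← jetNumerator_smul, ← jetNumerator_smul, ← jetNumerator_add, ← map_smul, ← map_smul,
    ← map_add] at hxy
  set v : ℂ × ℝ := x • (1, 0) + y • (Complex.I, 0) with hv
  set X := firstOrder (e ∘ M.point) p z₁ with hX
  set V := fderiv ℝ (e ∘ M.point) p v with hV
  have hX0' : (X.2.re : ℂ) ≠ 0 := by exact_mod_cast hX0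
  have h1 : base V = (V.2.re / X.2.re) • base X := by
    unfold jetNumerator at hxy
    ext1
    · simp only [base_apply, Prod.smul_fst, Complex.real_smul]
      push_cast
      field_simp
      linear_combination hxy
    · simp only [base_apply, Prod.smul_snd, smul_eq_mul]
      field_simp
  have h2 : V = (V.2.re / X.2.re) • X := by
    have h3 : M'.tangentLift p' (base V) = V := htan v
    have h4 : M'.tangentLift p' (base X) = X := htan (z₁, 1)
    rw [h1, tangentLift_smul, h4] at h3
    exact h3.symm
  have h3 : v = (V.2.re / X.2.re) • (z₁, (1 : ℝ)) := by
    apply hinj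
    rw [map_smul]
    exact h2
  have h4 : (0 : ℝ) = V.2.re / X.2.re := by
    have := congrArg Prod.snd h3
    simpa [hv] using this
  rw [← h4, zero_smul] at h3
  have h5 := congrArg Prod.fst h3
  have h6 := congrArg Complex.re h5
  have h7 := congrArg Complex.im h5
  simp [hv] at h6 h7
  exact ⟨h6, h7⟩

/-- The equation of `Σ_p`, solved for `z₂`. -/
theorem mem_sigma_iff_eq_solveJet {M : AnalyticGraph} {p : ℂ × ℝ}
    {φ : OpenPartialHomeomorph (ℂ × ℂ) (ℂ × ℂ)} (h : M.IsNormalizing p φ) {z₁ : ℂ}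
    (hz : M.CRTransversal p z₁) (z₂ : ℂ) : (z₁, z₂) ∈ M.sigma p φ ↔
      z₂ = solveJet (firstOrder (φ ∘ M.point) p z₁) (secondOrder (φ ∘ M.point) p (z₁, 0))
        (fderiv ℝ (φ ∘ M.point) p (1, 0)) (fderiv ℝ (φ ∘ M.point) p (Complex.I, 0)) := by
  obtain ⟨N, hN, hφ⟩ := h
  have h0 := hφ.imageParamByU hN hz
  have hX0 : (firstOrder (φ ∘ M.point) p z₁).2.re ≠ 0 := by
    rw [hφ.firstOrder_eq]
    exact h0
  have h1 : (z₁, z₂) ∈ M.sigma p φ ↔ M.prolong φ p (z₁, z₂) ∈ sigmaZero :=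
    ⟨fun h => h.2, fun h => ⟨hz, h⟩⟩
  rw [h1, M.prolong_eq (z₁, z₂) hφ.analyticAt_comp_point.contDiffAt hX0,
    jetOf_mem_sigmaZero_iff hX0, solveJet, ← eq_cramerSol_iff (hφ.pairDet_ne_zero h0)]
  have h2 : secondOrder (φ ∘ M.point) p (z₁, z₂) = secondOrder (φ ∘ M.point) p (z₁, 0) +
      (z₂.re • fderiv ℝ (φ ∘ M.point) p (1, 0) +
        z₂.im • fderiv ℝ (φ ∘ M.point) p (Complex.I, 0)) := by
    have h3 : ((z₂, 0) : ℂ × ℝ) = z₂.re • (1, 0) + z₂.im • (Complex.I, 0) := by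
      ext1
      · apply Complex.ext <;> simp
      · simp
    have h4 : ((0, 0) : ℂ × ℝ) = 0 := rfl
    simp only [secondOrder, h3, h4, map_zero, add_zero, map_add, map_smul]
  rw [h2, jetNumerator_add, jetNumerator_add, jetNumerator_smul, jetNumerator_smul]
  constructor
  · intro h
    linear_combination h
  · intro h
    linear_combination h

/-- The second order part `z₂ = A + i B` of the 2-jet of `Σ_p` above the 1-jet `z₁`. -/
noncomputable def chainJet (M : AnalyticGraph) (q : (ℂ × ℝ) × ℂ) : ℂ :=
  Classical.epsilon fun z₂ => ∃ φ : OpenPartialHomeomorph (ℂ × ℂ) (ℂ × ℂ),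
    M.IsNormalizing q.1 φ ∧ (q.2, z₂) ∈ M.sigma q.1 φ

/-- The choice hidden in `chainJet` is harmless: `Σ_p` is independent of the normalizing map, and
its equation has a unique solution `z₂`. -/
theorem mem_sigma_iff_eq_chainJet {M : AnalyticGraph} {p : ℂ × ℝ}
    {φ : OpenPartialHomeomorph (ℂ × ℂ) (ℂ × ℂ)} (h : M.IsNormalizing p φ) {z₁ : ℂ}
    (hz : M.CRTransversal p z₁) (z₂ : ℂ) : (z₁, z₂) ∈ M.sigma p φ ↔ z₂ = M.chainJet (p, z₁) := by
  have h1 : ∃ z₂, ∃ φ : OpenPartialHomeomorph (ℂ × ℂ) (ℂ × ℂ), M.IsNormalizing p φ ∧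
      (z₁, z₂) ∈ M.sigma p φ := ⟨_, φ, h, (mem_sigma_iff_eq_solveJet h hz _).2 rfl⟩
  obtain ⟨φ', h', hs⟩ := Classical.epsilon_spec h1
  rw [sigma_eq h' h] at hs
  have h2 := (mem_sigma_iff_eq_solveJet h hz _).1 hs
  rw [mem_sigma_iff_eq_solveJet h hz, ← h2]
  rfl

/-! ### Analyticity -/

theorem analyticAt_ofReal_comp {E : Type*} [NormedAddCommGroup E] [NormedSpace ℝ E] {f : E → ℝ}
    {x : E} (hf : AnalyticAt ℝ f x) : AnalyticAt ℝ (fun y => (f y : ℂ)) x :=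
  (Complex.ofRealCLM.analyticAt _).fun_comp hf

section

variable {E : Type*} [NormedAddCommGroup E] [NormedSpace ℝ E] {x : E}

theorem analyticAt_re_comp {f : E → ℂ} (hf : AnalyticAt ℝ f x) :
    AnalyticAt ℝ (fun y => (f y).re) x :=
  (Complex.reCLM.analyticAt _).fun_comp hf

theorem analyticAt_im_comp {f : E → ℂ} (hf : AnalyticAt ℝ f x) :
    AnalyticAt ℝ (fun y => (f y).im) x :=
  (Complex.imCLM.analyticAt _).fun_comp hf

theorem analyticAt_fst_comp {f : E → ℂ × ℂ} (hf : AnalyticAt ℝ f x) :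
    AnalyticAt ℝ (fun y => (f y).1) x :=
  ((ContinuousLinearMap.fst ℝ ℂ ℂ).analyticAt _).fun_comp hf

theorem analyticAt_snd_comp {f : E → ℂ × ℂ} (hf : AnalyticAt ℝ f x) :
    AnalyticAt ℝ (fun y => (f y).2) x :=
  ((ContinuousLinearMap.snd ℝ ℂ ℂ).analyticAt _).fun_comp hf

theorem analyticAt_jetNumerator {X Y : E → ℂ × ℂ} (hX : AnalyticAt ℝ X x) (hY : AnalyticAt ℝ Y x) :
    AnalyticAt ℝ (fun y => jetNumerator (X y) (Y y)) x :=
  ((analyticAt_ofReal_comp (analyticAt_re_comp (analyticAt_snd_comp hX))).mul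
    (analyticAt_fst_comp hY)).sub
    ((analyticAt_ofReal_comp (analyticAt_re_comp (analyticAt_snd_comp hY))).mul
    (analyticAt_fst_comp hX))

theorem analyticAt_pairDet {α β : E → ℂ} (hα : AnalyticAt ℝ α x) (hβ : AnalyticAt ℝ β x) :
    AnalyticAt ℝ (fun y => pairDet (α y) (β y)) x :=
  ((analyticAt_re_comp hα).mul (analyticAt_im_comp hβ)).sub
    ((analyticAt_im_comp hα).mul (analyticAt_re_comp hβ))

theorem analyticAt_cramerSol {α β w : E → ℂ} (hα : AnalyticAt ℝ α x) (hβ : AnalyticAt ℝ β x)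
    (hw : AnalyticAt ℝ w x) (h : pairDet (α x) (β x) ≠ 0) :
    AnalyticAt ℝ (fun y => cramerSol (α y) (β y) (w y)) x :=
  (analyticAt_ofReal_comp ((analyticAt_pairDet hw hβ).div (analyticAt_pairDet hα hβ) h)).add
    ((analyticAt_ofReal_comp ((analyticAt_pairDet hα hw).div (analyticAt_pairDet hα hβ) h)).mul
      analyticAt_const)

theorem analyticAt_solveJet {X Y V W : E → ℂ × ℂ} (hX : AnalyticAt ℝ X x) (hY : AnalyticAt ℝ Y x)
    (hV : AnalyticAt ℝ V x) (hW : AnalyticAt ℝ W x)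
    (h : pairDet (jetNumerator (X x) (V x)) (jetNumerator (X x) (W x)) ≠ 0) :
    AnalyticAt ℝ (fun y => solveJet (X y) (Y y) (V y) (W y)) x := by
  have hX1 := analyticAt_fst_comp hX
  exact analyticAt_cramerSol (analyticAt_jetNumerator hX hV) (analyticAt_jetNumerator hX hW)
    (((analyticAt_const.mul (hX1.mul hX1.conj_complex)).mul hX1).sub
      (analyticAt_jetNumerator hX hY)) h

end

section PartialDerivatives

variable {E F : Type*} [NormedAddCommGroup E] [NormedSpace ℝ E] [NormedAddCommGroup F]
  [NormedSpace ℝ F] {G : E × E → F}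

theorem fderiv_slice {p q : E} (hG : DifferentiableAt ℝ G (p, q)) (v : E) :
    fderiv ℝ (fun q => G (p, q)) q v = fderiv ℝ G (p, q) (0, v) := by
  have h1 : HasFDerivAt (fun q : E => (p, q)) (ContinuousLinearMap.inr ℝ E E) q :=
    hasFDerivAt_prodMk_right p q
  exact DFunLike.congr_fun (hG.hasFDerivAt.comp q h1).fderiv v

theorem fderiv_fderiv_slice {p : E} (hG : ContDiffAt ℝ 2 G (p, p)) (v w : E) :
    fderiv ℝ (fderiv ℝ fun q => G (p, q)) p v w =
      fderiv ℝ (fderiv ℝ G) (p, p) (0, v) (0, w) := by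
  have h1 : ∀ q : E, HasFDerivAt (fun q : E => (p, q)) (ContinuousLinearMap.inr ℝ E E) q :=
    fun q => hasFDerivAt_prodMk_right p q
  have h2 : fderiv ℝ (fun q => G (p, q)) =ᶠ[𝓝 p]
      fun q => (fderiv ℝ G (p, q)).comp (ContinuousLinearMap.inr ℝ E E) := by
    have h3 : Tendsto (fun q : E => (p, q)) (𝓝 p) (𝓝 (p, p)) := (h1 p).continuousAt
    filter_upwards [h3.eventually (hG.eventually (by simp))] with q hq
    exact ((hq.differentiableAt (by simp)).hasFDerivAt.comp q (h1 q)).fderiv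
  have h3 : DifferentiableAt ℝ (fderiv ℝ G) (p, p) :=
    (hG.fderiv_right (m := 1) (by norm_num)).differentiableAt (by simp)
  have h4 := (h3.hasFDerivAt.comp p (h1 p)).clm_comp
    (hasFDerivAt_const (ContinuousLinearMap.inr ℝ E E) p)
  rw [h2.fderiv_eq]
  erw [h4.fderiv]
  simp

end PartialDerivatives

/-- Near the given jet `chainJet` coincides with Cramer's formula for the analytic family of
normalizing maps, evaluated on the diagonal (map at `p`, derivatives taken at `p`). -/
theorem analyticAt_chainJet {M : AnalyticGraph} (hM : M.LeviNondegenerate) {q₀ : (ℂ × ℝ) × ℂ}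
    (hq : q₀ ∈ M.transversalJets) : AnalyticAt ℝ M.chainJet q₀ := by
  obtain ⟨p₀, z₀⟩ := q₀
  obtain ⟨Φ, hΦ, hn⟩ := M.exists_analytic_normalizing hM hq.1
  set G : (ℂ × ℝ) × (ℂ × ℝ) → ℂ × ℂ := fun x => Φ x.1 (M.point x.2) with hG
  have hp : AnalyticAt ℝ (fun q : (ℂ × ℝ) × ℂ => (q.1, q.1)) (p₀, z₀) :=
    analyticAt_fst.prod analyticAt_fst
  have hD : AnalyticAt ℝ (fun q : (ℂ × ℝ) × ℂ => fderiv ℝ G (q.1, q.1)) (p₀, z₀) :=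
    AnalyticAt.fun_comp (g := fderiv ℝ G) hΦ.fderiv hp
  have hDD : AnalyticAt ℝ (fun q : (ℂ × ℝ) × ℂ => fderiv ℝ (fderiv ℝ G) (q.1, q.1)) (p₀, z₀) :=
    AnalyticAt.fun_comp (g := fderiv ℝ (fderiv ℝ G)) hΦ.fderiv.fderiv hp
  have hv : AnalyticAt ℝ (fun q : (ℂ × ℝ) × ℂ => (((0 : ℂ × ℝ), (q.2, (1 : ℝ))) :
      (ℂ × ℝ) × (ℂ × ℝ))) (p₀, z₀) :=
    analyticAt_const.prod (analyticAt_snd.prod analyticAt_const)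
  have hev : ∀ᶠ q : (ℂ × ℝ) × ℂ in 𝓝 (p₀, z₀), ContDiffAt ℝ 2 G (q.1, q.1) :=
    hp.continuousAt.eventually (hΦ.contDiffAt.eventually (by simp))
  have hev' : ∀ᶠ q : (ℂ × ℝ) × ℂ in 𝓝 (p₀, z₀), ∃ e : OpenPartialHomeomorph (ℂ × ℂ) (ℂ × ℂ),
      (e : ℂ × ℂ → ℂ × ℂ) = Φ q.1 ∧ M.IsNormalizing q.1 e :=
    continuousAt_fst.eventually hn
  let X : (ℂ × ℝ) × ℂ → ℂ × ℂ := fun q => fderiv ℝ G (q.1, q.1) (0, (q.2, 1))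
  let Y : (ℂ × ℝ) × ℂ → ℂ × ℂ := fun q =>
    fderiv ℝ (fderiv ℝ G) (q.1, q.1) (0, (q.2, 1)) (0, (q.2, 1))
  let V : (ℂ × ℝ) × ℂ → ℂ × ℂ := fun q => fderiv ℝ G (q.1, q.1) (0, (1, 0))
  let W : (ℂ × ℝ) × ℂ → ℂ × ℂ := fun q => fderiv ℝ G (q.1, q.1) (0, (Complex.I, 0))
  have hX : ∀ q : (ℂ × ℝ) × ℂ, ContDiffAt ℝ 2 G (q.1, q.1) → ∀ e : ℂ × ℂ → ℂ × ℂ, e = Φ q.1 →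
      firstOrder (e ∘ M.point) q.1 q.2 = X q ∧ secondOrder (e ∘ M.point) q.1 (q.2, 0) = Y q ∧
      fderiv ℝ (e ∘ M.point) q.1 (1, 0) = V q ∧ fderiv ℝ (e ∘ M.point) q.1 (Complex.I, 0) = W q := by
    rintro q hc e rfl
    have hd := hc.differentiableAt (by simp)
    have e1 : Φ q.1 ∘ M.point = fun x => G (q.1, x) := rfl
    refine ⟨?_, ?_, ?_, ?_⟩
    · rw [firstOrder, e1, fderiv_slice hd]
    · rw [secondOrder, e1, fderiv_fderiv_slice hc, fderiv_slice hd]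
      change _ + fderiv ℝ G (q.1, q.1) 0 = _
      rw [map_zero, add_zero]
    · rw [e1, fderiv_slice hd]
    · rw [e1, fderiv_slice hd]
  have hdet : pairDet (jetNumerator (X (p₀, z₀)) (V (p₀, z₀)))
      (jetNumerator (X (p₀, z₀)) (W (p₀, z₀))) ≠ 0 := by
    obtain ⟨e, he, hne⟩ := hev'.self_of_nhds
    obtain ⟨N, hN, hloc⟩ := hne
    obtain ⟨e1, -, e3, e4⟩ := hX (p₀, z₀) hev.self_of_nhds e he
    rw [← e1, ← e3, ← e4]
    exact hloc.pairDet_ne_zero (hloc.imageParamByU hN hq.2)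
  have hsol : AnalyticAt ℝ (fun q => solveJet (X q) (Y q) (V q) (W q)) (p₀, z₀) :=
    analyticAt_solveJet (hD.clm_apply_fun hv) ((hDD.clm_apply_fun hv).clm_apply_fun hv)
      (hD.clm_apply_fun analyticAt_const) (hD.clm_apply_fun analyticAt_const) hdet
  refine hsol.congr ?_
  filter_upwards [hev, hev', M.isOpen_transversalJets.mem_nhds hq] with q h1 h2 h3
  obtain ⟨e, he, hne⟩ := h2
  obtain ⟨e1, e2, e3, e4⟩ := hX q h1 e he
  rw [← mem_sigma_iff_eq_chainJet hne h3.2, mem_sigma_iff_eq_solveJet hne h3.2, e1, e2, e3, e4]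

end AnalyticGraph

/-! ### Invariance -/

namespace AnalyticGraph

theorem exists_normalizing {M : AnalyticGraph} (hM : M.LeviNondegenerate) {p : ℂ × ℝ}
    (hp : p ∈ M.Ω) : ∃ φ : OpenPartialHomeomorph (ℂ × ℂ) (ℂ × ℂ), M.IsNormalizing p φ := by
  obtain ⟨_, _, hn⟩ := M.exists_analytic_normalizing hM hp
  obtain ⟨e, -, he⟩ := hn.self_of_nhds
  exact ⟨e, he⟩

theorem IsLocalBiholomorphism.prolong_chainJet {h : OpenPartialHomeomorph (ℂ × ℂ) (ℂ × ℂ)}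
    {M M' : AnalyticGraph} {p p' : ℂ × ℝ} (hh : IsLocalBiholomorphism h M p M' p')
    (hM' : M'.LeviNondegenerate) {z₁ : ℂ} (hz : M.CRTransversal p z₁)
    (h0 : M.ImageParamByU h p z₁) : ∃ z₁', M'.CRTransversal p' z₁' ∧
      M.prolong h p (z₁, M.chainJet (p, z₁)) = (z₁', M'.chainJet (p', z₁')) := by
  obtain ⟨φ, hφ⟩ := exists_normalizing hM' hh.mem'
  obtain ⟨N, hN, hloc⟩ := id hφ
  -- Pulling back a normalizing map of the target gives one of the source; independence of the
  -- choice then yields invariance.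
  have hn : M.IsNormalizing p (h.trans φ) := ⟨N, hN, hh.trans hloc⟩
  have h1 := ((mem_sigma_iff_eq_chainJet hn hz _).2 rfl).2
  rw [hh.prolong_trans hloc _ h0 ((hh.trans hloc).imageParamByU hN hz)] at h1
  have h2 := hh.CRTransversal_map hz h0 (M.chainJet (p, z₁))
  exact ⟨_, h2, Prod.ext rfl ((mem_sigma_iff_eq_chainJet hφ h2 _).1 ⟨h2, h1⟩)⟩

/-! ### Chains -/

/-- The vector field on the space of 1-jets whose integral curves are the lifts of chains. -/
noncomputable def chainField (M : AnalyticGraph) (q : (ℂ × ℝ) × ℂ) : (ℂ × ℝ) × ℂ :=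
  ((q.2, 1), M.chainJet q)

theorem contDiffAt_chainField {M : AnalyticGraph} (hM : M.LeviNondegenerate) {q : (ℂ × ℝ) × ℂ}
    (hq : q ∈ M.transversalJets) : ContDiffAt ℝ 1 M.chainField q :=
  ((analyticAt_snd.prod analyticAt_const).prod (analyticAt_chainJet hM hq)).contDiffAt

/-- The lift of the curve `u ↦ ζ(u)` to the space of 1-jets. -/
noncomputable def jetLift (ζ : ℝ → ℂ) (t : ℝ) : (ℂ × ℝ) × ℂ := ((ζ t, t), deriv ζ t)

theorem SolvesODE.hasDerivAt_jetLift {M : AnalyticGraph} {I : Set ℝ} {ζ : ℝ → ℂ}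
    (h : M.SolvesODE (fun q => (M.chainJet q).re) (fun q => (M.chainJet q).im) I ζ) {t : ℝ}
    (ht : t ∈ I) : HasDerivAt (jetLift ζ) (M.chainField (jetLift ζ t)) t := by
  obtain ⟨-, h1, h2, h3⟩ := h t ht
  have h4 : HasDerivAt (deriv ζ) (M.chainJet (jetLift ζ t)) t := by
    have := h2.ofReal_comp.add (h3.ofReal_comp.mul_const Complex.I)
    rw [Complex.re_add_im] at this
    refine this.congr_of_eventuallyEq (Eventually.of_forall fun s => ?_)
    exact (Complex.re_add_im _).symm
  exact (h1.hasDerivAt.prodMk (hasDerivAt_id t)).prodMk h4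

theorem exists_solvesODE {M : AnalyticGraph} (hM : M.LeviNondegenerate) {p : ℂ × ℝ}
    (hp : p ∈ M.Ω) {z₁ : ℂ} (hz : M.CRTransversal p z₁) :
    ∃ ε > 0, ∃ ζ : ℝ → ℂ, M.SolvesODE (fun q => (M.chainJet q).re) (fun q => (M.chainJet q).im)
      (Ioo (p.2 - ε) (p.2 + ε)) ζ ∧ ζ p.2 = p.1 ∧ deriv ζ p.2 = z₁ := by
  have hq : (p, z₁) ∈ M.transversalJets := ⟨hp, hz⟩
  obtain ⟨α, h0, ε, hε, hα⟩ :=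
    (contDiffAt_chainField hM hq).exists_forall_mem_closedBall_exists_eq_forall_mem_Ioo_hasDerivAt₀
      p.2
  have hmem : p.2 ∈ Ioo (p.2 - ε) (p.2 + ε) := ⟨by linarith, by linarith⟩
  have hd : ∀ t ∈ Ioo (p.2 - ε) (p.2 + ε), HasDerivAt (fun s => (α s).1.1) (α t).2 t ∧
      HasDerivAt (fun s => (α s).1.2) 1 t ∧
      HasDerivAt (fun s => (α s).2) (M.chainJet (α t)) t := by
    intro t ht
    exact ⟨(ContinuousLinearMap.fst ℝ ℂ ℝ ∘L ContinuousLinearMap.fst ℝ (ℂ × ℝ) ℂ).hasFDerivAt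
        |>.comp_hasDerivAt t (hα t ht),
      (ContinuousLinearMap.snd ℝ ℂ ℝ ∘L ContinuousLinearMap.fst ℝ (ℂ × ℝ) ℂ).hasFDerivAt
        |>.comp_hasDerivAt t (hα t ht),
      (ContinuousLinearMap.snd ℝ (ℂ × ℝ) ℂ).hasFDerivAt.comp_hasDerivAt t (hα t ht)⟩
  -- The `u`-component of the field is `1`, so the flow time is `u` itself and the integral curve is
  -- the jet lift of its `z`-component.
  have hu : ∀ t ∈ Ioo (p.2 - ε) (p.2 + ε), (α t).1.2 = t := by
    intro t ht
    have h1 := isOpen_Ioo.eqOn_of_deriv_eq isPreconnected_Ioo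
      (f := fun s => (α s).1.2) (g := fun s => s)
      (fun s hs => (hd s hs).2.1.differentiableAt.differentiableWithinAt) differentiableOn_id
      (fun s hs => by rw [(hd s hs).2.1.deriv]; exact (deriv_id s).symm) hmem (by simp [h0])
    exact h1 ht
  have hderiv : ∀ t ∈ Ioo (p.2 - ε) (p.2 + ε), deriv (fun s => (α s).1.1) t = (α t).2 :=
    fun t ht => (hd t ht).1.deriv
  have hlift : ∀ t ∈ Ioo (p.2 - ε) (p.2 + ε),
      (((α t).1.1, t), deriv (fun s => (α s).1.1) t) = α t := by
    intro t ht
    rw [hderiv t ht]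
    exact Prod.ext (Prod.ext rfl (hu t ht).symm) rfl
  -- The interval is shrunk so that the solution stays in the open set of transversal jets.
  have hev : ∀ᶠ t in 𝓝 p.2, α t ∈ M.transversalJets :=
    (hα p.2 hmem).continuousAt.eventually (by
      rw [h0]
      exact M.isOpen_transversalJets.mem_nhds hq)
  obtain ⟨δ, hδ, hδ'⟩ := Metric.eventually_nhds_iff_ball.1 hev
  rw [Real.ball_eq_Ioo] at hδ'
  refine ⟨min ε δ, lt_min hε hδ, fun s => (α s).1.1, ?_, by simp [h0], by rw [hderiv _ hmem, h0]⟩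
  intro t ht
  have ht1 : t ∈ Ioo (p.2 - ε) (p.2 + ε) :=
    ⟨by linarith [ht.1, min_le_left ε δ], by linarith [ht.2, min_le_left ε δ]⟩
  have ht2 : t ∈ Ioo (p.2 - δ) (p.2 + δ) :=
    ⟨by linarith [ht.1, min_le_right ε δ], by linarith [ht.2, min_le_right ε δ]⟩
  have h2 : HasDerivAt (deriv fun s => (α s).1.1) (M.chainJet (α t)) t := by
    refine (hd t ht1).2.2.congr_of_eventuallyEq ?_
    filter_upwards [isOpen_Ioo.mem_nhds ht1] with s hs
    exact hderiv s hs
  rw [hlift t ht1]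
  exact ⟨hδ' t ht2, (hd t ht1).1.differentiableAt,
    Complex.reCLM.hasFDerivAt.comp_hasDerivAt t h2, Complex.imCLM.hasFDerivAt.comp_hasDerivAt t h2⟩

theorem SolvesODE.eqOn {M : AnalyticGraph} (hM : M.LeviNondegenerate) {a b t₀ : ℝ} {ζ ζ' : ℝ → ℂ}
    (ht₀ : t₀ ∈ Ioo a b)
    (h : M.SolvesODE (fun q => (M.chainJet q).re) (fun q => (M.chainJet q).im) (Ioo a b) ζ)
    (h' : M.SolvesODE (fun q => (M.chainJet q).re) (fun q => (M.chainJet q).im) (Ioo a b) ζ')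
    (h0 : ζ t₀ = ζ' t₀) (h1 : deriv ζ t₀ = deriv ζ' t₀) : EqOn ζ ζ' (Ioo a b) := by
  have hloc : ∀ t ∈ Ioo a b, jetLift ζ t = jetLift ζ' t → jetLift ζ =ᶠ[𝓝 t] jetLift ζ' := by
    intro t ht heq
    obtain ⟨K, s, hs, hK⟩ := (contDiffAt_chainField hM (h t ht).1).exists_lipschitzOnWith
    have e1 : ∀ᶠ x in 𝓝 t, jetLift ζ x ∈ s :=
      (h.hasDerivAt_jetLift ht).continuousAt.eventually hs
    have e2 : ∀ᶠ x in 𝓝 t, jetLift ζ' x ∈ s := by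
      refine (h'.hasDerivAt_jetLift ht).continuousAt.eventually ?_
      rw [← heq]
      exact hs
    have e3 : ∀ᶠ x in 𝓝 t, x ∈ Ioo a b := isOpen_Ioo.mem_nhds ht
    refine ODE_solution_unique_of_eventually (v := fun _ => M.chainField) (s := fun _ => s)
      (K := K) (Eventually.of_forall fun _ => hK) ?_ ?_ heq
    · filter_upwards [e1, e3] with x h1 h2
      exact ⟨h.hasDerivAt_jetLift h2, h1⟩
    · filter_upwards [e2, e3] with x h1 h2
      exact ⟨h'.hasDerivAt_jetLift h2, h1⟩
  -- Connectedness: the set where the lifts agree locally is open, and by continuity a limit point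
  -- of it in the interval is again a point of agreement, to which local uniqueness applies.
  have key : Ioo a b ⊆ {t | jetLift ζ =ᶠ[𝓝 t] jetLift ζ'} := by
    refine isPreconnected_Ioo.subset_of_closure_inter_subset isOpen_setOfPred_eventually_nhds
      ⟨t₀, ht₀, hloc t₀ ht₀ ?_⟩ ?_
    · simp only [jetLift, h0, h1]
    · rintro t ⟨htc, ht⟩
      refine hloc t ht ?_
      have hf := mem_closure_iff_frequently.1 htc
      by_contra hne
      have h2 := ((h.hasDerivAt_jetLift ht).continuousAt.ne_iff_eventually_ne
        (h'.hasDerivAt_jetLift ht).continuousAt).1 hne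
      obtain ⟨x, hx1, hx2⟩ := (hf.and_eventually h2).exists
      exact hx2 (EventuallyEq.eq_of_nhds hx1)
  intro t ht
  have h2 : jetLift ζ t = jetLift ζ' t := EventuallyEq.eq_of_nhds (key ht)
  exact congrArg (fun q => q.1.1) h2

end AnalyticGraph

/-- The functions `A M` and `B M` of `(u, x, y, x₁, y₁)` are written as functions of
`((x + i y, u), x₁ + i y₁)`, and 2-jets as pairs `(x₁ + i y₁, x₂ + i y₂)`. -/
theorem proposition8p2 :
    -- normalizing maps exist at every point
    (∀ M : AnalyticGraph, M.LeviNondegenerate → ∀ p ∈ M.Ω,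
      ∃ φ : OpenPartialHomeomorph (ℂ × ℂ) (ℂ × ℂ), M.IsNormalizing p φ) ∧
    -- the surface `Σ_p` does not depend on the normalizing map
    (∀ M : AnalyticGraph, M.LeviNondegenerate → ∀ p ∈ M.Ω,
      ∀ φ φ' : OpenPartialHomeomorph (ℂ × ℂ) (ℂ × ℂ),
        M.IsNormalizing p φ → M.IsNormalizing p φ' → M.sigma p φ = M.sigma p φ') ∧
    ∃ A B : AnalyticGraph → (ℂ × ℝ) × ℂ → ℝ,
      -- `A` and `B` are real-analytic on the space of CR-transversal 1-jets
      (∀ M : AnalyticGraph, M.LeviNondegenerate →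
        IsOpen M.transversalJets ∧
        AnalyticOnNhd ℝ (A M) M.transversalJets ∧ AnalyticOnNhd ℝ (B M) M.transversalJets) ∧
      -- `Σ_p` is the graph `x₂ = A`, `y₂ = B` over the CR-transversal 1-jets at `p`
      (∀ M : AnalyticGraph, M.LeviNondegenerate → ∀ p ∈ M.Ω,
        ∀ φ : OpenPartialHomeomorph (ℂ × ℂ) (ℂ × ℂ), M.IsNormalizing p φ →
          M.sigma p φ =
            {j | M.CRTransversal p j.1 ∧ j.2.re = A M (p, j.1) ∧ j.2.im = B M (p, j.1)}) ∧
      -- the assignment of a 2-jet to a 1-jet is biholomorphically invariant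
      (∀ M M' : AnalyticGraph, M.LeviNondegenerate → M'.LeviNondegenerate →
        ∀ (p p' : ℂ × ℝ) (h : OpenPartialHomeomorph (ℂ × ℂ) (ℂ × ℂ)),
          AnalyticGraph.IsLocalBiholomorphism h M p M' p' →
          ∀ z₁ : ℂ, M.CRTransversal p z₁ → M.ImageParamByU h p z₁ →
            ∃ z₁' : ℂ, M'.CRTransversal p' z₁' ∧
              M.prolong h p (z₁, ⟨A M (p, z₁), B M (p, z₁)⟩) =
                (z₁', ⟨A M' (p', z₁'), B M' (p', z₁')⟩)) ∧
      -- Moser chains: existence and uniqueness for `ẍ = A`, `ÿ = B` with a given initial 1-jet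
      (∀ M : AnalyticGraph, M.LeviNondegenerate → ∀ p ∈ M.Ω, ∀ z₁ : ℂ, M.CRTransversal p z₁ →
        (∃ ε > 0, ∃ ζ : ℝ → ℂ, M.SolvesODE (A M) (B M) (Set.Ioo (p.2 - ε) (p.2 + ε)) ζ ∧
          ζ p.2 = p.1 ∧ deriv ζ p.2 = z₁) ∧
        (∀ (a b : ℝ) (ζ ζ' : ℝ → ℂ), p.2 ∈ Set.Ioo a b →
          M.SolvesODE (A M) (B M) (Set.Ioo a b) ζ → M.SolvesODE (A M) (B M) (Set.Ioo a b) ζ' →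
          ζ p.2 = p.1 → deriv ζ p.2 = z₁ → ζ' p.2 = p.1 → deriv ζ' p.2 = z₁ →
          Set.EqOn ζ ζ' (Set.Ioo a b))) := by
  refine ⟨fun M hM p hp => AnalyticGraph.exists_normalizing hM hp,
    fun M _ p _ φ φ' h h' => AnalyticGraph.sigma_eq h h',
    fun M q => (M.chainJet q).re, fun M q => (M.chainJet q).im,
    fun M hM => ⟨M.isOpen_transversalJets, fun q hq =>
      AnalyticGraph.analyticAt_re_comp (AnalyticGraph.analyticAt_chainJet hM hq), fun q hq =>
      AnalyticGraph.analyticAt_im_comp (AnalyticGraph.analyticAt_chainJet hM hq)⟩, ?_, ?_, ?_⟩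
  · rintro M hM p hp φ hφ
    ext ⟨z₁, z₂⟩
    constructor
    · intro hj
      have h1 := (AnalyticGraph.mem_sigma_iff_eq_chainJet hφ hj.1 z₂).1 hj
      exact ⟨hj.1, congrArg Complex.re h1, congrArg Complex.im h1⟩
    · rintro ⟨h1, h2, h3⟩
      exact (AnalyticGraph.mem_sigma_iff_eq_chainJet hφ h1 z₂).2 (Complex.ext h2 h3)
  · intro M M' _ hM' p p' h hh z₁ hz h0
    exact hh.prolong_chainJet hM' hz h0
  · intro M hM p hp z₁ hz
    refine ⟨AnalyticGraph.exists_solvesODE hM hp hz, ?_⟩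
    intro a b ζ ζ' hab h h' h0 h1 h0' h1'
    exact h.eqOn hM hab h' (h0.trans h0'.symm) (h1.trans h1'.symm)
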